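/- **Conventions.** Manifolds are smooth and finite-dimensional; $M$ is a Hausdorff manifold, while all other manifolds (spaces of arrows, bitorsors) may be non-Hausdorff. A *Lie groupoid* $G$ over $M$ is a groupoid with object manifold $M$ whose arrows form a manifold $G$, with source and target $s,t:G\to M$ submersions and smooth composition, units and inverses; $G_T$ denotes the set of arrows with source and target in $T\subseteq M$. A *bundle of Lie groups* $K$ over $M$ is a Lie groupoid over $M$ with $s=t$. An *extension* $K\xrightarrow{\,j\,}G\xrightarrow{\,\pi\,}E$ over $M$ consists of Lie groupoids over $M$, with $K$ a bundle of Lie groups, and smooth homomorphisms $j,\pi$ that are the identity on objects, such that $j$ is an embedding, $\pi$ is a surjective submersion, and the image of $j$ is the kernel of $\pi$ (the set of arrows that $\pi$ maps to units). An isomorphism of extensions of $E$ by $K$ is an isomorphism of Lie groupoids $G\to G'$, the identity on objects, compatible with the maps from $K$ and to $E$. $E$ is *regular* if its anchor map $\ker(ds)|_M\to TM$ (induced by $dt$) has locally constant rank; its images are then the tangent spaces of the *orbit foliation*, whose leaves are the connected components of the orbits of $E$. A *complete transversal* is an embedded submanifold $T\subseteq M$ whose tangent spaces are complementary to those of the orbit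 foliation and which meets every leaf. Any extension $K\to G\to E$ then restricts to an extension $K_T\to G_T\to E_T$ of Lie groupoids over $T$. A $K$-$K$ *bitorsor* over $M$ is a manifold $P$ with a surjective submersion $P\to M$ and commuting smooth fibrewise left and right actions of $K$ such that $(p,k)\mapsto(p,pk)$ is a diffeomorphism $P\times_MK\to P\times_MP$ and $(k,p)\mapsto(kp,p)$ is a diffeomorphism $K\times_MP\to P\times_MP$. For $q,p$ in the same fibre, $q^{-1}p\in K$ is defined by $q\,(q^{-1}p)=p$. A *central section* of $P$ over $T$ is a smooth map $\alpha:T\to P$ with $\alpha(x)\in P_x$ and $\alpha(x)k=k\,\alpha(x)$ for all $x\in T$, $k\in K_x$. Given a $K$-$K$ bitorsor $P$ and an extension $K\xrightarrow{j}H\xrightarrow{\rho}E$, the arrows $x\to y$ of $P\otimes_KH\otimes_KP^{-1}$ are the classes $q\otimes h\otimes p^{-1}$ of triples with $q\in P_y$, $h:x\to y$ in $H$, $p\in P_x$, for the equivalence relation generated by $(qk,h,p^{-1})\sim(q,j(k)h,p^{-1})$ and $(q,h\,j(l),p^{-1})\sim(q,h,(p\,l^{-1})^{-1})$. Composition is $(r\otimes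 h'\otimes s^{-1})(q\otimes h\otimes p^{-1})=r\otimes h'\,j(s^{-1}q)\,h\otimes p^{-1}$. With the quotient manifold structure (the one for which the projection from the manifold of triples is a submersion) it is a Lie groupoid over $M$, and it is an extension $K\xrightarrow{j_P}P\otimes_KH\otimes_KP^{-1}\xrightarrow{\rho_P}E$ by $j_P(k)=kq\otimes 1_x\otimes q^{-1}$ (for $k\in K_x$ and any $q\in P_x$) and $\rho_P(q\otimes h\otimes p^{-1})=\rho(h)$. A central section $\alpha$ over $T$ induces $\hat\alpha:H_T\to(P\otimes_KH\otimes_KP^{-1})_T$, $\hat\alpha(h)=\alpha(y)\otimes h\otimes\alpha(x)^{-1}$ for $h:x\to y$. **Proposition 4.7.** Let $E$ be a regular Lie groupoid over $M$, $K$ a bundle of Lie groups over $M$, and $T\subseteq M$ a complete transversal to the orbit foliation of $E$. Let $K\to G\to E$ and $K\to H\to E$ be two extensions over $M$, and let $\phi:H_T\to G_T$ be an isomorphism between the restricted extensions $K_T\to H_T\to E_T$ and $K_T\to G_T\to E_T$. Then there exist a $K$-$K$ bitorsor $P$ over $M$ with a central section $\alpha$ over $T$, and an isomorphism of extensions $$\psi:P\otimes_KH\otimes_KP^{-1}\longrightarrow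 G$$ such that $\psi_T\circ\hat\alpha=\phi:H_T\to G_T$. -/

import Mathlib

open scoped Manifold ContDiff Topology

universe u

namespace LieExt

/-! ### Manifolds and smoothness

Manifolds are smooth, finite-dimensional, without boundary, and not necessarily Hausdorff. -/

/-- A smooth manifold structure of some dimension `dim` on a type. -/
structure MfdStr (X : Type u) where
  dim : ℕ
  top : TopologicalSpace X
  charted : ChartedSpace (EuclideanSpace ℝ (Fin dim)) X
  smooth : IsManifold (𝓡 dim) ∞ X

/-- A smooth manifold. -/
structure Mfd where
  carrier : Type u
  str : MfdStr carrier

instance : CoeSort Mfd.{u} (Type u) := ⟨Mfd.carrier⟩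

/-- The dimension of a manifold. -/
abbrev Mfd.dim (X : Mfd.{u}) : ℕ := X.str.dim

instance (X : Mfd.{u}) : TopologicalSpace X := X.str.top

instance (X : Mfd.{u}) : ChartedSpace (EuclideanSpace ℝ (Fin X.dim)) X := X.str.charted

instance (X : Mfd.{u}) : IsManifold (𝓡 X.dim) ∞ X := X.str.smooth

/-- The model of a manifold. -/
noncomputable abbrev Mfd.model (X : Mfd.{u}) :
    ModelWithCorners ℝ (EuclideanSpace ℝ (Fin X.dim)) (EuclideanSpace ℝ (Fin X.dim)) := 𝓡 X.dim

section Subsets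

variable {EX HX EY HY : Type*} [NormedAddCommGroup EX] [NormedSpace ℝ EX] [TopologicalSpace HX]
  [NormedAddCommGroup EY] [NormedSpace ℝ EY] [TopologicalSpace HY]
  (I : ModelWithCorners ℝ EX HX) (J : ModelWithCorners ℝ EY HY)
  {X Y : Type*} [TopologicalSpace X] [ChartedSpace HX X] [TopologicalSpace Y] [ChartedSpace HY Y]

/-- Smoothness of a map `f : A → Y` defined on a subset `A` of a manifold `X` (in use below only
for embedded submanifolds `A`, where it is smoothness for the induced manifold structure).
All extensions `F` of `f` agree on `A`, so that `ContMDiffOn` does not depend on `F`. -/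
def SmoothFrom (A : Set X) (f : A → Y) : Prop :=
  ∀ F : X → Y, (∀ a : A, F a = f a) → ContMDiffOn I J ∞ F A

/-- A map `f : A → Y` defined on an embedded submanifold `A` of `X` is a submersion: it is smooth,
and through every point of `A` there passes a smooth local section of `f`. -/
def IsSubmersionFrom (A : Set X) (f : A → Y) : Prop :=
  SmoothFrom I J A f ∧
  ∀ a : A, ∃ U : Set Y, IsOpen U ∧ f a ∈ U ∧ ∃ σ : Y → X,
    ContMDiffOn J I ∞ σ U ∧ σ (f a) = a ∧ ∀ y ∈ U, ∃ h : σ y ∈ A, f ⟨σ y, h⟩ = y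

end Subsets

/-! ### Groupoids and Lie groupoids -/

/-- A groupoid with set of objects `M` and set of arrows `A`. The composition `mul g h` is
meaningful only if `src g = tgt h`; its other values are junk, and no condition involves them. -/
structure GroupoidOn (M A : Type u) where
  src : A → M
  tgt : A → M
  one : M → A
  inv : A → A
  mul : A → A → A
  src_one : ∀ x, src (one x) = x
  tgt_one : ∀ x, tgt (one x) = x
  src_inv : ∀ g, src (inv g) = tgt g
  tgt_inv : ∀ g, tgt (inv g) = src g
  src_mul : ∀ g h, src g = tgt h → src (mul g h) = src h
  tgt_mul : ∀ g h, src g = tgt h → tgt (mul g h) = tgt g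
  mul_assoc : ∀ f g h, src f = tgt g → src g = tgt h → mul (mul f g) h = mul f (mul g h)
  one_mul : ∀ g, mul (one (tgt g)) g = g
  mul_one : ∀ g, mul g (one (src g)) = g
  inv_mul : ∀ g, mul (inv g) g = one (src g)
  mul_inv : ∀ g, mul g (inv g) = one (tgt g)

/-- The smoothness conditions of a Lie groupoid. -/
structure IsLie {M A : Mfd.{u}} (C : GroupoidOn M A) : Prop where
  src_submersion : Manifold.IsSubmersion A.model M.model ∞ C.src
  tgt_submersion : Manifold.IsSubmersion A.model M.model ∞ C.tgt
  one_smooth : ContMDiff M.model A.model ∞ C.one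
  inv_smooth : ContMDiff A.model A.model ∞ C.inv
  mul_smooth : ContMDiffOn (A.model.prod A.model) A.model ∞
    (fun z : A × A => C.mul z.1 z.2) {z | C.src z.1 = C.tgt z.2}

/-- A Lie groupoid over the manifold `M`, with manifold of arrows `Arr`. -/
structure LieGroupoid (M : Mfd.{u}) where
  Arr : Mfd.{u}
  toGroupoidOn : GroupoidOn M Arr
  isLie : IsLie toGroupoidOn

namespace LieGroupoid

variable {M : Mfd.{u}} (G : LieGroupoid M)

abbrev src : G.Arr → M := G.toGroupoidOn.src
abbrev tgt : G.Arr → M := G.toGroupoidOn.tgt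
abbrev one : M → G.Arr := G.toGroupoidOn.one
abbrev inv : G.Arr → G.Arr := G.toGroupoidOn.inv
abbrev mul : G.Arr → G.Arr → G.Arr := G.toGroupoidOn.mul

/-- The image in `T_x M` of the anchor map of the Lie algebroid of `G`, that is, of the map
`d tgt : ker (d src) → T_x M` at the unit `1_x`. -/
noncomputable def anchorImage (x : M) : Submodule ℝ (TangentSpace M.model x) :=
  let ds : EuclideanSpace ℝ (Fin G.Arr.dim) →L[ℝ] EuclideanSpace ℝ (Fin M.dim) :=
    mfderiv G.Arr.model M.model G.src (G.one x)
  let dt : EuclideanSpace ℝ (Fin G.Arr.dim) →L[ℝ] EuclideanSpace ℝ (Fin M.dim) :=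
    mfderiv G.Arr.model M.model G.tgt (G.one x)
  (LinearMap.ker ds.toLinearMap).map dt.toLinearMap

/-- `G` is regular: its anchor map has locally constant rank, so that the images of the anchor map
are the tangent spaces of a foliation of `M`, the orbit foliation. -/
def IsRegular : Prop :=
  IsLocallyConstant fun x : M => Module.finrank ℝ (G.anchorImage x)

/-- The leaf through `x` of the orbit foliation, that is, the connected component of `x` in its
orbit `tgt (src ⁻¹ x)`. Here the orbit has its own manifold topology, the quotient topology of
`src ⁻¹ x`, so that this component is the image of the component of `1_x` in `src ⁻¹ x`. -/
def leaf (x : M) : Set M :=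
  G.tgt '' connectedComponentIn (G.src ⁻¹' {x}) (G.one x)

/-- `T` is a complete transversal to the orbit foliation of `G`: an (embedded) submanifold of `M`
whose tangent spaces are complementary to those of the foliation and which meets every leaf. -/
def IsCompleteTransversal (T : Set M) : Prop :=
  (∃ (q : ℕ) (_ : ChartedSpace (EuclideanSpace ℝ (Fin q)) T) (_ : IsManifold (𝓡 q) ∞ T),
    Manifold.IsSmoothEmbedding (𝓡 q) M.model ∞ (Subtype.val : T → M) ∧
    ∀ x : T, IsCompl (LinearMap.range (mfderiv (𝓡 q) M.model (Subtype.val : T → M) x).toLinearMap)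
      (G.anchorImage (x : M))) ∧
  ∀ x : M, (G.leaf x ∩ T).Nonempty

end LieGroupoid

/-- A smooth homomorphism of Lie groupoids over `M` which is the identity on objects (it preserves
units and inverses automatically). -/
structure IsHom {M : Mfd.{u}} (G H : LieGroupoid M) (f : G.Arr → H.Arr) : Prop where
  smooth : ContMDiff G.Arr.model H.Arr.model ∞ f
  map_src : ∀ g, H.src (f g) = G.src g
  map_tgt : ∀ g, H.tgt (f g) = G.tgt g
  map_mul : ∀ g h, G.src g = G.tgt h → f (G.mul g h) = H.mul (f g) (f h)

/-- A bundle of Lie groups over `M`: a Lie groupoid in which source and target coincide. -/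
structure GroupBundle (M : Mfd.{u}) extends LieGroupoid M where
  src_eq_tgt : toLieGroupoid.src = toLieGroupoid.tgt

/-! ### Extensions -/

/-- `j : K → G` and `π : G → E` form an extension of Lie groupoids over `M`: `j` is an embedding,
`π` is a surjective submersion, and `j` is onto the kernel of `π`. -/
structure IsExtension {M : Mfd.{u}} (K : GroupBundle M) (E G : LieGroupoid M)
    (j : K.Arr → G.Arr) (π : G.Arr → E.Arr) : Prop where
  j_hom : IsHom K.toLieGroupoid G j
  j_embedding : Manifold.IsSmoothEmbedding K.Arr.model G.Arr.model ∞ j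
  π_hom : IsHom G E π
  π_submersion : Manifold.IsSubmersion G.Arr.model E.Arr.model ∞ π
  π_surjective : Function.Surjective π
  exact : ∀ g, (∃ k, j k = g) ↔ ∃ x, π g = E.one x

/-- An extension `K → G → E` over `M`. -/
structure Extension {M : Mfd.{u}} (K : GroupBundle M) (E : LieGroupoid M) where
  G : LieGroupoid M
  j : K.Arr → G.Arr
  π : G.Arr → E.Arr
  isExtension : IsExtension K E G j π

/-- An isomorphism of extensions of `E` by `K`. -/
structure ExtIso {M : Mfd.{u}} {K : GroupBundle M} {E : LieGroupoid M} (X Y : Extension K E) where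
  toDiffeo : Diffeomorph X.G.Arr.model Y.G.Arr.model X.G.Arr Y.G.Arr ∞
  isHom : IsHom X.G Y.G toDiffeo
  comp_j : ∀ k, toDiffeo (X.j k) = Y.j k
  π_comp : ∀ g, Y.π (toDiffeo g) = X.π g

/-! ### Restriction to a subset of the base -/

/-- The set of arrows of the restriction `G_T`. -/
def LieGroupoid.restrSet {M : Mfd.{u}} (G : LieGroupoid M) (T : Set M) : Set G.Arr :=
  {g | G.src g ∈ T ∧ G.tgt g ∈ T}

open Classical in
/-- The restriction `G_T`, a groupoid over `T`. For a complete transversal `T` its set of arrows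
is an embedded submanifold of that of `G`, which makes it a Lie groupoid over `T`. -/
noncomputable def LieGroupoid.restr {M : Mfd.{u}} (G : LieGroupoid M) (T : Set M) :
    GroupoidOn T (G.restrSet T) where
  src g := ⟨G.src g, g.2.1⟩
  tgt g := ⟨G.tgt g, g.2.2⟩
  one x := ⟨G.one x, by
    simp only [LieGroupoid.restrSet, Set.mem_ofPred_eq, GroupoidOn.src_one, GroupoidOn.tgt_one]
    exact ⟨x.2, x.2⟩⟩
  inv g := ⟨G.inv g, by
    simp only [LieGroupoid.restrSet, Set.mem_ofPred_eq, GroupoidOn.src_inv, GroupoidOn.tgt_inv]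
    exact ⟨g.2.2, g.2.1⟩⟩
  mul g h := if c : G.src g = G.tgt h then
      ⟨G.mul g h, by
        simp only [LieGroupoid.restrSet, Set.mem_ofPred_eq, GroupoidOn.src_mul _ _ _ c,
          GroupoidOn.tgt_mul _ _ _ c]
        exact ⟨h.2.1, g.2.2⟩⟩
    else g
  src_one x := Subtype.ext (G.toGroupoidOn.src_one x)
  tgt_one x := Subtype.ext (G.toGroupoidOn.tgt_one x)
  src_inv g := Subtype.ext (G.toGroupoidOn.src_inv g)
  tgt_inv g := Subtype.ext (G.toGroupoidOn.tgt_inv g)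
  src_mul g h c := by
    have c' : G.src g = G.tgt h := congrArg Subtype.val c
    simp [c', GroupoidOn.src_mul]
  tgt_mul g h c := by
    have c' : G.src g = G.tgt h := congrArg Subtype.val c
    simp [c', GroupoidOn.tgt_mul]
  mul_assoc f g h c d := by
    have c' : G.src f = G.tgt g := congrArg Subtype.val c
    have d' : G.src g = G.tgt h := congrArg Subtype.val d
    simp [c', d', GroupoidOn.tgt_mul, GroupoidOn.src_mul, GroupoidOn.mul_assoc]
  one_mul g := by simp [GroupoidOn.src_one, GroupoidOn.one_mul]
  mul_one g := by simp [GroupoidOn.tgt_one, GroupoidOn.mul_one]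
  inv_mul g := by simp [GroupoidOn.src_inv, GroupoidOn.inv_mul]
  mul_inv g := by simp [GroupoidOn.tgt_inv, GroupoidOn.mul_inv]

section Restriction

variable {M : Mfd.{u}} {K : GroupBundle M} {E : LieGroupoid M}

/-- The map `j : K_T → G_T` of the restricted extension. -/
def Extension.restrJ (X : Extension K E) (T : Set M) (k : K.restrSet T) : X.G.restrSet T :=
  ⟨X.j k, by
    simp only [LieGroupoid.restrSet, Set.mem_ofPred_eq, X.isExtension.j_hom.map_src,
      X.isExtension.j_hom.map_tgt]
    exact k.2⟩

/-- The map `π : G_T → E_T` of the restricted extension. -/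
def Extension.restrπ (X : Extension K E) (T : Set M) (g : X.G.restrSet T) : E.restrSet T :=
  ⟨X.π g, by
    simp only [LieGroupoid.restrSet, Set.mem_ofPred_eq, X.isExtension.π_hom.map_src,
      X.isExtension.π_hom.map_tgt]
    exact g.2⟩

/-- An isomorphism from the restricted extension `K_T → (X.G)_T → E_T` to the restricted extension
`K_T → (Y.G)_T → E_T`: an isomorphism of groupoids over `T`, smooth in both directions and
compatible with the maps from `K_T` and to `E_T`. -/
structure RestrIso (X Y : Extension K E) (T : Set M) where
  toEquiv : X.G.restrSet T ≃ Y.G.restrSet T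
  smooth : SmoothFrom X.G.Arr.model Y.G.Arr.model (X.G.restrSet T)
    (fun g => (toEquiv g : Y.G.Arr))
  smooth_symm : SmoothFrom Y.G.Arr.model X.G.Arr.model (Y.G.restrSet T)
    (fun g => (toEquiv.symm g : X.G.Arr))
  map_src : ∀ g, (Y.G.restr T).src (toEquiv g) = (X.G.restr T).src g
  map_tgt : ∀ g, (Y.G.restr T).tgt (toEquiv g) = (X.G.restr T).tgt g
  map_mul : ∀ g h, (X.G.restr T).src g = (X.G.restr T).tgt h →
    toEquiv ((X.G.restr T).mul g h) = (Y.G.restr T).mul (toEquiv g) (toEquiv h)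
  comp_j : ∀ k, toEquiv (X.restrJ T k) = Y.restrJ T k
  π_comp : ∀ g, Y.restrπ T (toEquiv g) = X.restrπ T g

end Restriction

/-! ### Elementary facts -/

namespace LieGroupoid

variable {M : Mfd.{u}} (G : LieGroupoid M)

theorem src_one (x : M) : G.src (G.one x) = x := G.toGroupoidOn.src_one x
theorem tgt_one (x : M) : G.tgt (G.one x) = x := G.toGroupoidOn.tgt_one x
theorem src_inv (g : G.Arr) : G.src (G.inv g) = G.tgt g := G.toGroupoidOn.src_inv g
theorem tgt_inv (g : G.Arr) : G.tgt (G.inv g) = G.src g := G.toGroupoidOn.tgt_inv g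
theorem src_mul (g h : G.Arr) (c : G.src g = G.tgt h) : G.src (G.mul g h) = G.src h :=
  G.toGroupoidOn.src_mul g h c
theorem tgt_mul (g h : G.Arr) (c : G.src g = G.tgt h) : G.tgt (G.mul g h) = G.tgt g :=
  G.toGroupoidOn.tgt_mul g h c
theorem mul_assoc (f g h : G.Arr) (c : G.src f = G.tgt g) (d : G.src g = G.tgt h) :
    G.mul (G.mul f g) h = G.mul f (G.mul g h) := G.toGroupoidOn.mul_assoc f g h c d
theorem one_mul (g : G.Arr) : G.mul (G.one (G.tgt g)) g = g := G.toGroupoidOn.one_mul g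
theorem mul_one (g : G.Arr) : G.mul g (G.one (G.src g)) = g := G.toGroupoidOn.mul_one g
theorem inv_mul (g : G.Arr) : G.mul (G.inv g) g = G.one (G.src g) := G.toGroupoidOn.inv_mul g
theorem mul_inv (g : G.Arr) : G.mul g (G.inv g) = G.one (G.tgt g) := G.toGroupoidOn.mul_inv g

end LieGroupoid

section Facts

variable {M : Mfd.{u}} {K : GroupBundle M} {E : LieGroupoid M}

theorem GroupBundle.tgt_eq (K : GroupBundle M) (k : K.Arr) : K.tgt k = K.src k :=
  (congrFun K.src_eq_tgt k).symm

theorem GroupBundle.src_inv (K : GroupBundle M) (k : K.Arr) : K.src (K.inv k) = K.src k :=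
  (K.toLieGroupoid.src_inv k).trans (K.tgt_eq k)

theorem GroupBundle.src_mul (K : GroupBundle M) (k l : K.Arr) (h : K.src k = K.src l) :
    K.src (K.mul k l) = K.src l :=
  K.toLieGroupoid.src_mul k l (h.trans (K.tgt_eq l).symm)

variable (X : Extension K E)

theorem Extension.src_j (k : K.Arr) : X.G.src (X.j k) = K.src k := X.isExtension.j_hom.map_src k

theorem Extension.tgt_j (k : K.Arr) : X.G.tgt (X.j k) = K.src k :=
  (X.isExtension.j_hom.map_tgt k).trans (K.tgt_eq k)

theorem Extension.j_mul (k l : K.Arr) (h : K.src k = K.src l) :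
    X.j (K.mul k l) = X.G.mul (X.j k) (X.j l) :=
  X.isExtension.j_hom.map_mul k l (h.trans (K.tgt_eq l).symm)

theorem Extension.j_one (x : M) : X.j (K.one x) = X.G.one x := by
  have s : X.G.src (X.j (K.one x)) = x := by rw [X.src_j]; exact K.toLieGroupoid.src_one x
  have t : X.G.tgt (X.j (K.one x)) = x := by rw [X.tgt_j]; exact K.toLieGroupoid.src_one x
  have e : X.G.mul (X.j (K.one x)) (X.j (K.one x)) = X.j (K.one x) := by
    rw [← X.j_mul _ _ rfl]
    congr 1
    have := K.toLieGroupoid.one_mul (K.one x)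
    rwa [K.toLieGroupoid.tgt_one] at this
  have h := congrArg (fun g => X.G.mul (X.G.inv (X.j (K.one x))) g) e
  rw [← X.G.mul_assoc _ _ _ (by rw [X.G.src_inv]) (by rw [s, t]),
    X.G.inv_mul] at h
  rw [s] at h
  have h' := X.G.one_mul (X.j (K.one x))
  rw [t] at h'
  exact h'.symm.trans h

theorem LieGroupoid.eq_inv {G : LieGroupoid M} (g h : G.Arr) (c : G.src g = G.tgt h)
    (e : G.mul g h = G.one (G.src h)) : g = G.inv h := by
  have h1 := congrArg (fun f => G.mul f (G.inv h)) e
  rw [G.mul_assoc _ _ _ c (G.tgt_inv h).symm, G.mul_inv,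
    ← c, G.mul_one] at h1
  have h2 := G.one_mul (G.inv h)
  rw [G.tgt_inv] at h2
  exact h1.trans h2

theorem Extension.j_inv (k : K.Arr) : X.j (K.inv k) = X.G.inv (X.j k) := by
  apply LieGroupoid.eq_inv
  · rw [X.src_j, X.tgt_j, K.src_inv]
  · rw [← X.j_mul _ _ (K.src_inv k), X.src_j, ← X.j_one]
    exact congrArg X.j (K.toLieGroupoid.inv_mul k)

theorem LieGroupoid.inv_mul_rev {G : LieGroupoid M} (g h : G.Arr) (c : G.src g = G.tgt h) :
    G.inv (G.mul g h) = G.mul (G.inv h) (G.inv g) := by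
  have c' : G.src (G.inv h) = G.tgt (G.inv g) := by
    rw [G.src_inv, G.tgt_inv, c]
  symm
  apply LieGroupoid.eq_inv
  · rw [G.src_mul _ _ c', G.src_inv, G.tgt_mul _ _ c]
  · have a1 : G.mul (G.inv g) (G.mul g h) = h := by
      rw [← G.mul_assoc _ _ _ (G.src_inv g) c, G.inv_mul, c,
        G.one_mul]
    rw [G.mul_assoc _ _ _ c'
      (by rw [G.src_inv, G.tgt_mul _ _ c]), a1, G.inv_mul,
      G.src_mul _ _ c]

end Facts

/-! ### Bitorsors -/

/-- An `L`-`K` bitorsor `P` over `M`, with projection `proj : P → M`, left action `lact` of `L` and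
right action `ract` of `K`. As for groupoids, `lact l p` and `ract p k` are meaningful only over
the same point of `M`, and so are the division maps `ldiv p q = p q⁻¹` in `L` and
`rdiv q p = q⁻¹ p` in `K`. The map `(q, p) ↦ (q, q⁻¹ p)` is the smooth inverse of
`(q, k) ↦ (q, q k)`, so that `rdiv` witnesses that the latter is a diffeomorphism from
`P ×_M K` to `P ×_M P`; similarly for `ldiv`. -/
structure Bitorsor {M : Mfd.{u}} (L K : GroupBundle M) where
  Tot : Mfd.{u}
  proj : Tot → M
  proj_submersion : Manifold.IsSubmersion Tot.model M.model ∞ proj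
  proj_surjective : Function.Surjective proj
  -- the right `K`-torsor
  ract : Tot → K.Arr → Tot
  proj_ract : ∀ p k, proj p = K.src k → proj (ract p k) = proj p
  ract_one : ∀ p, ract p (K.one (proj p)) = p
  ract_mul : ∀ p k k', proj p = K.src k → proj p = K.src k' →
    ract p (K.mul k k') = ract (ract p k) k'
  ract_smooth : ContMDiffOn (Tot.model.prod K.Arr.model) Tot.model ∞
    (fun z : Tot × K.Arr => ract z.1 z.2) {z | proj z.1 = K.src z.2}
  rdiv : Tot → Tot → K.Arr
  src_rdiv : ∀ q p, proj q = proj p → K.src (rdiv q p) = proj q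
  ract_rdiv : ∀ q p, proj q = proj p → ract q (rdiv q p) = p
  rdiv_ract : ∀ q k, proj q = K.src k → rdiv q (ract q k) = k
  rdiv_smooth : ContMDiffOn (Tot.model.prod Tot.model) K.Arr.model ∞
    (fun z : Tot × Tot => rdiv z.1 z.2) {z | proj z.1 = proj z.2}
  -- the left `L`-torsor
  lact : L.Arr → Tot → Tot
  proj_lact : ∀ l p, proj p = L.src l → proj (lact l p) = proj p
  one_lact : ∀ p, lact (L.one (proj p)) p = p
  mul_lact : ∀ l l' p, proj p = L.src l → proj p = L.src l' →
    lact (L.mul l l') p = lact l (lact l' p)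
  lact_smooth : ContMDiffOn (L.Arr.model.prod Tot.model) Tot.model ∞
    (fun z : L.Arr × Tot => lact z.1 z.2) {z | proj z.2 = L.src z.1}
  ldiv : Tot → Tot → L.Arr
  src_ldiv : ∀ p q, proj p = proj q → L.src (ldiv p q) = proj q
  ldiv_lact : ∀ p q, proj p = proj q → lact (ldiv p q) q = p
  lact_ldiv : ∀ l q, proj q = L.src l → ldiv (lact l q) q = l
  ldiv_smooth : ContMDiffOn (Tot.model.prod Tot.model) L.Arr.model ∞
    (fun z : Tot × Tot => ldiv z.1 z.2) {z | proj z.1 = proj z.2}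
  -- compatibility
  lact_ract : ∀ l p k, proj p = L.src l → proj p = K.src k →
    lact l (ract p k) = ract (lact l p) k

/-- `α` is a (smooth) section over `T` of the bitorsor `P`. -/
structure IsSectionOver {M : Mfd.{u}} {L K : GroupBundle M} (P : Bitorsor L K) (T : Set M)
    (α : T → P.Tot) : Prop where
  smooth : SmoothFrom M.model P.Tot.model T α
  proj_eq : ∀ x : T, P.proj (α x) = x

/-- `α` is a central section over `T` of the `K`-`K` bitorsor `P`: conjugation by `α` is the
identity of `K_T`, that is, `α(x) k = k α(x)` for all `x` in `T` and `k` in `K_x`. -/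
structure IsCentralSection {M : Mfd.{u}} {K : GroupBundle M} (P : Bitorsor K K) (T : Set M)
    (α : T → P.Tot) : Prop extends IsSectionOver P T α where
  central : ∀ (x : T) (k : K.Arr), K.src k = x → P.ract (α x) k = P.lact k (α x)

section BitorsorFacts

variable {M : Mfd.{u}} {L K : GroupBundle M} (P : Bitorsor L K)

theorem Bitorsor.rdiv_mul (q p : P.Tot) (k : K.Arr) (h : P.proj q = P.proj p)
    (c : P.proj p = K.src k) : P.rdiv q (P.ract p k) = K.mul (P.rdiv q p) k := by
  have s := P.src_rdiv q p h
  rw [← P.rdiv_ract q (K.mul (P.rdiv q p) k)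
    (by rw [K.src_mul _ _ (by rw [s, h, c]), h, c]),
    P.ract_mul _ _ _ s.symm (h.trans c), P.ract_rdiv _ _ h]

theorem Bitorsor.ract_inv_ract (p : P.Tot) (l : K.Arr) (c : P.proj p = K.src l) :
    P.ract (P.ract p (K.inv l)) l = p := by
  rw [← P.ract_mul _ _ _ (by rw [K.src_inv, c]) c]
  have : K.mul (K.inv l) l = K.one (P.proj p) := by rw [c]; exact K.toLieGroupoid.inv_mul l
  rw [this, P.ract_one]

theorem Bitorsor.rdiv_ract_inv (p q : P.Tot) (l : K.Arr) (c : P.proj p = K.src l)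
    (h : P.proj p = P.proj q) : P.rdiv (P.ract p (K.inv l)) q = K.mul l (P.rdiv p q) := by
  have s := P.src_rdiv p q h
  have e : P.proj (P.ract p (K.inv l)) = P.proj p := P.proj_ract _ _ (by rw [K.src_inv, c])
  have cl : K.src l = K.src (P.rdiv p q) := by rw [s, c]
  rw [← P.rdiv_ract (P.ract p (K.inv l)) (K.mul l (P.rdiv p q)) (by rw [e, K.src_mul _ _ cl, s]),
    P.ract_mul _ _ _ (e.trans c) (e.trans s.symm), P.ract_inv_ract _ _ c, P.ract_rdiv _ _ h]

theorem Bitorsor.rdiv_self (p : P.Tot) : P.rdiv p p = K.one (P.proj p) := by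
  conv_lhs => rw [← P.ract_one p]
  rw [P.ract_one, ← P.rdiv_ract p (K.one (P.proj p)) (K.toLieGroupoid.src_one _).symm, P.ract_one]

end BitorsorFacts

/-! ### The twisted extension `P ⊗_K G ⊗_K P⁻¹` -/

section Twist

variable {M : Mfd.{u}} {L K : GroupBundle M} {E : LieGroupoid M}
  (P : Bitorsor L K) (X : Extension K E)

/-- The triples `(q, g, p⁻¹)` with `g : x → y` in `G`, `q ∈ P_y` and `p ∈ P_x`, as a subset of
`P × G × P`. -/
def tripleSet : Set (P.Tot × X.G.Arr × P.Tot) :=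
  {z | P.proj z.1 = X.G.tgt z.2.1 ∧ P.proj z.2.2 = X.G.src z.2.1}

/-- The identifications `(q k, g, p⁻¹) ∼ (q, k g, p⁻¹)` and `(q, g l, p⁻¹) ∼ (q, g, l p⁻¹)`, where
`l p⁻¹ = (p l⁻¹)⁻¹`. -/
def TwistRel (a b : tripleSet P X) : Prop :=
  (∃ k, K.src k = P.proj b.1.1 ∧ a.1.1 = P.ract b.1.1 k ∧
    b.1.2.1 = X.G.mul (X.j k) a.1.2.1 ∧ b.1.2.2 = a.1.2.2) ∨
  (∃ l, K.src l = P.proj a.1.2.2 ∧ a.1.1 = b.1.1 ∧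
    a.1.2.1 = X.G.mul b.1.2.1 (X.j l) ∧ b.1.2.2 = P.ract a.1.2.2 (K.inv l))

/-- The set of arrows of `P ⊗_K G ⊗_K P⁻¹`: the quotient of the set of triples by the equivalence
relation generated by the identifications `TwistRel`. -/
def Twist : Type u := Quot (TwistRel P X)

variable {P X}

/-- The class `q ⊗ g ⊗ p⁻¹`. -/
def tensor (q : P.Tot) (g : X.G.Arr) (p : P.Tot) (hq : P.proj q = X.G.tgt g)
    (hp : P.proj p = X.G.src g) : Twist P X :=
  Quot.mk _ ⟨(q, g, p), hq, hp⟩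

theorem tensor_congr {q q' : P.Tot} {g g' : X.G.Arr} {p p' : P.Tot} (hq : P.proj q = X.G.tgt g)
    (hp : P.proj p = X.G.src g) (eq : q = q') (eg : g = g') (ep : p = p') :
    tensor q g p hq hp = tensor q' g' p' (by rw [← eq, ← eg, hq]) (by rw [← ep, ← eg, hp]) := by
  subst eq eg ep; rfl

theorem tensor_left (q : P.Tot) (g : X.G.Arr) (p : P.Tot) (k : K.Arr)
    (hk : K.src k = P.proj q) (hq : P.proj q = X.G.tgt g) (hp : P.proj p = X.G.src g) :
    tensor (P.ract q k) g p (by rw [P.proj_ract _ _ hk.symm, hq]) hp =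
      tensor q (X.G.mul (X.j k) g) p
        (by rw [X.G.tgt_mul _ _ (by rw [X.src_j, hk, hq]), X.tgt_j, hk])
        (by rw [X.G.src_mul _ _ (by rw [X.src_j, hk, hq]), hp]) :=
  Quot.sound (Or.inl ⟨k, hk, rfl, rfl, rfl⟩)

theorem tensor_right (q : P.Tot) (g : X.G.Arr) (p : P.Tot) (l : K.Arr)
    (hl : K.src l = P.proj p) (hq : P.proj q = X.G.tgt g) (hp : P.proj p = X.G.src g) :
    tensor q (X.G.mul g (X.j l)) p
        (by rw [X.G.tgt_mul _ _ (by rw [X.tgt_j, hl, hp]), hq])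
        (by rw [X.G.src_mul _ _ (by rw [X.tgt_j, hl, hp]), X.src_j, hl]) =
      tensor q g (P.ract p (K.inv l)) hq
        (by rw [P.proj_ract _ _ (by rw [K.src_inv, hl]), hp]) :=
  Quot.sound (Or.inr ⟨l, hl, rfl, rfl, rfl⟩)

/-- A function on triples which is compatible with the two identifications is compatible with the
relation `TwistRel`; this form is convenient for verifications. -/
theorem TwistRel.elim {C : tripleSet P X → tripleSet P X → Prop}
    (left : ∀ q g p k (_ : K.src k = P.proj q) (_ : P.proj q = X.G.tgt g)
      (_ : P.proj p = X.G.src g) h1 h2, C ⟨(P.ract q k, g, p), h1⟩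
        ⟨(q, X.G.mul (X.j k) g, p), h2⟩)
    (right : ∀ q g p l (_ : K.src l = P.proj p) (_ : P.proj q = X.G.tgt g)
      (_ : P.proj p = X.G.src g) h1 h2, C ⟨(q, X.G.mul g (X.j l), p), h1⟩
        ⟨(q, g, P.ract p (K.inv l)), h2⟩)
    (a b : tripleSet P X) (r : TwistRel P X a b) : C a b := by
  obtain ⟨⟨q, g, p⟩, hq, hp⟩ := a
  obtain ⟨⟨q', g', p'⟩, hq', hp'⟩ := b
  rcases r with ⟨k, hk, e1, e2, e3⟩ | ⟨l, hl, e1, e2, e3⟩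
  · simp only at hk e1 e2 e3 hq hp hq' hp'
    subst e1 e2 e3
    exact left _ _ _ _ hk (by rw [← hq, P.proj_ract _ _ hk.symm]) hp _ _
  · simp only at hl e1 e2 e3 hq hp hq' hp'
    subst e1 e2 e3
    exact right _ _ _ _ hl hq' (by rw [← hp', P.proj_ract _ _ (by rw [K.src_inv, hl])]) _ _

/-- The source `x` of `q ⊗ g ⊗ p⁻¹ : x → y`. -/
def Twist.src : Twist P X → M :=
  Quot.lift (fun a => P.proj a.1.2.2) <| TwistRel.elim
    (fun _ _ _ _ _ _ _ _ _ => rfl)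
    (fun _ _ p l hl _ _ _ _ => (P.proj_ract p _ (by rw [K.src_inv, hl])).symm)

/-- The target `y` of `q ⊗ g ⊗ p⁻¹ : x → y`. -/
def Twist.tgt : Twist P X → M :=
  Quot.lift (fun a => P.proj a.1.1) <| TwistRel.elim
    (fun q _ _ k hk _ _ _ _ => P.proj_ract q k hk.symm)
    (fun _ _ _ _ _ _ _ _ _ => rfl)

/-- The inverse of `q ⊗ g ⊗ p⁻¹` is `p ⊗ g⁻¹ ⊗ q⁻¹`. -/
def Twist.inv : Twist P X → Twist P X :=
  Quot.lift (fun a => tensor a.1.2.2 (X.G.inv a.1.2.1) a.1.1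
      (by rw [X.G.tgt_inv]; exact a.2.2)
      (by rw [X.G.src_inv]; exact a.2.1)) <| TwistRel.elim
    (fun q g p k hk hq hp _ _ => by
      have ck : K.src (K.inv k) = P.proj q := by rw [K.src_inv, hk]
      have := tensor_right (X := X) p (X.G.inv g) q (K.inv k) ck
        (by rw [X.G.tgt_inv, hp]) (by rw [X.G.src_inv, hq])
      have e : K.inv (K.inv k) = k := by
        refine (LieGroupoid.eq_inv (G := K.toLieGroupoid) k (K.inv k) ?_ ?_).symm
        · exact (K.toLieGroupoid.tgt_inv k).symm
        · rw [K.toLieGroupoid.src_inv]; exact K.toLieGroupoid.mul_inv k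
      refine (tensor_congr _ _ rfl rfl (by rw [e])).trans (this.symm.trans
        (tensor_congr _ _ rfl ?_ rfl))
      rw [LieGroupoid.inv_mul_rev _ _ (by rw [X.src_j, hk, hq]), X.j_inv])
    (fun q g p l hl hq hp _ _ => by
      have cl : K.src (K.inv l) = P.proj p := by rw [K.src_inv, hl]
      refine (tensor_congr _ _ rfl ?_ rfl).trans
        (tensor_left (X := X) p (X.G.inv g) q (K.inv l) cl
        (by rw [X.G.tgt_inv, hp]) (by rw [X.G.src_inv, hq])).symm
      rw [LieGroupoid.inv_mul_rev _ _ (by rw [X.tgt_j, hl, hp]), X.j_inv])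

theorem mul_composable (g h : X.G.Arr) (d : K.Arr) (h1 : K.src d = X.G.src g)
    (h2 : K.src d = X.G.tgt h) :
    X.G.src g = X.G.tgt (X.j d) ∧ X.G.src (X.j d) = X.G.tgt h ∧
    X.G.src (X.G.mul g (X.j d)) = X.G.tgt h ∧
    X.G.src (X.G.mul (X.G.mul g (X.j d)) h) = X.G.src h ∧
    X.G.tgt (X.G.mul (X.G.mul g (X.j d)) h) = X.G.tgt g ∧
    X.G.tgt (X.G.mul g (X.j d)) = X.G.tgt g := by
  have a : X.G.src g = X.G.tgt (X.j d) := by rw [X.tgt_j, h1]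
  have b : X.G.src (X.j d) = X.G.tgt h := by rw [X.src_j, h2]
  have c : X.G.src (X.G.mul g (X.j d)) = X.G.tgt h := by
    rw [X.G.src_mul _ _ a, b]
  refine ⟨a, b, c, X.G.src_mul _ _ c, ?_, X.G.tgt_mul _ _ a⟩
  rw [X.G.tgt_mul _ _ c, X.G.tgt_mul _ _ a]

open Classical in
/-- The composition of two triples `(r, h, s⁻¹)` and `(q, g, p⁻¹)` with `s` and `q` in the same
fibre, `r ⊗ h (s⁻¹ q) g ⊗ p⁻¹`. -/
noncomputable def preMul (a b : tripleSet P X) : Twist P X :=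
  if c : P.proj a.1.2.2 = P.proj b.1.1 then
    tensor a.1.1 (X.G.mul (X.G.mul a.1.2.1 (X.j (P.rdiv a.1.2.2 b.1.1))) b.1.2.1) b.1.2.2
      (by
        have s := P.src_rdiv _ _ c
        rw [(mul_composable a.1.2.1 b.1.2.1 _ (s.trans a.2.2)
          (s.trans (c.trans b.2.1))).2.2.2.2.1, a.2.1])
      (by
        have s := P.src_rdiv _ _ c
        rw [(mul_composable a.1.2.1 b.1.2.1 _ (s.trans a.2.2)
          (s.trans (c.trans b.2.1))).2.2.2.1, b.2.2])
  else Quot.mk _ a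

theorem preMul_pos (r s q p : P.Tot) (h g : X.G.Arr) (h1 h2) (c : P.proj s = P.proj q) :
    ∃ h3 h4, preMul (⟨(r, h, s), h1⟩ : tripleSet P X) ⟨(q, g, p), h2⟩ =
      tensor r (X.G.mul (X.G.mul h (X.j (P.rdiv s q))) g) p h3 h4 := by
  have sd := P.src_rdiv _ _ c
  obtain ⟨m1, m2, m3, m4, m5, m6⟩ := mul_composable h g _ (sd.trans h1.2)
    (sd.trans (c.trans h2.1))
  exact ⟨h1.1.trans m5.symm, h2.2.trans m4.symm, dif_pos c⟩

theorem preMul_neg (r s q p : P.Tot) (h g : X.G.Arr) (h1 h2) (c : ¬ P.proj s = P.proj q) :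
    preMul (⟨(r, h, s), h1⟩ : tripleSet P X) ⟨(q, g, p), h2⟩ = Quot.mk _ ⟨(r, h, s), h1⟩ :=
  dif_neg c

theorem preMul_left (a a' b : tripleSet P X) (r : TwistRel P X a a') :
    preMul a b = preMul a' b := by
  obtain ⟨⟨q, g, p⟩, hz⟩ := b
  have hq : P.proj q = X.G.tgt g := hz.1
  have hp : P.proj p = X.G.src g := hz.2
  refine TwistRel.elim (C := fun a a' => Quot.mk (TwistRel P X) a = Quot.mk _ a' →
    preMul a ⟨(q, g, p), hz⟩ = preMul a' ⟨(q, g, p), hz⟩) ?_ ?_ a a' r (Quot.sound r)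
  · intro q1 g1 p1 k hk hq1 hp1 h1 h2 s
    by_cases c : P.proj p1 = P.proj q
    · obtain ⟨i1, i2, e1⟩ := preMul_pos _ _ _ _ _ _ h1 hz c
      obtain ⟨i3, i4, e2⟩ := preMul_pos _ _ _ _ _ _ h2 hz c
      rw [e1, e2]
      have sd := P.src_rdiv _ _ c
      obtain ⟨m1, m2, m3, m4, m5, m6⟩ := mul_composable g1 g _ (sd.trans hp1)
        (sd.trans (c.trans hq))
      refine (tensor_left _ _ _ _ hk (hq1.trans m5.symm) (hp.trans m4.symm)).trans
        (tensor_congr _ _ rfl ?_ rfl)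
      have ck : X.G.src (X.j k) = X.G.tgt g1 := by rw [X.src_j, hk, hq1]
      rw [X.G.mul_assoc _ _ _ ck m1, X.G.mul_assoc _ _ _ (by rw [ck, m6]) m3]
    · rw [preMul_neg _ _ _ _ _ _ _ _ c, preMul_neg _ _ _ _ _ _ _ _ c, s]
  · intro q1 g1 p1 l hl hq1 hp1 h1 h2 s
    have e : P.proj (P.ract p1 (K.inv l)) = P.proj p1 :=
      P.proj_ract _ _ (by rw [K.src_inv, hl])
    by_cases c : P.proj p1 = P.proj q
    · obtain ⟨i1, i2, e1⟩ := preMul_pos _ _ _ _ _ _ h1 hz c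
      obtain ⟨i3, i4, e2⟩ := preMul_pos _ _ _ _ _ _ h2 hz (e.trans c)
      rw [e1, e2]
      refine tensor_congr _ _ rfl ?_ rfl
      have sd := P.src_rdiv _ _ c
      rw [P.rdiv_ract_inv _ _ _ hl.symm c, X.j_mul _ _ (by rw [hl, sd]),
        X.G.mul_assoc g1 _ _ (by rw [X.tgt_j, hl, hp1]) (by rw [X.src_j, X.tgt_j, hl, sd])]
    · rw [preMul_neg _ _ _ _ _ _ _ _ c, preMul_neg _ _ _ _ _ _ _ _ (by rw [e]; exact c), s]

theorem preMul_right (a b b' : tripleSet P X) (r : TwistRel P X b b') :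
    preMul a b = preMul a b' := by
  obtain ⟨⟨q, g, p⟩, hz⟩ := a
  have hq : P.proj q = X.G.tgt g := hz.1
  have hp : P.proj p = X.G.src g := hz.2
  refine TwistRel.elim (C := fun b b' => preMul ⟨(q, g, p), hz⟩ b =
    preMul ⟨(q, g, p), hz⟩ b') ?_ ?_ b b' r
  · intro q1 g1 p1 k hk hq1 hp1 h1 h2
    have e : P.proj (P.ract q1 k) = P.proj q1 := P.proj_ract _ _ hk.symm
    by_cases c : P.proj p = P.proj q1
    · obtain ⟨i1, i2, e1⟩ := preMul_pos _ _ _ _ _ _ hz h1 (c.trans e.symm)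
      obtain ⟨i3, i4, e2⟩ := preMul_pos _ _ _ _ _ _ hz h2 c
      rw [e1, e2]
      refine tensor_congr _ _ rfl ?_ rfl
      have sd := P.src_rdiv _ _ c
      have ck : X.G.src (X.j k) = X.G.tgt g1 := by rw [X.src_j, hk, hq1]
      obtain ⟨m1, m2, m3, m4, m5, m6⟩ := mul_composable g (X.j k) _ (sd.trans hp)
        (by rw [sd, X.tgt_j, c, hk])
      rw [P.rdiv_mul _ _ _ c hk.symm, X.j_mul _ _ (by rw [sd, hk, c]),
        ← X.G.mul_assoc _ _ _ m1 m2, X.G.mul_assoc _ _ _ m3 ck]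
    · rw [preMul_neg _ _ _ _ _ _ _ _ (by rw [e]; exact c), preMul_neg _ _ _ _ _ _ _ _ c]
  · intro q1 g1 p1 l hl hq1 hp1 h1 h2
    by_cases c : P.proj p = P.proj q1
    · obtain ⟨i1, i2, e1⟩ := preMul_pos _ _ _ _ _ _ hz h1 c
      obtain ⟨i3, i4, e2⟩ := preMul_pos _ _ _ _ _ _ hz h2 c
      rw [e1, e2]
      have sd := P.src_rdiv _ _ c
      obtain ⟨m1, m2, m3, m4, m5, m6⟩ := mul_composable g g1 _ (sd.trans hp)
        (sd.trans (c.trans hq1))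
      refine (tensor_congr _ _ rfl ?_ rfl).trans
        (tensor_right _ _ _ _ hl (hq.trans m5.symm) (hp1.trans m4.symm))
      rw [X.G.mul_assoc _ _ _ m3 (by rw [X.tgt_j, hl, hp1])]
    · rw [preMul_neg _ _ _ _ _ _ _ _ c, preMul_neg _ _ _ _ _ _ _ _ c]

/-- Composition in `P ⊗_K G ⊗_K P⁻¹`. -/
noncomputable def Twist.mul : Twist P X → Twist P X → Twist P X :=
  Quot.lift₂ preMul (fun a b b' r => preMul_right a b b' r) (fun a a' b r => preMul_left a a' b r)

/-- The composition formula `(r ⊗ h ⊗ s⁻¹)(q ⊗ g ⊗ p⁻¹) = r ⊗ h (s⁻¹ q) g ⊗ p⁻¹`. -/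
theorem tensor_mul (r s q p : P.Tot) (h g : X.G.Arr) (hr : P.proj r = X.G.tgt h)
    (hs : P.proj s = X.G.src h) (hq : P.proj q = X.G.tgt g) (hp : P.proj p = X.G.src g)
    (c : P.proj s = P.proj q) :
    ∃ h1 h2, Twist.mul (tensor r h s hr hs) (tensor q g p hq hp) =
      tensor r (X.G.mul (X.G.mul h (X.j (P.rdiv s q))) g) p h1 h2 := by
  have s := P.src_rdiv _ _ c
  obtain ⟨m1, m2, m3, m4, m5, m6⟩ := mul_composable h g _ (s.trans hs) (s.trans (c.trans hq))
  exact ⟨hr.trans m5.symm, hp.trans m4.symm, dif_pos c⟩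

theorem Twist.ind {C : Twist P X → Prop} (h : ∀ q g p hq hp, C (tensor q g p hq hp))
    (a : Twist P X) : C a := by
  obtain ⟨⟨⟨q, g, p⟩, hq, hp⟩⟩ := a
  exact h q g p hq hp

variable (P X) in
/-- The unit `1_x = q ⊗ 1_x ⊗ q⁻¹`, with `q ∈ P_x`. -/
noncomputable def Twist.one (x : M) : Twist P X :=
  tensor (Function.surjInv P.proj_surjective x) (X.G.one x)
    (Function.surjInv P.proj_surjective x)
    ((Function.surjInv_eq P.proj_surjective x).trans (X.G.tgt_one x).symm)
    ((Function.surjInv_eq P.proj_surjective x).trans (X.G.src_one x).symm)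

theorem lact_tensor_indep (l : L.Arr) (x : M) (hl : L.src l = x) (q q' : P.Tot)
    (hq : P.proj q = x) (hq' : P.proj q' = x) :
    ∃ h1 h2 h3 h4, tensor (X := X) (P.lact l q) (X.G.one x) q h1 h2 =
      tensor (P.lact l q') (X.G.one x) q' h3 h4 := by
  have pl : ∀ q : P.Tot, P.proj q = x → P.proj (P.lact l q) = x := fun q h => by
    rw [P.proj_lact _ _ (by rw [h, hl]), h]
  have ht := X.G.tgt_one x
  have hs := X.G.src_one x
  refine ⟨(pl q hq).trans ht.symm, hq.trans hs.symm, (pl q' hq').trans ht.symm,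
    hq'.trans hs.symm, ?_⟩
  have c : P.proj q = P.proj q' := by rw [hq, hq']
  have sd := P.src_rdiv q q' c
  set k := P.rdiv q q' with hk
  have e : q' = P.ract q k := (P.ract_rdiv q q' c).symm
  have kx : K.src k = x := sd.trans hq
  have e1 : P.lact l q' = P.ract (P.lact l q) k := by
    rw [e, P.lact_ract _ _ _ (by rw [hq, hl]) sd.symm]
  have cK : X.G.mul (X.j k) (X.G.one x) = X.G.mul (X.G.one x) (X.j k) := by
    have a1 := X.G.mul_one (X.j k)
    have a2 := X.G.one_mul (X.j k)
    rw [show X.G.src (X.j k) = x from (X.src_j k).trans kx] at a1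
    rw [show X.G.tgt (X.j k) = x from (X.tgt_j k).trans kx] at a2
    exact a1.trans a2.symm
  symm
  refine (tensor_congr _ _ e1 rfl rfl).trans ?_
  refine (tensor_left _ _ _ _ (by rw [pl q hq, kx]) ((pl q hq).trans ht.symm)
    (hq'.trans hs.symm)).trans ?_
  refine (tensor_congr _ _ rfl cK rfl).trans ?_
  refine (tensor_right _ _ _ _ (by rw [hq', kx]) ((pl q hq).trans ht.symm)
    (hq'.trans hs.symm)).trans ?_
  refine tensor_congr _ _ rfl rfl ?_
  rw [e, ← P.ract_mul _ _ _ sd.symm (by rw [K.src_inv, sd])]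
  have : K.mul k (K.inv k) = K.one (P.proj q) := by
    rw [← sd, ← K.tgt_eq k]; exact K.toLieGroupoid.mul_inv k
  rw [this, P.ract_one]

/-- The unit `q ⊗ 1_x ⊗ q⁻¹` does not depend on the choice of `q ∈ P_x`. -/
theorem Twist.one_eq (q : P.Tot) (x : M) (hq : P.proj q = x) :
    Twist.one P X x = tensor q (X.G.one x) q (by rw [hq, X.G.tgt_one])
      (by rw [hq, X.G.src_one]) := by
  have e : P.proj (Function.surjInv P.proj_surjective x) = x := Function.surjInv_eq _ x
  obtain ⟨h1, h2, h3, h4, h⟩ := lact_tensor_indep (X := X) (L.one x) x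
    (L.toLieGroupoid.src_one x) _ q e hq
  have one : ∀ q : P.Tot, P.proj q = x → P.lact (L.one x) q = q := fun q h => by
    have := P.one_lact q
    rwa [h] at this
  exact (tensor_congr _ _ (one _ e).symm rfl rfl).trans
    (h.trans (tensor_congr _ _ (one _ hq) rfl rfl))

variable (P X) in
/-- The groupoid `P ⊗_K G ⊗_K P⁻¹` over `M`. -/
noncomputable def twistGroupoid : GroupoidOn M (Twist P X) where
  src := Twist.src
  tgt := Twist.tgt
  one := Twist.one P X
  inv := Twist.inv
  mul := Twist.mul
  src_one x := Function.surjInv_eq P.proj_surjective x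
  tgt_one x := Function.surjInv_eq P.proj_surjective x
  src_inv := Twist.ind fun _ _ _ _ _ => rfl
  tgt_inv := Twist.ind fun _ _ _ _ _ => rfl
  src_mul := Twist.ind fun r h s hr hs => Twist.ind fun q g p hq hp c => by
    obtain ⟨h1, h2, e⟩ := tensor_mul r s q p h g hr hs hq hp c
    rw [e]; rfl
  tgt_mul := Twist.ind fun r h s hr hs => Twist.ind fun q g p hq hp c => by
    obtain ⟨h1, h2, e⟩ := tensor_mul r s q p h g hr hs hq hp c
    rw [e]; rfl
  mul_assoc := Twist.ind fun r h s hr hs => Twist.ind fun q g p hq hp =>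
    Twist.ind fun v f w hv hw c d => by
      have c : P.proj s = P.proj q := c
      have d : P.proj p = P.proj v := d
      obtain ⟨h1, h2, e⟩ := tensor_mul r s q p h g hr hs hq hp c
      obtain ⟨h3, h4, e'⟩ := tensor_mul q p v w g f hq hp hv hw d
      obtain ⟨h5, h6, e5⟩ := tensor_mul r p v w _ f h1 h2 hv hw d
      obtain ⟨h7, h8, e7⟩ := tensor_mul r s q w h _ hr hs h3 h4 c
      rw [e, e', e5, e7]
      refine tensor_congr _ _ rfl ?_ rfl
      have s1 := P.src_rdiv _ _ c
      have s2 := P.src_rdiv _ _ d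
      obtain ⟨m1, m2, m3, m4, m5, m6⟩ := mul_composable h g _ (s1.trans hs)
        (s1.trans (c.trans hq))
      obtain ⟨n1, n2, n3, n4, n5, n6⟩ := mul_composable g f _ (s2.trans hp)
        (s2.trans (d.trans hv))
      rw [X.G.mul_assoc _ g _ m3 n1,
        X.G.mul_assoc _ _ f (m3.trans n6.symm) n3]
  one_mul := Twist.ind fun q g p hq hp => by
    have c : P.proj q = X.G.tgt (X.G.one (P.proj q)) := (X.G.tgt_one _).symm
    have c' : P.proj q = X.G.src (X.G.one (P.proj q)) := (X.G.src_one _).symm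
    change Twist.mul (Twist.one P X (P.proj q)) _ = _
    obtain ⟨h1, h2, e⟩ := tensor_mul q q q p (X.G.one (P.proj q)) g c c' hq hp rfl
    rw [Twist.one_eq q _ rfl, e]
    refine tensor_congr _ _ rfl ?_ rfl
    have a := X.G.one_mul (X.G.one (P.proj q))
    rw [X.G.tgt_one] at a
    rw [P.rdiv_self, X.j_one, a, hq, X.G.one_mul]
  mul_one := Twist.ind fun q g p hq hp => by
    have c : P.proj p = X.G.tgt (X.G.one (P.proj p)) := (X.G.tgt_one _).symm
    have c' : P.proj p = X.G.src (X.G.one (P.proj p)) := (X.G.src_one _).symm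
    change Twist.mul _ (Twist.one P X (P.proj p)) = _
    obtain ⟨h1, h2, e⟩ := tensor_mul q p p p g (X.G.one (P.proj p)) hq hp c c' rfl
    rw [Twist.one_eq p _ rfl, e]
    refine tensor_congr _ _ rfl ?_ rfl
    rw [P.rdiv_self, X.j_one, hp, X.G.mul_one, X.G.mul_one]
  inv_mul := Twist.ind fun q g p hq hp => by
    have c : P.proj p = X.G.tgt (X.G.inv g) := by rw [X.G.tgt_inv, hp]
    have c' : P.proj q = X.G.src (X.G.inv g) := by rw [X.G.src_inv, hq]
    change Twist.mul (tensor p (X.G.inv g) q c c') _ = Twist.one P X (P.proj p)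
    obtain ⟨h1, h2, e⟩ := tensor_mul p q q p (X.G.inv g) g c c' hq hp rfl
    rw [Twist.one_eq p _ rfl, e]
    refine tensor_congr _ _ rfl ?_ rfl
    rw [P.rdiv_self, X.j_one, c', X.G.mul_one, X.G.inv_mul, hp]
  mul_inv := Twist.ind fun q g p hq hp => by
    have c : P.proj p = X.G.tgt (X.G.inv g) := by rw [X.G.tgt_inv, hp]
    have c' : P.proj q = X.G.src (X.G.inv g) := by rw [X.G.src_inv, hq]
    change Twist.mul _ (tensor p (X.G.inv g) q c c') = Twist.one P X (P.proj q)
    obtain ⟨h1, h2, e⟩ := tensor_mul q p p q g (X.G.inv g) hq hp c c' rfl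
    rw [Twist.one_eq q _ rfl, e]
    refine tensor_congr _ _ rfl ?_ rfl
    rw [P.rdiv_self, X.j_one, hp, X.G.mul_one, X.G.mul_inv, hq]

variable (P X) in
/-- The map `j_P : L → P ⊗_K G ⊗_K P⁻¹`, `j_P(l) = l q ⊗ 1_x ⊗ q⁻¹` for `l ∈ L_x` and any
`q ∈ P_x` (it does not depend on `q`, by `lact_tensor_indep`). -/
noncomputable def twistJ (l : L.Arr) : Twist P X :=
  let q := Function.surjInv P.proj_surjective (L.src l)
  have hq : P.proj q = L.src l := Function.surjInv_eq P.proj_surjective (L.src l)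
  tensor (P.lact l q) (X.G.one (L.src l)) q
    (by rw [P.proj_lact _ _ hq, hq, X.G.tgt_one])
    (by rw [hq, X.G.src_one])

variable (P X) in
/-- The map `π_P : P ⊗_K G ⊗_K P⁻¹ → E`, `π_P(q ⊗ g ⊗ p⁻¹) = π(g)`. -/
def twistπ : Twist P X → E.Arr :=
  have key : ∀ k, ∃ x, X.π (X.j k) = E.one x := fun k => (X.isExtension.exact _).1 ⟨k, rfl⟩
  have unit : ∀ k, X.π (X.j k) = E.one (K.src k) := fun k => by
    obtain ⟨x, hx⟩ := key k
    have := congrArg E.src hx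
    rw [X.isExtension.π_hom.map_src, X.src_j, E.src_one] at this
    rw [hx, this]
  Quot.lift (fun a => X.π a.1.2.1) <| TwistRel.elim
    (fun q g p k hk hq hp _ _ => by
      have c : X.G.src (X.j k) = X.G.tgt g := by rw [X.src_j, hk, hq]
      simp only
      rw [X.isExtension.π_hom.map_mul _ _ c, unit, hk, hq, ← X.isExtension.π_hom.map_tgt,
        E.one_mul])
    (fun q g p l hl hq hp _ _ => by
      have c : X.G.src g = X.G.tgt (X.j l) := by rw [X.tgt_j, hl, hp]
      simp only
      rw [X.isExtension.π_hom.map_mul _ _ c, unit, hl, hp, ← X.isExtension.π_hom.map_src,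
        E.mul_one])

/-- The manifold with underlying set `P ⊗_K G ⊗_K P⁻¹` and manifold structure `S`. -/
def twistMfd (S : MfdStr (Twist P X)) : Mfd.{u} := ⟨Twist P X, S⟩

/-- The quotient map `(q, g, p⁻¹) ↦ q ⊗ g ⊗ p⁻¹`. -/
def twistMk (S : MfdStr (Twist P X)) (a : tripleSet P X) : twistMfd S :=
  (Quot.mk (TwistRel P X) a : Twist P X)

/-- The manifold structure `S` on the space of arrows of `P ⊗_K G ⊗_K P⁻¹` is the quotient
structure, that is, the (unique) one for which the quotient map from the manifold of triples is a
submersion, and with it `L → P ⊗_K G ⊗_K P⁻¹ → E` is an extension of Lie groupoids. -/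
structure IsTwistStr (S : MfdStr (Twist P X)) : Prop where
  quotient : IsSubmersionFrom (P.Tot.model.prod (X.G.Arr.model.prod P.Tot.model))
    (twistMfd S).model (tripleSet P X) (twistMk S)
  isLie : IsLie (M := M) (A := twistMfd S) (twistGroupoid P X)
  isExtension : IsExtension L E ⟨twistMfd S, twistGroupoid P X, isLie⟩ (twistJ P X) (twistπ P X)

variable (P X) in
/-- The extension `L → P ⊗_K G ⊗_K P⁻¹ → E` obtained by twisting `K → G → E` by `P`. -/
noncomputable def twist (S : MfdStr (Twist P X)) (hS : IsTwistStr S) : Extension L E where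
  G := ⟨twistMfd S, twistGroupoid P X, hS.isLie⟩
  j := twistJ P X
  π := twistπ P X
  isExtension := hS.isExtension

/-- The map `α̂ : G_T → (P ⊗_K G ⊗_K P⁻¹)_T`, `α̂(g) = α(y) ⊗ g ⊗ α(x)⁻¹` for `g : x → y`,
induced by a section `α` of `P` over `T`. -/
noncomputable def sectionHat {T : Set M} {α : T → P.Tot} (hα : IsSectionOver P T α) (S : MfdStr (Twist P X))
    (hS : IsTwistStr S) (g : X.G.restrSet T) : (twist P X S hS).G.restrSet T :=
  ⟨tensor (α ⟨X.G.tgt g, g.2.2⟩) g (α ⟨X.G.src g, g.2.1⟩) (hα.proj_eq _) (hα.proj_eq _), by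
    constructor
    · exact (congrArg (· ∈ T) (hα.proj_eq ⟨X.G.src g, g.2.1⟩)).mpr g.2.1
    · exact (congrArg (· ∈ T) (hα.proj_eq ⟨X.G.tgt g, g.2.2⟩)).mpr g.2.2⟩

end Twist

/-- The restriction `ψ_T : (X.G)_T → (Y.G)_T` of an isomorphism of extensions. -/
noncomputable def ExtIso.restr {M : Mfd.{u}} {K : GroupBundle M} {E : LieGroupoid M} {X Y : Extension K E}
    (ψ : ExtIso X Y) (T : Set M) (g : X.G.restrSet T) : Y.G.restrSet T :=
  ⟨ψ.toDiffeo g, by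
    simp only [LieGroupoid.restrSet, Set.mem_ofPred_eq, ψ.isHom.map_src, ψ.isHom.map_tgt]
    exact g.2⟩

end LieExt

/-!
Near every point `x` of `M` the transversal `T` provides a smooth family of arrows of `E` from
points of `T` to the points near `x` (`LieGroupoid.IsCompleteTransversal.exists_section`): near a
point of `T` this is the inverse function theorem, since the tangent spaces of `T` and of the orbits
span, and a leaf carries such a family from its points in `T` to its other points. Lifting the
family to `H` and to `G` along the two projections gives local smooth frames
(`exists_smooth_frames`): pairs `(a, b)` of arrows of `H` and `G` over the same arrow of `E`, with
target `x` and source in `T`.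

By means of frames at its ends an arrow `h` of `H` is transported to the arrow
`b₂ φ(a₂⁻¹ h a₁) b₁⁻¹` of `G`. A choice of a frame at every point of `M` thus defines an isomorphism
of groupoids `Ψ : H → G` over `E`. It need not be continuous, but changing the frame at a point
changes `Ψ` by an element of `K`, and transport along smooth frames is smooth; so there are sections
`δᵢ` of `K` over the sets of an open cover such that `δⱼ⁻¹ Ψ δᵢ` is smooth. This is the notion of a
`TwistedIso`, and `RestrIso.exists_twistedIso` is the result of the construction.

The bitorsor `P` is the set `K`, on which `K` acts from the left by multiplication and from the
right by multiplication through the automorphism `θ` of `K` induced by `Ψ`. Its manifold structure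
is glued from that of `K` along the bijections `p ↦ p δᵢ` (`GluingData`): the changes of
coordinates are multiplications with `δᵢ⁻¹ δⱼ`, which is smooth, being a local expression of `Ψ` on
units. In these coordinates all structure maps of `P` become smooth (`TwistedIso.bitorsor`).

Then `q ⊗ h ⊗ p⁻¹ ↦ q Ψ(h) p⁻¹` is an isomorphism from `P ⊗ H ⊗ P⁻¹` to `G`. The manifold structure
of `P ⊗ H ⊗ P⁻¹` is transported from `G`; it is the quotient structure because `q` and `p` can be
prescribed to be local sections of `P`, after which `h` is determined
(`TwistedIso.isTwistStr_quotient`). Over `T` the constant frames `(1, 1)` compare with the chosen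
ones by a section `α` of `K`; as a section of `P` it is smooth, it satisfies `α Ψ α⁻¹ = φ`, and it
is central because `φ` is the identity on `K`.
-/


universe v

namespace LieExt

/-! ### Submersions, immersions and local diffeomorphisms -/

section Local

open Manifold Set

variable {EX : Type v} {HX EY HY F : Type*} [NormedAddCommGroup EX] [NormedSpace ℝ EX]
  [TopologicalSpace HX]
  [NormedAddCommGroup EY] [NormedSpace ℝ EY] [TopologicalSpace HY]
  [NormedAddCommGroup F] [NormedSpace ℝ F]
  {I : ModelWithCorners ℝ EX HX} {J : ModelWithCorners ℝ EY HY}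
  {X X' Y : Type*} [TopologicalSpace X] [ChartedSpace HX X]
  [TopologicalSpace X'] [ChartedSpace HX X'] [TopologicalSpace Y] [ChartedSpace HY Y]

theorem trans_mem_maximalAtlas [IsManifold I ∞ X'] (e : OpenPartialHomeomorph X' X)
    (he : ContMDiffOn I I ∞ e e.source) (he' : ContMDiffOn I I ∞ e.symm e.target)
    {c : OpenPartialHomeomorph X HX} (hc : c ∈ IsManifold.maximalAtlas I ∞ X) :
    e.trans c ∈ IsManifold.maximalAtlas I ∞ X' := by
  apply OpenPartialHomeomorph.mem_maximalAtlas_of_contMDiffOn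
  · exact (contMDiffOn_of_mem_maximalAtlas hc).comp (he.mono (by simp))
      (fun x hx => by simpa using hx.2)
  · refine he'.comp ((contMDiffOn_symm_of_mem_maximalAtlas hc).mono (by simp)) ?_
    intro x hx
    simpa using hx.2

theorem submersionAt_comp_localDiffeo [IsManifold I ∞ X'] (e : OpenPartialHomeomorph X' X)
    (he : ContMDiffOn I I ∞ e e.source) (he' : ContMDiffOn I I ∞ e.symm e.target)
    {f : X → Y} {x : X'} (hx : x ∈ e.source) (hf : IsSubmersionAtOfComplement F I J ∞ f (e x)) :
    IsSubmersionAtOfComplement F I J ∞ (f ∘ e) x := by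
  refine IsSubmersionAtOfComplement.mk_of_continuousAt
    (hf.contMDiffAt.continuousAt.comp (e.continuousAt hx)) hf.equiv (e.trans hf.domChart)
    hf.codChart ⟨hx, hf.mem_domChart_source⟩ hf.mem_codChart_source
    (trans_mem_maximalAtlas e he he' hf.domChart_mem_maximalAtlas) hf.codChart_mem_maximalAtlas ?_
  intro z hz
  have h0 : z ∈ (hf.domChart.extend I).target := (by
    simp only [OpenPartialHomeomorph.extend_target, OpenPartialHomeomorph.trans_target] at hz ⊢
    exact ⟨hz.1.1, hz.2⟩)
  have h2 := hf.writtenInCharts h0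
  rw [← h2]
  simp only [OpenPartialHomeomorph.extend_target, OpenPartialHomeomorph.trans_target] at hz
  have : e (e.symm (hf.domChart.symm (I.symm z))) = hf.domChart.symm (I.symm z) :=
    e.right_inv hz.1.2
  simp [this]

theorem immersion_localDiffeo_comp [IsManifold J ∞ Y] {Z : Type*} [TopologicalSpace Z]
    [ChartedSpace HY Z] [IsManifold J ∞ Z] (e : OpenPartialHomeomorph Y Z)
    (he : ContMDiffOn J J ∞ e e.source) (he' : ContMDiffOn J J ∞ e.symm e.target)
    {f : X → Y} {x : X} (hx : f x ∈ e.source) (hf : IsImmersionAtOfComplement F I J ∞ f x) :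
    IsImmersionAtOfComplement F I J ∞ (e ∘ f) x := by
  refine IsImmersionAtOfComplement.mk_of_continuousAt
    ((e.continuousAt hx).comp hf.contMDiffAt.continuousAt) hf.equiv
    (hf.domChart.restr (interior (f ⁻¹' e.source)))
    (e.symm.trans hf.codChart) ?_ ⟨e.map_source hx, ?_⟩ ?_
    (trans_mem_maximalAtlas e.symm he' (by simpa using he) hf.codChart_mem_maximalAtlas) ?_
  · rw [OpenPartialHomeomorph.restr_source]
    refine ⟨hf.mem_domChart_source, ?_⟩
    rw [interior_interior, mem_interior_iff_mem_nhds]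
    exact hf.contMDiffAt.continuousAt.preimage_mem_nhds (e.open_source.mem_nhds hx)
  · simpa [e.left_inv hx] using hf.mem_codChart_source
  · exact restr_mem_maximalAtlas _ hf.domChart_mem_maximalAtlas isOpen_interior
  intro z hz
  simp only [OpenPartialHomeomorph.extend_target, OpenPartialHomeomorph.restr_target] at hz
  have h0 : z ∈ (hf.domChart.extend I).target := (by
    simp only [OpenPartialHomeomorph.extend_target] at hz ⊢
    exact ⟨hz.1.1, hz.2⟩)
  have h2 := hf.writtenInCharts h0
  rw [← h2]
  have h3 : f (hf.domChart.symm (I.symm z)) ∈ e.source := by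
    have := hz.1.2
    simp only [interior_interior, mem_preimage] at this
    exact (interior_subset this : _ ∈ f ⁻¹' e.source)
  simp [e.left_inv h3]

/-- Near a point of its domain, a submersion is a projection: `q` is a coordinate along the
fibres, and `b` reconstructs a point from its image and its fibre coordinate. -/
theorem exists_straightening [I.Boundaryless] [IsManifold I ∞ X] [IsManifold J ∞ Y] {f : X → Y}
    (hf : IsSubmersion I J ∞ f) (a : X) :
    ∃ (F : Type v) (_ : NormedAddCommGroup F) (_ : NormedSpace ℝ F) (N : Set (Y × F))
      (b : Y × F → X) (q : X → F), IsOpen N ∧ (f a, q a) ∈ N ∧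
      ContMDiffOn (J.prod 𝓘(ℝ, F)) I ∞ b N ∧ (∀ z ∈ N, f (b z) = z.1) ∧
      ContMDiffAt I 𝓘(ℝ, F) ∞ q a ∧ ∀ᶠ x in 𝓝 a, b (f x, q x) = x := by
  have h := hf.isSubmersionAt a
  set φ := h.domChart
  set ψ := h.codChart
  have hopen : IsOpen (φ.extend I).target := by
    rw [OpenPartialHomeomorph.extend_target]
    simpa [I.range_eq_univ] using φ.open_target.preimage I.continuous_symm
  have hd := h.writtenInCharts
  have hb : ∀ x ∈ φ.source, h.equiv.symm (ψ.extend J (f x), (h.equiv (φ.extend I x)).2) =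
      φ.extend I x := by
    intro x hx
    rw [← φ.extend_source (I := I)] at hx
    have h2 : ψ.extend J _ = _ := hd ((φ.extend I).map_source hx)
    rw [Function.comp_apply, (φ.extend I).left_inv hx] at h2
    rw [h2]
    simp
  have hc : ContMDiffOn (J.prod 𝓘(ℝ, h.complement)) 𝓘(ℝ, EX) ∞
      (fun z : Y × h.complement => h.equiv.symm (ψ.extend J z.1, z.2)) (ψ.source ×ˢ univ) :=
    h.equiv.symm.contDiff.contMDiff.comp_contMDiffOn
      (((ψ.contMDiffOn_extend h.codChart_mem_maximalAtlas).comp contMDiffOn_fst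
        fun z hz => hz.1).prodMk_space contMDiffOn_snd)
  refine ⟨h.complement, inferInstance, inferInstance,
    ψ.source ×ˢ univ ∩ (fun z => h.equiv.symm (ψ.extend J z.1, z.2)) ⁻¹' (φ.extend I).target,
    fun z => (φ.extend I).symm (h.equiv.symm (ψ.extend J z.1, z.2)),
    fun x => (h.equiv (φ.extend I x)).2,
    hc.continuousOn.isOpen_inter_preimage (ψ.open_source.prod isOpen_univ) hopen,
    ⟨⟨h.mem_codChart_source, mem_univ _⟩, ?_⟩, ?_, ?_, ?_, ?_⟩
  · rw [Set.mem_preimage, hb a h.mem_domChart_source]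
    refine (φ.extend I).map_source ?_
    rw [φ.extend_source]; exact h.mem_domChart_source
  · refine (contMDiffOn_extend_symm h.domChart_mem_maximalAtlas).comp
      (hc.mono inter_subset_left) fun y hy => ?_
    rw [← OpenPartialHomeomorph.extend_target']
    exact hy.2
  · intro z hz
    have h1 : (φ.extend I).symm (h.equiv.symm (ψ.extend J z.1, z.2)) ∈ φ.source := by
      rw [← φ.extend_source (I := I)]; exact (φ.extend I).map_target hz.2
    have h2 : ψ.extend J (f _) = (h.equiv (h.equiv.symm (ψ.extend J z.1, z.2))).1 := hd hz.2
    rw [ContinuousLinearEquiv.apply_symm_apply] at h2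
    refine (ψ.extend J).injOn ?_ ?_ h2
    · rw [ψ.extend_source]; exact h.source_subset_preimage_source h1
    · rw [ψ.extend_source]; exact hz.1.1
  · exact (contDiff_snd.comp h.equiv.contDiff).contMDiff.contMDiffAt.comp a
      (φ.contMDiffAt_extend h.domChart_mem_maximalAtlas h.mem_domChart_source)
  · filter_upwards [φ.open_source.mem_nhds h.mem_domChart_source] with x hx
    simp only [hb x hx]
    exact (φ.extend I).left_inv (by rwa [φ.extend_source])

/-- Through each point of its domain, a submersion has a smooth local section. -/
theorem exists_localSection [I.Boundaryless] [IsManifold I ∞ X] [IsManifold J ∞ Y] {f : X → Y}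
    (hf : IsSubmersion I J ∞ f) (a : X) :
    ∃ U : Set Y, IsOpen U ∧ f a ∈ U ∧ ∃ σ : Y → X, ContMDiffOn J I ∞ σ U ∧ σ (f a) = a ∧
      ∀ y ∈ U, f (σ y) = y := by
  obtain ⟨F, _, _, N, b, q, hN, ha, hb, hfb, -, hbq⟩ := exists_straightening hf a
  have hc : ContMDiff J (J.prod 𝓘(ℝ, F)) ∞ fun y : Y => (y, q a) :=
    contMDiff_id.prodMk contMDiff_const
  exact ⟨(fun y => (y, q a)) ⁻¹' N, hN.preimage hc.continuous, ha, fun y => b (y, q a),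
    hb.comp hc.contMDiffOn fun y hy => hy, hbq.self_of_nhds, fun y hy => hfb _ hy⟩

/-- A smooth embedding has, near each point of its image, a smooth left inverse. -/
theorem exists_localRetraction [I.Boundaryless] [IsManifold I ∞ X] [IsManifold J ∞ Y] {f : X → Y}
    (hf : IsSmoothEmbedding I J ∞ f) (a : X) :
    ∃ U : Set Y, IsOpen U ∧ f a ∈ U ∧ ∃ r : Y → X, ContMDiffOn J I ∞ r U ∧
      ∀ x, f x ∈ U → r (f x) = x := by
  have h := hf.isImmersion.isImmersionAt a
  set φ := h.domChart
  set ψ := h.codChart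
  have ha : a ∈ (φ.extend I).source := by
    rw [OpenPartialHomeomorph.extend_source]; exact h.mem_domChart_source
  have hc : ContMDiffOn J 𝓘(ℝ, EX) ∞ (fun y => (h.equiv.symm (ψ.extend J y)).1) ψ.source :=
    (contDiff_fst.comp h.equiv.symm.contDiff).contMDiff.comp_contMDiffOn
      (ψ.contMDiffOn_extend h.codChart_mem_maximalAtlas)
  have hopen : IsOpen (φ.extend I).target := by
    rw [OpenPartialHomeomorph.extend_target]
    simpa [I.range_eq_univ] using φ.open_target.preimage I.continuous_symm
  have hx : ∀ x ∈ (φ.extend I).source, (h.equiv.symm (ψ.extend J (f x))).1 = φ.extend I x := by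
    intro x hx
    have h2 : ψ.extend J _ = _ := h.writtenInCharts ((φ.extend I).map_source hx)
    rw [Function.comp_apply, (φ.extend I).left_inv hx] at h2
    rw [h2]; simp
  obtain ⟨V, hV, hVφ⟩ := hf.isEmbedding.isInducing.isOpen_iff.1 φ.open_source
  refine ⟨(ψ.source ∩ (fun y => (h.equiv.symm (ψ.extend J y)).1) ⁻¹' (φ.extend I).target) ∩ V,
    (hc.continuousOn.isOpen_inter_preimage ψ.open_source hopen).inter hV,
    ⟨⟨h.mem_codChart_source, ?_⟩, ?_⟩,
    fun y => (φ.extend I).symm (h.equiv.symm (ψ.extend J y)).1, ?_, ?_⟩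
  · rw [Set.mem_preimage, hx a ha]; exact (φ.extend I).map_source ha
  · have : a ∈ f ⁻¹' V := hVφ ▸ h.mem_domChart_source
    exact this
  · refine (contMDiffOn_extend_symm h.domChart_mem_maximalAtlas).comp
      (hc.mono fun y hy => hy.1.1) fun y hy => ?_
    rw [← OpenPartialHomeomorph.extend_target']
    exact hy.1.2
  · intro x hxU
    have h1 : x ∈ (φ.extend I).source := by
      rw [φ.extend_source]
      have : x ∈ f ⁻¹' V := hxU.2
      rwa [hVφ] at this
    simp only
    rw [hx x h1, (φ.extend I).left_inv h1]

/-- A map into an embedded submanifold is smooth if it is smooth as a map into the ambient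
manifold; the map need not be known to be continuous. -/
theorem contMDiffOn_of_embedding_comp [I.Boundaryless] [IsManifold I ∞ X] [IsManifold J ∞ Y]
    {f : X → Y} (hf : IsSmoothEmbedding I J ∞ f) {E' H' Z : Type*} [NormedAddCommGroup E'] [NormedSpace ℝ E']
    [TopologicalSpace H'] {I' : ModelWithCorners ℝ E' H'} [TopologicalSpace Z] [ChartedSpace H' Z]
    {g : Z → X} {s : Set Z} (hg : ContMDiffOn I' J ∞ (f ∘ g) s) : ContMDiffOn I' I ∞ g s := by
  intro z hz
  obtain ⟨U, hU, hzU, r, hr, hrf⟩ := exists_localRetraction hf (g z)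
  have h1 : ContMDiffWithinAt I' I ∞ (r ∘ (f ∘ g)) s z :=
    (hr.contMDiffAt (hU.mem_nhds hzU)).comp_contMDiffWithinAt z (hg z hz)
  refine h1.congr_of_eventuallyEq ?_ (hrf _ hzU).symm
  filter_upwards [(hg z hz).continuousWithinAt.preimage_mem_nhdsWithin (hU.mem_nhds hzU)] with w hw
  exact (hrf _ hw).symm

end Local

/-! ### Gluing manifolds -/

/-- Bijections `e i` between subsets of `X` and subsets of a manifold `Y`, whose domains cover `X`
and whose changes of coordinates are smooth on open sets. -/
structure GluingData (X : Type u) (Y : Mfd.{u}) (ι : Type*) where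
  e : ι → PartialEquiv X Y
  cover : ∀ x, ∃ i, x ∈ (e i).source
  isOpen_overlap : ∀ i j, IsOpen ((e i).target ∩ (e i).symm ⁻¹' (e j).source)
  smooth : ∀ i j, ContMDiffOn Y.model Y.model ∞ (e j ∘ (e i).symm)
    ((e i).target ∩ (e i).symm ⁻¹' (e j).source)

namespace GluingData

variable {X : Type u} {Y : Mfd.{u}} {ι : Type*} (D : GluingData X Y ι)

/-- The topology glued from those of the images of the `e i`. -/
@[reducible]
def topology : TopologicalSpace X where
  IsOpen W := ∀ i, IsOpen ((D.e i).target ∩ (D.e i).symm ⁻¹' W)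
  isOpen_univ i := by
    have := D.isOpen_overlap i i
    rw [Set.inter_eq_left.2 (D.e i).target_subset_preimage_source] at this
    rwa [Set.preimage_univ, Set.inter_univ]
  isOpen_inter s t hs ht i := by
    rw [Set.preimage_inter, Set.inter_inter_distrib_left]
    exact (hs i).inter (ht i)
  isOpen_sUnion S hS i := by
    rw [Set.preimage_sUnion, Set.inter_iUnion₂]
    exact isOpen_biUnion fun t ht => hS t ht i

/-- The set `X`, as the carrier of the glued manifold. -/
def Glued (_ : GluingData X Y ι) : Type u := X

instance : TopologicalSpace D.Glued := D.topology

/-- The bijection `e i` as a homeomorphism between open sets. -/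
def homeo (i : ι) : OpenPartialHomeomorph D.Glued Y where
  toPartialEquiv := D.e i
  open_source := fun j => D.isOpen_overlap j i
  open_target := by
    have := D.isOpen_overlap i i
    rwa [Set.inter_eq_left.2 (D.e i).target_subset_preimage_source] at this
  continuousOn_toFun := by
    have h : IsOpen (X := D.Glued) (D.e i).source := fun j => D.isOpen_overlap j i
    refine (continuousOn_open_iff h).2 fun s hs j => ?_
    have := (D.smooth j i).continuousOn.isOpen_inter_preimage (D.isOpen_overlap j i) hs
    rw [Set.inter_assoc] at this
    exact this
  continuousOn_invFun := by
    have h := D.isOpen_overlap i i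
    rw [Set.inter_eq_left.2 (D.e i).target_subset_preimage_source] at h
    exact (continuousOn_open_iff h).2 fun W hW => hW i

noncomputable instance : ChartedSpace (EuclideanSpace ℝ (Fin Y.dim)) D.Glued where
  atlas := {c | ∃ i y, c = (D.homeo i).trans (chartAt (EuclideanSpace ℝ (Fin Y.dim)) y)}
  chartAt x := (D.homeo (D.cover x).choose).trans
    (chartAt (EuclideanSpace ℝ (Fin Y.dim)) (D.e (D.cover x).choose x))
  mem_chart_source x := ⟨(D.cover x).choose_spec, mem_chart_source _ _⟩
  chart_mem_atlas _ := ⟨_, _, rfl⟩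

instance : IsManifold (𝓡 Y.dim) ∞ D.Glued := by
  refine isManifold_of_contDiffOn _ _ _ ?_
  rintro _ _ ⟨i, y, rfl⟩ ⟨j, z, rfl⟩
  rw [← contMDiffOn_iff_contDiffOn]
  have h1 := contMDiffOn_chart_symm (I := 𝓡 Y.dim) (n := ∞) (x := y)
  have h2 := contMDiffOn_chart (I := 𝓡 Y.dim) (n := ∞) (x := z)
  refine (h2.comp ((D.smooth i j).comp (h1.mono ?_) ?_) ?_)
  · rintro x ⟨hx, -⟩
    exact hx.1.1
  · rintro x ⟨hx, -⟩
    exact ⟨hx.1.2, hx.2.1⟩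
  · rintro x ⟨hx, -⟩
    exact hx.2.2

theorem homeo_trans_mem_maximalAtlas (i : ι) (y : Y) :
    (D.homeo i).trans (chartAt (EuclideanSpace ℝ (Fin Y.dim)) y) ∈
      IsManifold.maximalAtlas (𝓡 Y.dim) ∞ D.Glued :=
  IsManifold.subset_maximalAtlas ⟨i, y, rfl⟩

theorem smooth_homeo (i : ι) :
    ContMDiffOn (𝓡 Y.dim) Y.model ∞ (D.homeo i) (D.homeo i).source := by
  intro x hx
  set c := chartAt (EuclideanSpace ℝ (Fin Y.dim)) (D.homeo i x)
  have hc := D.homeo_trans_mem_maximalAtlas i (D.homeo i x)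
  have hcx : D.homeo i x ∈ c.source := mem_chart_source _ _
  have h1 := contMDiffAt_of_mem_maximalAtlas (x := x) hc ⟨hx, hcx⟩
  have h2 : ContMDiffAt Y.model Y.model ∞ c.symm (c (D.homeo i x)) :=
    (contMDiffOn_chart_symm (I := Y.model) (n := ∞)).contMDiffAt
      (c.open_target.mem_nhds (c.map_source hcx))
  have h3 : ContMDiffAt (𝓡 Y.dim) Y.model ∞ (c.symm ∘ ((D.homeo i).trans c)) x := h2.comp x h1
  refine (h3.congr_of_eventuallyEq ?_).contMDiffWithinAt
  filter_upwards [((D.homeo i).trans c).open_source.mem_nhds ⟨hx, hcx⟩] with z hz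
  exact (c.left_inv hz.2).symm

theorem smooth_homeo_symm (i : ι) :
    ContMDiffOn Y.model (𝓡 Y.dim) ∞ (D.homeo i).symm (D.homeo i).target := by
  intro y hy
  set c := chartAt (EuclideanSpace ℝ (Fin Y.dim)) y
  have hc := D.homeo_trans_mem_maximalAtlas i y
  have hcy : y ∈ c.source := mem_chart_source _ _
  have h1 : ContMDiffAt Y.model Y.model ∞ c y :=
    (contMDiffOn_chart (I := Y.model) (n := ∞)).contMDiffAt (c.open_source.mem_nhds hcy)
  have h2 := contMDiffAt_symm_of_mem_maximalAtlas (x := c y) hc (by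
    refine ⟨c.map_source hcy, ?_⟩
    change c.symm (c y) ∈ (D.homeo i).target
    rwa [c.left_inv hcy])
  have h3 : ContMDiffAt Y.model (𝓡 Y.dim) ∞ (((D.homeo i).trans c).symm ∘ c) y := h2.comp y h1
  refine (h3.congr_of_eventuallyEq ?_).contMDiffWithinAt
  filter_upwards [c.open_source.mem_nhds hcy] with z hz
  exact congrArg (D.homeo i).symm (c.left_inv (x := z) hz).symm

/-- The glued manifold structure on `X`. -/
noncomputable def mfdStr : MfdStr X where
  dim := Y.dim
  top := inferInstanceAs (TopologicalSpace D.Glued)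
  charted := inferInstanceAs (ChartedSpace (EuclideanSpace ℝ (Fin Y.dim)) D.Glued)
  smooth := inferInstanceAs (IsManifold (𝓡 Y.dim) ∞ D.Glued)

/-- The glued manifold. -/
noncomputable def mfd : Mfd.{u} := ⟨X, D.mfdStr⟩

/-- The bijection `e i` as a diffeomorphism between open sets. -/
noncomputable def chart (i : ι) : OpenPartialHomeomorph D.mfd Y := D.homeo i

theorem smooth_chart (i : ι) :
    ContMDiffOn D.mfd.model Y.model ∞ (D.chart i) (D.chart i).source := D.smooth_homeo i

theorem smooth_chart_symm (i : ι) :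
    ContMDiffOn Y.model D.mfd.model ∞ (D.chart i).symm (D.chart i).target := D.smooth_homeo_symm i

section Maps

open Manifold

variable {F E' H' N : Type*} [NormedAddCommGroup F] [NormedSpace ℝ F] [NormedAddCommGroup E']
  [NormedSpace ℝ E'] [TopologicalSpace H'] {J : ModelWithCorners ℝ E' H'} [TopologicalSpace N]
  [ChartedSpace H' N]

theorem submersionAt_comp_chart (i : ι) {f : Y → N} {x : D.mfd} (hx : x ∈ (D.chart i).source)
    (hf : IsSubmersionAtOfComplement F Y.model J ∞ f (D.chart i x)) :
    IsSubmersionAtOfComplement F D.mfd.model J ∞ (f ∘ D.chart i) x :=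
  submersionAt_comp_localDiffeo (X' := D.Glued) (D.homeo i) (D.smooth_homeo i)
    (D.smooth_homeo_symm i) hx hf

theorem immersionAt_chart_symm_comp (i : ι) {f : N → Y} {x : N} (hx : f x ∈ (D.chart i).target)
    (hf : IsImmersionAtOfComplement F J Y.model ∞ f x) :
    IsImmersionAtOfComplement F J D.mfd.model ∞ ((D.chart i).symm ∘ f) x :=
  immersion_localDiffeo_comp (Z := D.Glued) (D.homeo i).symm (D.smooth_homeo_symm i)
    (D.smooth_homeo i) hx hf

end Maps

end GluingData

/-! ### Arrows from a complete transversal -/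

section Surjective

open Manifold Set

theorem HasMFDerivAt.congr_point {EX HX EY HY : Type*} [NormedAddCommGroup EX] [NormedSpace ℝ EX]
    [TopologicalSpace HX] [NormedAddCommGroup EY] [NormedSpace ℝ EY] [TopologicalSpace HY]
    {I : ModelWithCorners ℝ EX HX} {J : ModelWithCorners ℝ EY HY} {X Y : Type*}
    [TopologicalSpace X] [ChartedSpace HX X] [TopologicalSpace Y] [ChartedSpace HY Y]
    {f : X → Y} {x y : X} {f' : EX →L[ℝ] EY} (h : HasMFDerivAt I J f x f') (e : x = y) :
    HasMFDerivAt I J f y f' := by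
  subst e; exact h

variable {EX HX EY HY : Type*} [NormedAddCommGroup EX] [NormedSpace ℝ EX] [TopologicalSpace HX]
  [NormedAddCommGroup EY] [NormedSpace ℝ EY] [FiniteDimensional ℝ EY] [TopologicalSpace HY]
  {I : ModelWithCorners ℝ EX HX} {J : ModelWithCorners ℝ EY HY}
  {X Y : Type*} [TopologicalSpace X] [ChartedSpace HX X] [IsManifold I ∞ X]
  [TopologicalSpace Y] [ChartedSpace HY Y] [IsManifold J ∞ Y]

/-- The inverse function theorem, with a local inverse which is smooth on an open set and not only
at the given point. -/
theorem exists_localInverse_of_fderiv_eq_id {h : EY → EY} {O : Set EY} (hO : IsOpen O)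
    (hh : ContDiffOn ℝ ∞ h O) {p : EY} (hp : p ∈ O)
    (hd : HasFDerivAt h (ContinuousLinearMap.id ℝ EY) p) :
    ∃ (V : Set EY) (k : EY → EY), IsOpen V ∧ h p ∈ V ∧ ContDiffOn ℝ ∞ k V ∧ k (h p) = p ∧
      ∀ y ∈ V, k y ∈ O ∧ h (k y) = y := by
  have : CompleteSpace EY := FiniteDimensional.complete ℝ EY
  have hat : ∀ w ∈ O, ContDiffAt ℝ ∞ h w := fun w hw => hh.contDiffAt (hO.mem_nhds hw)
  have hd' : HasFDerivAt h ((ContinuousLinearEquiv.refl ℝ EY : EY ≃L[ℝ] EY) : EY →L[ℝ] EY) p := hd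
  set Φ := (hat p hp).toOpenPartialHomeomorph h hd' (by simp)
  have hΦ : ∀ w, Φ w = h w := fun w => rfl
  have hpΦ : p ∈ Φ.source := (hat p hp).mem_toOpenPartialHomeomorph_source hd' (by simp)
  have hcont : ContinuousOn (fderiv ℝ h) O := hh.continuousOn_fderiv_of_isOpen hO (by simp)
  have hD : IsOpen (O ∩ fderiv ℝ h ⁻¹' range ((↑) : (EY ≃L[ℝ] EY) → EY →L[ℝ] EY)) :=
    hcont.isOpen_inter_preimage hO ContinuousLinearEquiv.isOpen
  set D := O ∩ fderiv ℝ h ⁻¹' range ((↑) : (EY ≃L[ℝ] EY) → EY →L[ℝ] EY)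
  have hpD : p ∈ D := ⟨hp, ⟨ContinuousLinearEquiv.refl ℝ EY, hd'.fderiv.symm⟩⟩
  refine ⟨(Φ.restr D).target, Φ.symm, (Φ.restr D).open_target, ?_, ?_, Φ.left_inv hpΦ, ?_⟩
  · exact (Φ.restr D).map_source (by rw [Φ.restr_source' D hD]; exact ⟨hpΦ, hpD⟩)
  · intro y hy
    have hy' := (Φ.restr D).map_target hy
    rw [Φ.restr_source' D hD] at hy'
    obtain ⟨h1, h2, ⟨e, he⟩⟩ := hy'
    rw [Φ.restr_symm_apply] at h1 h2 he
    refine (Φ.contDiffAt_symm (f₀' := e) hy.1 ?_ (hat _ h2)).contDiffWithinAt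
    rw [he]
    exact ((hat _ h2).differentiableAt (by simp)).hasFDerivAt
  · intro y hy
    have hy' := (Φ.restr D).map_target hy
    rw [Φ.restr_source' D hD] at hy'
    exact ⟨hy'.2.1, Φ.right_inv hy.1⟩

/-- A smooth map whose derivative at a point is surjective has a smooth local section through
that point. -/
theorem exists_localSection_of_surjective_mfderiv [I.Boundaryless] [J.Boundaryless]
    {f : X → Y} {W : Set X} (hW : IsOpen W)
    (hf : ContMDiffOn I J ∞ f W) {a : X} (ha : a ∈ W) (hs : Function.Surjective (mfderiv I J f a)) :
    ∃ (U : Set Y) (s : Y → X), IsOpen U ∧ f a ∈ U ∧ ContMDiffOn J I ∞ s U ∧ s (f a) = a ∧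
      ∀ y ∈ U, s y ∈ W ∧ f (s y) = y := by
  set χ := extChartAt I a
  set φ := extChartAt J (f a)
  have hχa : a ∈ χ.source := mem_extChartAt_source a
  have hφa : f a ∈ φ.source := mem_extChartAt_source (f a)
  have hfa : MDifferentiableAt I J f a :=
    (hf.contMDiffAt (hW.mem_nhds ha)).mdifferentiableAt (by simp)
  have hW1 : IsOpen (W ∩ f ⁻¹' φ.source) :=
    hf.continuousOn.isOpen_inter_preimage hW (isOpen_extChartAt_source (f a))
  set W' := W ∩ f ⁻¹' φ.source
  set O := χ.target ∩ χ.symm ⁻¹' W'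
  have hO : IsOpen O :=
    (contMDiffOn_extChartAt_symm (I := I) (n := ∞) a).continuousOn.isOpen_inter_preimage
      (isOpen_extChartAt_target a) hW1
  have hg : ContDiffOn ℝ ∞ (φ ∘ f ∘ χ.symm) O := by
    rw [← contMDiffOn_iff_contDiffOn]
    refine (contMDiffOn_extChartAt (I := J) (n := ∞) (x := f a)).comp (hf.comp
      ((contMDiffOn_extChartAt_symm (I := I) (n := ∞) a).mono inter_subset_left)
      fun z hz => hz.2.1) fun z hz => ?_
    rw [← extChartAt_source J]
    exact hz.2.2
  let f' : EX →L[ℝ] EY := mfderiv I J f a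
  have hga : HasFDerivAt (φ ∘ f ∘ χ.symm) f' (χ a) := by
    have := hfa.hasMFDerivAt.2
    rw [I.range_eq_univ] at this
    exact hasFDerivWithinAt_univ.1 this
  obtain ⟨R, hR⟩ := f'.exists_rightInverse_of_surjective (LinearMap.range_eq_top.2 hs)
  set p := φ (f a)
  set A : EY → EX := fun w => χ a + R (w - p)
  have hA : ContDiff ℝ ∞ A := by fun_prop
  have hAp : A p = χ a := by simp [A]
  have hχO : χ a ∈ O := ⟨χ.map_source hχa, by
    change χ.symm (χ a) ∈ W'
    rw [χ.left_inv hχa]; exact ⟨ha, hφa⟩⟩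
  have hdA : HasFDerivAt A R p := by
    have h1 : HasFDerivAt (fun w : EY => w - p) (ContinuousLinearMap.id ℝ EY) p :=
      (hasFDerivAt_id p).sub_const p
    exact (R.hasFDerivAt.comp p h1).const_add (χ a)
  obtain ⟨V, k, hV, hpV, hk, hkp, hkV⟩ := exists_localInverse_of_fderiv_eq_id
    (h := (φ ∘ f ∘ χ.symm) ∘ A) (O := A ⁻¹' O) (hO.preimage hA.continuous)
    (hg.comp hA.contDiffOn fun w hw => hw) (p := p) (by rw [mem_preimage, hAp]; exact hχO) (by
      rw [← hR]
      refine HasFDerivAt.comp p ?_ hdA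
      rwa [hAp])
  have hval : ((φ ∘ f ∘ χ.symm) ∘ A) p = p := by
    simp only [Function.comp_apply, hAp, χ.left_inv hχa]; rfl
  rw [hval] at hpV hkp
  have hφc := contMDiffOn_extChartAt (I := J) (n := ∞) (x := f a)
  rw [← extChartAt_source J] at hφc
  refine ⟨φ.source ∩ φ ⁻¹' V, fun y => χ.symm (A (k (φ y))),
    hφc.continuousOn.isOpen_inter_preimage (isOpen_extChartAt_source (f a)) hV,
    ⟨hφa, hpV⟩, ?_, ?_, ?_⟩
  · refine (contMDiffOn_extChartAt_symm (I := I) (n := ∞) a).comp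
      (hA.contMDiff.comp_contMDiffOn (hk.contMDiffOn.comp (hφc.mono inter_subset_left)
        fun y hy => hy.2)) fun y hy => (hkV _ hy.2).1.1
  · change χ.symm (A (k p)) = a
    rw [hkp, hAp, χ.left_inv hχa]
  · intro y hy
    obtain ⟨⟨h1, h2⟩, h3⟩ := hkV _ hy.2
    exact ⟨h2.1, φ.injOn h2.2 hy.1 h3⟩

end Surjective

namespace LieGroupoid

variable {M : Mfd.{u}} {E : LieGroupoid M} {T : Set M}

/-- Near a point of a complete transversal `T`, every point is the target of an arrow with source
in `T`, which depends smoothly on it. -/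
theorem IsCompleteTransversal.exists_section_near
    (hT : E.IsCompleteTransversal T) (t : T) :
    ∃ U : Set M, IsOpen U ∧ (t : M) ∈ U ∧ ∃ σ : M → E.Arr, ContMDiffOn M.model E.Arr.model ∞ σ U ∧
      ∀ y ∈ U, E.tgt (σ y) = y ∧ E.src (σ y) ∈ T := by
  obtain ⟨⟨d, _, _, hemb, hcompl⟩, -⟩ := hT
  obtain ⟨F, _, _, N, b, q, hN, hN1, hb, hsb, hq, hbq⟩ :=
    exists_straightening E.isLie.src_submersion (E.one t)
  set p := E.one t
  set w := q p
  have hsp : E.src p = t := E.src_one t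
  have htp : E.tgt p = t := E.tgt_one t
  have hbp : b (E.src p, w) = p := hbq.self_of_nhds
  let dι : EuclideanSpace ℝ (Fin d) →L[ℝ] EuclideanSpace ℝ (Fin M.dim) :=
    mfderiv (𝓡 d) M.model (Subtype.val : T → M) t
  let ds : EuclideanSpace ℝ (Fin E.Arr.dim) →L[ℝ] EuclideanSpace ℝ (Fin M.dim) :=
    mfderiv E.Arr.model M.model E.src p
  let dt : EuclideanSpace ℝ (Fin E.Arr.dim) →L[ℝ] EuclideanSpace ℝ (Fin M.dim) :=
    mfderiv E.Arr.model M.model E.tgt p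
  let du : EuclideanSpace ℝ (Fin M.dim) →L[ℝ] EuclideanSpace ℝ (Fin E.Arr.dim) :=
    mfderiv M.model E.Arr.model E.one t
  let dq : EuclideanSpace ℝ (Fin E.Arr.dim) →L[ℝ] F := mfderiv E.Arr.model 𝓘(ℝ, F) q p
  let db : (EuclideanSpace ℝ (Fin M.dim) × F) →L[ℝ] EuclideanSpace ℝ (Fin E.Arr.dim) :=
    mfderiv (M.model.prod 𝓘(ℝ, F)) E.Arr.model b (E.src p, w)
  have hι : HasMFDerivAt (𝓡 d) M.model (Subtype.val : T → M) t dι :=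
    (hemb.isImmersion.contMDiff.mdifferentiable (by simp) t).hasMFDerivAt
  have hs : HasMFDerivAt E.Arr.model M.model E.src p ds :=
    (E.isLie.src_submersion.contMDiff.mdifferentiable (by simp) p).hasMFDerivAt
  have ht : HasMFDerivAt E.Arr.model M.model E.tgt p dt :=
    (E.isLie.tgt_submersion.contMDiff.mdifferentiable (by simp) p).hasMFDerivAt
  have hu : HasMFDerivAt M.model E.Arr.model E.one t du :=
    (E.isLie.one_smooth.mdifferentiable (by simp) t).hasMFDerivAt
  have hq' : HasMFDerivAt E.Arr.model 𝓘(ℝ, F) q p dq :=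
    (hq.mdifferentiableAt (by simp)).hasMFDerivAt
  have hb' : HasMFDerivAt (M.model.prod 𝓘(ℝ, F)) E.Arr.model b (E.src p, w) db :=
    ((hb.contMDiffAt (hN.mem_nhds hN1)).mdifferentiableAt (by simp)).hasMFDerivAt
  have e1 : ∀ v, ds (db v) = v.1 := by
    have h1 := HasMFDerivAt.comp (E.src p, w) (HasMFDerivAt.congr_point hs hbp.symm) hb'
    have h2 := (hasMFDerivAt_fst (I := M.model) (I' := 𝓘(ℝ, F)) (E.src p, w)).congr_of_eventuallyEq
      (f₁ := E.src ∘ b) (by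
        filter_upwards [hN.mem_nhds hN1] with z hz using hsb z hz)
    intro v
    exact DFunLike.congr_fun (hasMFDerivAt_unique h1 h2) v
  have e2 : ∀ v, ds (du v) = v := by
    have h1 := HasMFDerivAt.comp (t : M) hs hu
    have h2 := (hasMFDerivAt_id (I := M.model) (t : M)).congr_of_eventuallyEq
      (f₁ := E.src ∘ E.one) (Filter.Eventually.of_forall E.src_one)
    intro v
    exact DFunLike.congr_fun (hasMFDerivAt_unique h1 h2) v
  have e3 : ∀ v, dt (du v) = v := by
    have h1 := HasMFDerivAt.comp (t : M) ht hu
    have h2 := (hasMFDerivAt_id (I := M.model) (t : M)).congr_of_eventuallyEq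
      (f₁ := E.tgt ∘ E.one) (Filter.Eventually.of_forall E.tgt_one)
    intro v
    exact DFunLike.congr_fun (hasMFDerivAt_unique h1 h2) v
  have e4 : ∀ v, db (ds v, dq v) = v := by
    have h1 := HasMFDerivAt.comp p hb' (hs.prodMk hq')
    have h2 := (hasMFDerivAt_id (I := E.Arr.model) p).congr_of_eventuallyEq
      (f₁ := b ∘ fun x => (E.src x, q x)) hbq
    intro v
    exact DFunLike.congr_fun (hasMFDerivAt_unique h1 h2) v
  have hj : ContMDiff ((𝓡 d).prod 𝓘(ℝ, F)) (M.model.prod 𝓘(ℝ, F)) ∞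
      (fun z : T × F => ((z.1 : M), z.2)) :=
    (hemb.isImmersion.contMDiff.comp contMDiff_fst).prodMk contMDiff_snd
  have hW : IsOpen ((fun z : T × F => ((z.1 : M), z.2)) ⁻¹' N) := hN.preimage hj.continuous
  have hf : ContMDiffOn ((𝓡 d).prod 𝓘(ℝ, F)) M.model ∞
      (E.tgt ∘ b ∘ fun z : T × F => ((z.1 : M), z.2)) ((fun z : T × F => ((z.1 : M), z.2)) ⁻¹' N) :=
    E.isLie.tgt_submersion.contMDiff.comp_contMDiffOn (hb.comp hj.contMDiffOn fun z hz => hz)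
  have haW : (t, w) ∈ (fun z : T × F => ((z.1 : M), z.2)) ⁻¹' N := by
    have : ((t : M), w) ∈ N := by rw [← hsp]; exact hN1
    exact this
  have hpt : (E.src p, w) = ((t : M), w) := by rw [hsp]
  have hjd : HasMFDerivAt ((𝓡 d).prod 𝓘(ℝ, F)) (M.model.prod 𝓘(ℝ, F))
      (fun z : T × F => ((z.1 : M), z.2)) (t, w)
      ((dι ∘L ContinuousLinearMap.fst ℝ _ F).prod (ContinuousLinearMap.snd ℝ _ F)) :=
    (HasMFDerivAt.comp (t, w) hι (hasMFDerivAt_fst (t, w))).prodMk (hasMFDerivAt_snd (t, w))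
  have hbd := HasMFDerivAt.comp (f := fun z : T × F => ((z.1 : M), z.2)) (t, w)
    (HasMFDerivAt.congr_point hb' hpt) hjd
  have hd := HasMFDerivAt.comp (t, w) (HasMFDerivAt.congr_point ht
    (show p = (b ∘ fun z : T × F => ((z.1 : M), z.2)) (t, w) by
      change p = b ((t : M), w)
      rw [← hpt, hbp])) hbd
  have hsum : ∀ v : EuclideanSpace ℝ (Fin M.dim), ∃ a k, ds k = 0 ∧ dι a + dt k = v := by
    intro v
    have hv := (codisjoint_iff.1 (hcompl t).2).ge (Submodule.mem_top (x := v))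
    obtain ⟨_, ⟨a, rfl⟩, _, ⟨k, hk, rfl⟩, h⟩ := Submodule.mem_sup.1 hv
    exact ⟨a, k, hk, h⟩
  obtain ⟨U, s, hU, htU, hsm, -, hsU⟩ := exists_localSection_of_surjective_mfderiv hW hf haW (by
    rw [hd.mfderiv]
    intro v
    obtain ⟨a, k, hk, hv⟩ := hsum v
    -- `du (dι a)` and `db (dι a, 0)` are two lifts of `dι a` along `ds`, so that `l` lies in the
    -- kernel of `ds`, which is the image of `db (0, ·)`.
    set l := du (dι a) + k - db (dι a, 0)
    have hl : db (0, dq l) = l := by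
      have : ds l = 0 := by simp [l, e1, e2, hk]
      rw [← this]; exact e4 l
    refine ⟨(a, dq l), ?_⟩
    change dt (db (dι a, dq l)) = v
    have : ((dι a, dq l) : _ × F) = (dι a, 0) + (0, dq l) := by simp
    rw [this, map_add, hl]
    simp only [l, add_sub_cancel, map_add, e3]
    exact hv)
  refine ⟨U, hU, ?_, fun y => b (((s y).1, (s y).2)), ?_, ?_⟩
  · have : (E.tgt ∘ b ∘ fun z : T × F => ((z.1 : M), z.2)) (t, w) = (t : M) := by
      change E.tgt (b ((t : M), w)) = t
      rw [← hpt, hbp, htp]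
    rwa [this] at htU
  · exact (hb.comp hj.contMDiffOn fun z hz => hz).comp hsm fun y hy => (hsU y hy).1
  · intro y hy
    refine ⟨(hsU y hy).2, ?_⟩
    rw [show E.src (b _) = _ from hsb _ (hsU y hy).1]
    exact (s y).1.2

/-- Near every point `x` of `M`, every point is the target of an arrow with source in `T`, which
depends smoothly on it: an arrow to `x` from a point `t` of `T` in its leaf extends to a local
section of the target map, and is composed with a section near `t`. -/
theorem IsCompleteTransversal.exists_section
    (hT : E.IsCompleteTransversal T) (x : M) :
    ∃ U : Set M, IsOpen U ∧ x ∈ U ∧ ∃ σ : M → E.Arr, ContMDiffOn M.model E.Arr.model ∞ σ U ∧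
      ∀ y ∈ U, E.tgt (σ y) = y ∧ E.src (σ y) ∈ T := by
  obtain ⟨t, ⟨e, he, rfl⟩, ht⟩ := hT.2 x
  have hex : E.src e = x := connectedComponentIn_subset (E.src ⁻¹' {x}) (E.one x) he
  obtain ⟨V, hV, htV, σ, hσ, hσV⟩ := hT.exists_section_near ⟨_, ht⟩
  obtain ⟨U, hU, hxU, l, hl, hlx, hlU⟩ := exists_localSection E.isLie.tgt_submersion (E.inv e)
  rw [show E.toGroupoidOn.tgt (E.inv e) = x from (E.tgt_inv e).trans hex] at hxU hlx
  have hs : ContMDiffOn M.model M.model ∞ (fun y => E.src (l y)) U :=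
    E.isLie.src_submersion.contMDiff.comp_contMDiffOn hl
  refine ⟨U ∩ (fun y => E.src (l y)) ⁻¹' V, hs.continuousOn.isOpen_inter_preimage hU hV, ⟨hxU, ?_⟩,
    fun y => E.mul (l y) (σ (E.src (l y))), ?_, ?_⟩
  · rw [Set.mem_preimage, hlx, E.src_inv]; exact htV
  · refine E.isLie.mul_smooth.comp (t := {z | E.src z.1 = E.tgt z.2})
      (ContMDiffOn.prodMk (hl.mono Set.inter_subset_left) (hσ.comp (hs.mono Set.inter_subset_left) fun y hy => hy.2)) fun y hy => ?_
    exact (hσV _ hy.2).1.symm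
  · intro y hy
    have c := (hσV _ hy.2).1.symm
    rw [E.tgt_mul _ _ c, E.src_mul _ _ c]
    exact ⟨hlU y hy.1, (hσV _ hy.2).2⟩

end LieGroupoid

/-! ### Algebra in a groupoid -/

namespace LieGroupoid

variable {M : Mfd.{u}} {G : LieGroupoid M}

theorem one_mul' {x : M} {g : G.Arr} (h : G.tgt g = x) : G.mul (G.one x) g = g := by
  rw [← h, G.one_mul]

theorem mul_one' {x : M} {g : G.Arr} (h : G.src g = x) : G.mul g (G.one x) = g := by
  rw [← h, G.mul_one]

theorem inv_mul_cancel_left {g h : G.Arr} (c : G.src g = G.tgt h) :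
    G.mul (G.inv g) (G.mul g h) = h := by
  rw [← G.mul_assoc _ _ _ (G.src_inv g) c, G.inv_mul, one_mul' c.symm]

theorem mul_inv_cancel_left {g h : G.Arr} (c : G.tgt g = G.tgt h) :
    G.mul g (G.mul (G.inv g) h) = h := by
  rw [← G.mul_assoc _ _ _ (G.tgt_inv g).symm ((G.src_inv g).trans c), G.mul_inv, one_mul' c.symm]

theorem inv_inv (g : G.Arr) : G.inv (G.inv g) = g :=
  (eq_inv _ _ (G.tgt_inv g).symm (by rw [G.mul_inv, G.src_inv])).symm

theorem inv_one (x : M) : G.inv (G.one x) = G.one x :=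
  (eq_inv _ _ (by rw [G.src_one, G.tgt_one]) (by rw [one_mul' (G.tgt_one x), G.src_one])).symm

theorem mul_left_cancel {f g h : G.Arr} (c : G.src f = G.tgt g) (d : G.src f = G.tgt h)
    (e : G.mul f g = G.mul f h) : g = h := by
  rw [← inv_mul_cancel_left c, e, inv_mul_cancel_left d]

theorem eq_one_of_mul_self {g : G.Arr} {x : M} (hs : G.src g = x) (ht : G.tgt g = x)
    (h : G.mul g g = g) : g = G.one x := by
  refine (mul_left_cancel (f := g) ?_ ?_ ?_).symm
  · rw [hs, G.tgt_one]
  · rw [hs, ht]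
  · rw [h, mul_one' hs]

end LieGroupoid

section Smooth

variable {M : Mfd.{u}} {G : LieGroupoid M} {E' H' Z : Type*} [NormedAddCommGroup E']
  [NormedSpace ℝ E'] [TopologicalSpace H'] {I : ModelWithCorners ℝ E' H'} [TopologicalSpace Z]
  [ChartedSpace H' Z] {f g : Z → G.Arr} {s : Set Z}

theorem LieGroupoid.contMDiffOn_mul (hf : ContMDiffOn I G.Arr.model ∞ f s)
    (hg : ContMDiffOn I G.Arr.model ∞ g s) (c : ∀ z ∈ s, G.src (f z) = G.tgt (g z)) :
    ContMDiffOn I G.Arr.model ∞ (fun z => G.mul (f z) (g z)) s :=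
  G.isLie.mul_smooth.comp (hf.prodMk hg) c

theorem LieGroupoid.contMDiffOn_inv (hf : ContMDiffOn I G.Arr.model ∞ f s) :
    ContMDiffOn I G.Arr.model ∞ (fun z => G.inv (f z)) s :=
  G.isLie.inv_smooth.comp_contMDiffOn hf

theorem LieGroupoid.contMDiff_src : ContMDiff G.Arr.model M.model ∞ G.src :=
  G.isLie.src_submersion.contMDiff

theorem LieGroupoid.contMDiff_tgt : ContMDiff G.Arr.model M.model ∞ G.tgt :=
  G.isLie.tgt_submersion.contMDiff

end Smooth

namespace IsHom

variable {M : Mfd.{u}} {G H : LieGroupoid M} {f : G.Arr → H.Arr}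

theorem map_one (hf : IsHom G H f) (x : M) : f (G.one x) = H.one x := by
  refine LieGroupoid.eq_one_of_mul_self ((hf.map_src _).trans (G.src_one x))
    ((hf.map_tgt _).trans (G.tgt_one x)) ?_
  rw [← hf.map_mul _ _ ((G.src_one x).trans (G.tgt_one x).symm),
    LieGroupoid.one_mul' (G.tgt_one x)]

theorem map_inv (hf : IsHom G H f) (g : G.Arr) : f (G.inv g) = H.inv (f g) := by
  refine LieGroupoid.eq_inv _ _ ?_ ?_
  · rw [hf.map_src, hf.map_tgt, G.src_inv]
  · rw [← hf.map_mul _ _ (G.src_inv g), G.inv_mul, hf.map_one, hf.map_src]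

end IsHom

/-! ### Isomorphisms between restricted extensions -/

namespace RestrIso

variable {M : Mfd.{u}} {K : GroupBundle M} {E : LieGroupoid M} {X Y : Extension K E} {T : Set M}

theorem restr_mul {G : LieGroupoid M} {g h : G.restrSet T} (c : G.src g = G.tgt h) :
    ((G.restr T).mul g h : G.Arr) = G.mul g h := by
  simp [LieGroupoid.restr, c]

/-- The inverse isomorphism. -/
def symm (φ : RestrIso X Y T) : RestrIso Y X T where
  toEquiv := φ.toEquiv.symm
  smooth := φ.smooth_symm
  smooth_symm := φ.smooth
  map_src g := by
    obtain ⟨g, rfl⟩ := φ.toEquiv.surjective g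
    rw [Equiv.symm_apply_apply, φ.map_src]
  map_tgt g := by
    obtain ⟨g, rfl⟩ := φ.toEquiv.surjective g
    rw [Equiv.symm_apply_apply, φ.map_tgt]
  map_mul g h c := by
    obtain ⟨g, rfl⟩ := φ.toEquiv.surjective g
    obtain ⟨h, rfl⟩ := φ.toEquiv.surjective h
    rw [φ.map_src, φ.map_tgt] at c
    rw [← φ.map_mul g h c]
    simp only [Equiv.symm_apply_apply]
  comp_j k := by rw [← φ.comp_j, Equiv.symm_apply_apply]
  π_comp g := by
    obtain ⟨g, rfl⟩ := φ.toEquiv.surjective g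
    rw [Equiv.symm_apply_apply, φ.π_comp]

open Classical in
/-- An extension of `φ : X_T → Y_T` to all arrows of `X`; its values outside `X_T` are junk. -/
noncomputable def ext (φ : RestrIso X Y T) (g : X.G.Arr) : Y.G.Arr :=
  if c : g ∈ X.G.restrSet T then φ.toEquiv ⟨g, c⟩ else Y.G.one (X.G.src g)

variable (φ : RestrIso X Y T) {g h : X.G.Arr}

theorem ext_coe (g : X.G.restrSet T) : φ.ext g = φ.toEquiv g := by
  simp [ext]

theorem smooth_ext : ContMDiffOn X.G.Arr.model Y.G.Arr.model ∞ φ.ext (X.G.restrSet T) :=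
  φ.smooth _ φ.ext_coe

theorem src_ext (hs : X.G.src g ∈ T) (ht : X.G.tgt g ∈ T) : Y.G.src (φ.ext g) = X.G.src g := by
  rw [φ.ext_coe ⟨g, hs, ht⟩]
  exact congrArg Subtype.val (φ.map_src ⟨g, hs, ht⟩)

theorem tgt_ext (hs : X.G.src g ∈ T) (ht : X.G.tgt g ∈ T) : Y.G.tgt (φ.ext g) = X.G.tgt g := by
  rw [φ.ext_coe ⟨g, hs, ht⟩]
  exact congrArg Subtype.val (φ.map_tgt ⟨g, hs, ht⟩)

theorem ext_mul (hg : X.G.tgt g ∈ T) (c : X.G.src g = X.G.tgt h) (hm : X.G.src g ∈ T)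
    (hh : X.G.src h ∈ T) : φ.ext (X.G.mul g h) = Y.G.mul (φ.ext g) (φ.ext h) := by
  have hg' : g ∈ X.G.restrSet T := ⟨hm, hg⟩
  have hh' : h ∈ X.G.restrSet T := ⟨hh, c ▸ hm⟩
  have h1 := φ.map_mul ⟨g, hg'⟩ ⟨h, hh'⟩ (Subtype.ext c)
  have h2 := congrArg Subtype.val h1
  rw [restr_mul, ← φ.ext_coe, ← φ.ext_coe, ← φ.ext_coe, restr_mul (by exact c)] at h2
  · exact h2
  · rw [← φ.ext_coe, ← φ.ext_coe, φ.src_ext hm hg, φ.tgt_ext hh (c ▸ hm)]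
    exact c

theorem ext_j {k : K.Arr} (hk : K.src k ∈ T) : φ.ext (X.j k) = Y.j k := by
  have h : k ∈ K.restrSet T := ⟨hk, by rw [K.tgt_eq]; exact hk⟩
  have := congrArg Subtype.val (φ.comp_j ⟨k, h⟩)
  rw [← φ.ext_coe] at this
  exact this

theorem ext_one {x : M} (hx : x ∈ T) : φ.ext (X.G.one x) = Y.G.one x := by
  rw [← X.j_one, φ.ext_j (by rwa [K.toLieGroupoid.src_one]), Y.j_one]

theorem π_ext (hs : X.G.src g ∈ T) (ht : X.G.tgt g ∈ T) : Y.π (φ.ext g) = X.π g := by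
  rw [φ.ext_coe ⟨g, hs, ht⟩]
  exact congrArg Subtype.val (φ.π_comp ⟨g, hs, ht⟩)

theorem symm_ext_ext (hs : X.G.src g ∈ T) (ht : X.G.tgt g ∈ T) : φ.symm.ext (φ.ext g) = g := by
  rw [φ.ext_coe ⟨g, hs, ht⟩, φ.symm.ext_coe]
  simp [symm]

end RestrIso

/-! ### Transport of arrows along frames -/

section Transport

variable {M : Mfd.{u}} {K : GroupBundle M} {E : LieGroupoid M} {X Y : Extension K E} {T : Set M}

/-- A frame at `x`: arrows `a` of `X` and `b` of `Y` with target `x` and the same source in `T`,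
which lie over the same arrow of `E`. -/
structure IsFrame (X Y : Extension K E) (T : Set M) (x : M) (z : X.G.Arr × Y.G.Arr) : Prop where
  π_eq : X.π z.1 = Y.π z.2
  tgt_fst : X.G.tgt z.1 = x
  src_mem : X.G.src z.1 ∈ T

namespace IsFrame

variable {x : M} {z : X.G.Arr × Y.G.Arr}

theorem src_snd (hz : IsFrame X Y T x z) : Y.G.src z.2 = X.G.src z.1 := by
  rw [← Y.isExtension.π_hom.map_src, ← hz.π_eq, X.isExtension.π_hom.map_src]

theorem tgt_snd (hz : IsFrame X Y T x z) : Y.G.tgt z.2 = x := by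
  rw [← hz.tgt_fst, ← Y.isExtension.π_hom.map_tgt, ← hz.π_eq, X.isExtension.π_hom.map_tgt]

theorem swap (hz : IsFrame X Y T x z) : IsFrame Y X T x z.swap :=
  ⟨hz.π_eq.symm, hz.tgt_snd, hz.src_snd ▸ hz.src_mem⟩

end IsFrame

theorem IsFrame.one {t : M} (ht : t ∈ T) : IsFrame X Y T t (X.G.one t, Y.G.one t) :=
  ⟨by rw [X.isExtension.π_hom.map_one, Y.isExtension.π_hom.map_one], X.G.tgt_one t,
    by rwa [X.G.src_one]⟩

/-- The arrow `b₂ φ(a₂⁻¹ h a₁) b₁⁻¹` of `Y` obtained from an arrow `h` of `X` by means of frames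
`(a₂, b₂)` at its target and `(a₁, b₁)` at its source. -/
noncomputable def RestrIso.transport (φ : RestrIso X Y T) (z₂ : X.G.Arr × Y.G.Arr) (h : X.G.Arr)
    (z₁ : X.G.Arr × Y.G.Arr) : Y.G.Arr :=
  Y.G.mul (Y.G.mul z₂.2 (φ.ext (X.G.mul (X.G.mul (X.G.inv z₂.1) h) z₁.1))) (Y.G.inv z₁.2)

namespace RestrIso

variable (φ : RestrIso X Y T) {h h' : X.G.Arr} {z₁ z₂ z₃ : X.G.Arr × Y.G.Arr}

theorem composable_transport (h₂ : IsFrame X Y T (X.G.tgt h) z₂) (h₁ : IsFrame X Y T (X.G.src h) z₁) :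
    X.G.src (X.G.inv z₂.1) = X.G.tgt h ∧ X.G.src (X.G.mul (X.G.inv z₂.1) h) = X.G.tgt z₁.1 ∧
    X.G.src (X.G.mul (X.G.mul (X.G.inv z₂.1) h) z₁.1) = X.G.src z₁.1 ∧
    X.G.tgt (X.G.mul (X.G.mul (X.G.inv z₂.1) h) z₁.1) = X.G.src z₂.1 := by
  have c1 : X.G.src (X.G.inv z₂.1) = X.G.tgt h := by rw [X.G.src_inv, h₂.tgt_fst]
  have c2 : X.G.src (X.G.mul (X.G.inv z₂.1) h) = X.G.tgt z₁.1 := by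
    rw [X.G.src_mul _ _ c1, h₁.tgt_fst]
  refine ⟨c1, c2, X.G.src_mul _ _ c2, ?_⟩
  rw [X.G.tgt_mul _ _ c2, X.G.tgt_mul _ _ c1, X.G.tgt_inv]

theorem exists_transport_eq (h₂ : IsFrame X Y T (X.G.tgt h) z₂) (h₁ : IsFrame X Y T (X.G.src h) z₁) :
    ∃ a, φ.ext (X.G.mul (X.G.mul (X.G.inv z₂.1) h) z₁.1) = a ∧ Y.G.src a = X.G.src z₁.1 ∧
      Y.G.tgt a = X.G.src z₂.1 ∧
      φ.transport z₂ h z₁ = Y.G.mul z₂.2 (Y.G.mul a (Y.G.inv z₁.2)) := by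
  obtain ⟨c1, c2, c3, c4⟩ := composable_transport h₂ h₁
  have hs := h₁.src_mem
  have ht := h₂.src_mem
  rw [← c3] at hs
  rw [← c4] at ht
  have d1 := φ.src_ext hs ht
  have d2 := φ.tgt_ext hs ht
  refine ⟨_, rfl, d1.trans c3, d2.trans c4, ?_⟩
  rw [transport, Y.G.mul_assoc]
  · rw [h₂.src_snd, d2, c4]
  · rw [d1, c3, Y.G.tgt_inv, h₁.src_snd]

theorem src_transport (h₂ : IsFrame X Y T (X.G.tgt h) z₂) (h₁ : IsFrame X Y T (X.G.src h) z₁) :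
    Y.G.src (φ.transport z₂ h z₁) = X.G.src h := by
  obtain ⟨a, -, ha1, ha2, e⟩ := φ.exists_transport_eq h₂ h₁
  have := h₁.src_snd
  have := h₂.src_snd
  have := h₁.tgt_snd
  simp (maxDischargeDepth := 8) [LieGroupoid.src_mul, LieGroupoid.tgt_mul, LieGroupoid.src_inv,
    LieGroupoid.tgt_inv, *]

theorem tgt_transport (h₂ : IsFrame X Y T (X.G.tgt h) z₂) (h₁ : IsFrame X Y T (X.G.src h) z₁) :
    Y.G.tgt (φ.transport z₂ h z₁) = X.G.tgt h := by
  obtain ⟨a, -, ha1, ha2, e⟩ := φ.exists_transport_eq h₂ h₁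
  have := h₁.src_snd
  have := h₂.src_snd
  have := h₂.tgt_snd
  simp (maxDischargeDepth := 8) [LieGroupoid.tgt_mul, LieGroupoid.tgt_inv, *]

theorem transport_mul (c : X.G.src h' = X.G.tgt h) (h₃ : IsFrame X Y T (X.G.tgt h') z₃)
    (h₂ : IsFrame X Y T (X.G.tgt h) z₂) (h₁ : IsFrame X Y T (X.G.src h) z₁) :
    φ.transport z₃ (X.G.mul h' h) z₁ =
      Y.G.mul (φ.transport z₃ h' z₂) (φ.transport z₂ h z₁) := by
  have h₂' := h₂
  rw [← c] at h₂'
  obtain ⟨a, ea, ha1, ha2, e⟩ := φ.exists_transport_eq h₂ h₁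
  obtain ⟨b, eb, hb1, hb2, e'⟩ := φ.exists_transport_eq h₃ h₂'
  obtain ⟨d, ed, hd1, hd2, e''⟩ := φ.exists_transport_eq (h := X.G.mul h' h) (z₁ := z₁) (z₂ := z₃)
    (by rwa [X.G.tgt_mul _ _ c]) (by rwa [X.G.src_mul _ _ c])
  have key : d = Y.G.mul b a := by
    obtain ⟨c1, c2, c3, c4⟩ := composable_transport h₂ h₁
    obtain ⟨b1, b2, b3, b4⟩ := composable_transport h₃ h₂'
    rw [← ed, ← eb, ← ea, ← φ.ext_mul]
    · congr 1
      have := h₁.tgt_fst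
      have := h₂.tgt_fst
      have := h₃.tgt_fst
      simp (maxDischargeDepth := 8) [LieGroupoid.src_mul, LieGroupoid.tgt_mul,
        LieGroupoid.tgt_inv, LieGroupoid.mul_assoc, LieGroupoid.mul_inv_cancel_left, *]
    · rw [b4]; exact h₃.src_mem
    · rw [b3, c4]
    · rw [b3]; exact h₂.src_mem
    · rw [c3]; exact h₁.src_mem
  have := h₁.src_snd
  have := h₂.src_snd
  have := h₃.src_snd
  have := h₁.tgt_snd
  have := h₂.tgt_snd
  simp (maxDischargeDepth := 8) [LieGroupoid.src_mul, LieGroupoid.tgt_mul, LieGroupoid.src_inv,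
    LieGroupoid.tgt_inv, LieGroupoid.mul_assoc, LieGroupoid.inv_mul_cancel_left, *]

theorem transport_one {x : M} {z : X.G.Arr × Y.G.Arr} (hz : IsFrame X Y T x z) :
    φ.transport z (X.G.one x) z = Y.G.one x := by
  have h1 : X.G.mul (X.G.mul (X.G.inv z.1) (X.G.one x)) z.1 = X.G.one (X.G.src z.1) := by
    rw [LieGroupoid.mul_one' (by rw [X.G.src_inv, hz.tgt_fst]), X.G.inv_mul]
  rw [transport, h1, φ.ext_one hz.src_mem, LieGroupoid.mul_one' hz.src_snd, Y.G.mul_inv, hz.tgt_snd]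

theorem transport_of_one (h₂ : X.G.tgt h ∈ T) (h₁ : X.G.src h ∈ T) :
    φ.transport (X.G.one (X.G.tgt h), Y.G.one (X.G.tgt h)) h
      (X.G.one (X.G.src h), Y.G.one (X.G.src h)) = φ.ext h := by
  have := φ.src_ext h₁ h₂
  have := φ.tgt_ext h₁ h₂
  simp (maxDischargeDepth := 8) [transport, LieGroupoid.inv_one, LieGroupoid.one_mul',
    LieGroupoid.mul_one', *]

theorem π_transport (h₂ : IsFrame X Y T (X.G.tgt h) z₂) (h₁ : IsFrame X Y T (X.G.src h) z₁) :
    Y.π (φ.transport z₂ h z₁) = X.π h := by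
  obtain ⟨a, ea, ha1, ha2, e⟩ := φ.exists_transport_eq h₂ h₁
  obtain ⟨c1, c2, c3, c4⟩ := composable_transport h₂ h₁
  have hX := X.isExtension.π_hom
  have hY := Y.isExtension.π_hom
  have s1 := h₁.src_snd
  have s2 := h₂.src_snd
  have t1 := h₁.tgt_fst
  have t2 := h₂.tgt_fst
  have ha : Y.π a = E.mul (E.mul (E.inv (X.π z₂.1)) (X.π h)) (X.π z₁.1) := by
    rw [← ea, φ.π_ext, hX.map_mul _ _ c2, hX.map_mul _ _ c1, hX.map_inv]
    · rw [c3]; exact h₁.src_mem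
    · rw [c4]; exact h₂.src_mem
  rw [e, hY.map_mul, hY.map_mul, hY.map_inv, ha, ← h₁.π_eq, ← h₂.π_eq]
  · have p1 := hX.map_src z₁.1
    have p2 := hX.map_src z₂.1
    have p3 := hX.map_src h
    have p4 := hX.map_tgt z₁.1
    have p5 := hX.map_tgt z₂.1
    have p6 := hX.map_tgt h
    have q1 : E.mul (X.π z₁.1) (E.inv (X.π z₁.1)) = E.one (X.G.src h) := by
      rw [E.mul_inv, p4, t1]
    have q2 : E.mul (X.π h) (E.one (X.G.src h)) = X.π h := LieGroupoid.mul_one' p3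
    simp (maxDischargeDepth := 8) [LieGroupoid.src_mul, LieGroupoid.tgt_mul, LieGroupoid.src_inv,
      LieGroupoid.tgt_inv, LieGroupoid.mul_assoc, LieGroupoid.mul_inv_cancel_left, *]
  · rw [Y.G.tgt_inv, ha1, s1]
  · rw [Y.G.tgt_mul _ _ (by rw [Y.G.tgt_inv, ha1, s1]), ha2, s2]

theorem symm_transport_transport (h₂ : IsFrame X Y T (X.G.tgt h) z₂)
    (h₁ : IsFrame X Y T (X.G.src h) z₁) :
    φ.symm.transport z₂.swap (φ.transport z₂ h z₁) z₁.swap = h := by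
  obtain ⟨a, ea, ha1, ha2, e⟩ := φ.exists_transport_eq h₂ h₁
  obtain ⟨c1, c2, c3, c4⟩ := composable_transport h₂ h₁
  have s1 := h₁.src_snd
  have s2 := h₂.src_snd
  have t1 := h₁.tgt_fst
  have t2 := h₂.tgt_fst
  have t1' := h₁.tgt_snd
  have t2' := h₂.tgt_snd
  have h3 : Y.G.mul (Y.G.mul (Y.G.inv z₂.2) (φ.transport z₂ h z₁)) z₁.2 = a := by
    simp (maxDischargeDepth := 8) [LieGroupoid.tgt_mul, LieGroupoid.src_inv, LieGroupoid.tgt_inv,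
      LieGroupoid.mul_assoc, LieGroupoid.inv_mul_cancel_left, LieGroupoid.inv_mul,
      LieGroupoid.mul_one', *]
  rw [transport, Prod.snd_swap, Prod.fst_swap, Prod.fst_swap, Prod.snd_swap, h3, ← ea,
    φ.symm_ext_ext]
  · simp (maxDischargeDepth := 8) [LieGroupoid.tgt_mul, LieGroupoid.tgt_inv,
      LieGroupoid.mul_assoc, LieGroupoid.mul_inv_cancel_left, LieGroupoid.mul_inv,
      LieGroupoid.mul_one', *]
  · rw [c3]; exact h₁.src_mem
  · rw [c4]; exact h₂.src_mem

theorem smooth_transport {U₁ U₂ : Set M} {f₁ f₂ : M → X.G.Arr × Y.G.Arr}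
    (s₁ : ContMDiffOn M.model (X.G.Arr.model.prod Y.G.Arr.model) ∞ f₁ U₁)
    (s₂ : ContMDiffOn M.model (X.G.Arr.model.prod Y.G.Arr.model) ∞ f₂ U₂)
    (h₁ : ∀ x ∈ U₁, IsFrame X Y T x (f₁ x)) (h₂ : ∀ x ∈ U₂, IsFrame X Y T x (f₂ x)) :
    ContMDiffOn X.G.Arr.model Y.G.Arr.model ∞
      (fun h => φ.transport (f₂ (X.G.tgt h)) h (f₁ (X.G.src h)))
      {h | X.G.src h ∈ U₁ ∧ X.G.tgt h ∈ U₂} := by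
  have r₁ := s₁.comp (s := {h | X.G.src h ∈ U₁ ∧ X.G.tgt h ∈ U₂})
    X.G.contMDiff_src.contMDiffOn fun h hh => hh.1
  have r₂ := s₂.comp (s := {h | X.G.src h ∈ U₁ ∧ X.G.tgt h ∈ U₂})
    X.G.contMDiff_tgt.contMDiffOn fun h hh => hh.2
  have key := fun h (hh : h ∈ {h | X.G.src h ∈ U₁ ∧ X.G.tgt h ∈ U₂}) =>
    composable_transport (h₂ _ hh.2) (h₁ _ hh.1)
  have k1 := LieGroupoid.contMDiffOn_mul
    (LieGroupoid.contMDiffOn_inv (contMDiff_fst.comp_contMDiffOn r₂)) contMDiffOn_id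
    fun h hh => (key h hh).1
  have k2 := LieGroupoid.contMDiffOn_mul k1 (contMDiff_fst.comp_contMDiffOn r₁)
    fun h hh => (key h hh).2.1
  have hm : ∀ h ∈ {h | X.G.src h ∈ U₁ ∧ X.G.tgt h ∈ U₂},
      X.G.mul (X.G.mul (X.G.inv (f₂ (X.G.tgt h)).1) h) (f₁ (X.G.src h)).1 ∈ X.G.restrSet T := by
    intro h hh
    refine ⟨?_, ?_⟩
    · rw [(key h hh).2.2.1]; exact (h₁ _ hh.1).src_mem
    · rw [(key h hh).2.2.2]; exact (h₂ _ hh.2).src_mem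
  have k3 := φ.smooth_ext.comp k2 hm
  have k4 := LieGroupoid.contMDiffOn_mul (contMDiff_snd.comp_contMDiffOn r₂) k3 fun h hh => by
    refine Eq.trans ?_ (φ.tgt_ext (hm h hh).1 (hm h hh).2).symm
    exact (h₂ _ hh.2).src_snd.trans (key h hh).2.2.2.symm
  refine LieGroupoid.contMDiffOn_mul k4
    (LieGroupoid.contMDiffOn_inv (contMDiff_snd.comp_contMDiffOn r₁)) fun h hh => ?_
  have e := φ.src_ext (hm h hh).1 (hm h hh).2
  rw [(key h hh).2.2.1] at e
  have e' := φ.tgt_ext (hm h hh).1 (hm h hh).2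
  rw [(key h hh).2.2.2] at e'
  refine (LieGroupoid.src_mul _ _ _ ?_).trans (e.trans ?_)
  · exact (h₂ _ hh.2).src_snd.trans e'.symm
  · rw [LieGroupoid.tgt_inv]; exact (h₁ _ hh.1).src_snd.symm

end RestrIso

/-- Around every point there is a smooth family of frames, obtained by lifting a smooth family of
arrows of `E` along the two projections. -/
theorem exists_smooth_frames (X Y : Extension K E) (hT : E.IsCompleteTransversal T) :
    ∃ (U : M → Set M) (z : M → M → X.G.Arr × Y.G.Arr), (∀ x, IsOpen (U x)) ∧ (∀ x, x ∈ U x) ∧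
      (∀ x, ContMDiffOn M.model (X.G.Arr.model.prod Y.G.Arr.model) ∞ (z x) (U x)) ∧
      ∀ x, ∀ y ∈ U x, IsFrame X Y T y (z x y) := by
  have key : ∀ x : M, ∃ (U : Set M) (z : M → X.G.Arr × Y.G.Arr), IsOpen U ∧ x ∈ U ∧
      ContMDiffOn M.model (X.G.Arr.model.prod Y.G.Arr.model) ∞ z U ∧
      ∀ y ∈ U, IsFrame X Y T y (z y) := by
    intro x
    obtain ⟨U, hU, hxU, σ, hσ, hσU⟩ := hT.exists_section x
    obtain ⟨g, hg⟩ := X.isExtension.π_surjective (σ x)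
    obtain ⟨h, hh⟩ := Y.isExtension.π_surjective (σ x)
    obtain ⟨V, hV, hgV, r, hr, -, hrV⟩ := exists_localSection X.isExtension.π_submersion g
    obtain ⟨W, hW, hhW, l, hl, -, hlW⟩ := exists_localSection Y.isExtension.π_submersion h
    refine ⟨U ∩ σ ⁻¹' (V ∩ W), fun y => (r (σ y), l (σ y)),
      hσ.continuousOn.isOpen_inter_preimage hU (hV.inter hW), ⟨hxU, hg ▸ hgV, hh ▸ hhW⟩,
      ContMDiffOn.prodMk (hr.comp (hσ.mono Set.inter_subset_left) fun y hy => hy.2.1)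
        (hl.comp (hσ.mono Set.inter_subset_left) fun y hy => hy.2.2), fun y hy => ?_⟩
    have hX := X.isExtension.π_hom
    refine ⟨(hrV _ hy.2.1).trans (hlW _ hy.2.2).symm, ?_, ?_⟩
    · rw [← hX.map_tgt, hrV _ hy.2.1]; exact (hσU y hy.1).1
    · rw [← hX.map_src, hrV _ hy.2.1]; exact (hσU y hy.1).2
  choose U z h1 h2 h3 h4 using key
  exact ⟨U, z, h1, h2, h3, h4⟩

end Transport

/-! ### Isomorphisms which are smooth up to sections of `K` -/

section TwistedIso

variable {M : Mfd.{u}} {K : GroupBundle M} {E : LieGroupoid M} {X Y : Extension K E} {T : Set M}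

theorem Extension.j_injective (X : Extension K E) : Function.Injective X.j :=
  X.isExtension.j_embedding.isEmbedding.injective

theorem Extension.π_j (X : Extension K E) (k : K.Arr) :
    X.π (X.j k) = E.one (K.src k) := by
  obtain ⟨x, hx⟩ := (X.isExtension.exact (X.j k)).1 ⟨k, rfl⟩
  have h := congrArg E.src hx
  rw [X.isExtension.π_hom.map_src, X.src_j, E.src_one] at h
  rw [hx, h]

/-- An isomorphism of groupoids from `X` to `Y` over `M` and `E`, not necessarily continuous, and
over the sets of an open cover `U` of `M` sections `δ i` of `K`, not necessarily continuous, such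
that the conjugates of the isomorphism by the `δ i` are smooth. -/
structure TwistedIso (X Y : Extension K E) (ι : Type*) where
  toFun : X.G.Arr → Y.G.Arr
  invFun : Y.G.Arr → X.G.Arr
  left_inv : ∀ h, invFun (toFun h) = h
  right_inv : ∀ g, toFun (invFun g) = g
  map_src : ∀ h, Y.G.src (toFun h) = X.G.src h
  map_tgt : ∀ h, Y.G.tgt (toFun h) = X.G.tgt h
  map_mul : ∀ h h', X.G.src h = X.G.tgt h' → toFun (X.G.mul h h') = Y.G.mul (toFun h) (toFun h')
  π_comp : ∀ h, Y.π (toFun h) = X.π h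
  U : ι → Set M
  isOpen_U : ∀ i, IsOpen (U i)
  cover : ∀ x, ∃ i, x ∈ U i
  δ : ι → M → K.Arr
  src_δ : ∀ i x, K.src (δ i x) = x
  smooth : ∀ i j, ContMDiffOn X.G.Arr.model Y.G.Arr.model ∞
    (fun h => Y.G.mul (Y.G.mul (Y.G.inv (Y.j (δ j (X.G.tgt h)))) (toFun h)) (Y.j (δ i (X.G.src h))))
    {h | X.G.src h ∈ U i ∧ X.G.tgt h ∈ U j}
  smooth_inv : ∀ i j, ContMDiffOn Y.G.Arr.model X.G.Arr.model ∞
    (fun g => invFun (Y.G.mul (Y.G.mul (Y.j (δ j (Y.G.tgt g))) g)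
      (Y.G.inv (Y.j (δ i (Y.G.src g))))))
    {g | Y.G.src g ∈ U i ∧ Y.G.tgt g ∈ U j}

/-- An isomorphism over a complete transversal extends to an isomorphism which is smooth up to
sections of `K`; over the transversal the two differ by conjugation with a section `α` of `K`. -/
theorem RestrIso.exists_twistedIso (φ : RestrIso X Y T) (hT : E.IsCompleteTransversal T) :
    ∃ (D : TwistedIso X Y M) (α : M → K.Arr), (∀ x, K.src (α x) = x) ∧
      (∀ i, ContMDiffOn M.model K.Arr.model ∞ (fun x => K.mul (α x) (D.δ i x)) (T ∩ D.U i)) ∧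
      ∀ h ∈ X.G.restrSet T, Y.G.mul (Y.G.mul (Y.j (α (X.G.tgt h))) (D.toFun h))
        (Y.G.inv (Y.j (α (X.G.src h)))) = φ.ext h := by
  classical
  obtain ⟨U, z, hU, hxU, hz, hfr⟩ := exists_smooth_frames X Y hT
  have ho : ∀ x, IsFrame X Y T x (z x x) := fun x => hfr x x (hxU x)
  -- Transport along two frames over the same point differs by an element of `K`.
  have hK : ∀ x w w', IsFrame X Y T x w → IsFrame X Y T x w' →
      ∃ k, K.src k = x ∧ Y.j k = φ.transport w (X.G.one x) w' := by
    intro x w w' hw hw'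
    have e1 := X.G.src_one x
    have e2 := X.G.tgt_one x
    obtain ⟨k, hk⟩ := (Y.isExtension.exact (φ.transport w (X.G.one x) w')).2 ⟨x, by
      rw [φ.π_transport (by rwa [e2]) (by rwa [e1]), X.isExtension.π_hom.map_one]⟩
    refine ⟨k, ?_, hk⟩
    rw [← Y.src_j, hk, φ.src_transport (by rwa [e2]) (by rwa [e1]), e1]
  have hδ : ∀ i x, ∃ k, K.src k = x ∧
      (x ∈ U i → Y.j k = φ.transport (z x x) (X.G.one x) (z i x)) := by
    intro i x
    by_cases hx : x ∈ U i
    · obtain ⟨k, hk, e⟩ := hK x _ _ (ho x) (hfr i x hx)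
      exact ⟨k, hk, fun _ => e⟩
    · exact ⟨K.one x, K.toLieGroupoid.src_one x, fun h => absurd h hx⟩
  choose δ hδs hδj using hδ
  have hα : ∀ x, ∃ k, K.src k = x ∧ (x ∈ T → Y.j k =
      φ.transport (X.G.one x, Y.G.one x) (X.G.one x) (z x x)) := by
    intro x
    by_cases hx : x ∈ T
    · obtain ⟨k, hk, e⟩ := hK x _ _ (IsFrame.one hx) (ho x)
      exact ⟨k, hk, fun _ => e⟩
    · exact ⟨K.one x, K.toLieGroupoid.src_one x, fun h => absurd h hx⟩
  choose α hαs hαj using hα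
  -- The inverse of a transport along frames over one point.
  have hinv : ∀ x w w', IsFrame X Y T x w → IsFrame X Y T x w' →
      Y.G.inv (φ.transport w (X.G.one x) w') = φ.transport w' (X.G.one x) w := by
    intro x w w' hw hw'
    have e1 := X.G.src_one x
    have e2 := X.G.tgt_one x
    symm
    apply LieGroupoid.eq_inv
    · rw [φ.src_transport (by rwa [e2]) (by rwa [e1]), φ.tgt_transport (by rwa [e2]) (by rwa [e1]),
        e1, e2]
    · rw [← φ.transport_mul (e1.trans e2.symm) (by rwa [e2]) (by rwa [e2]) (by rwa [e1]),
        LieGroupoid.one_mul' e2, φ.transport_one hw',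
        φ.src_transport (by rwa [e2]) (by rwa [e1]), e1]
  -- Transport along any frames is a conjugate of transport along the chosen frames.
  have hconj : ∀ h w w', IsFrame X Y T (X.G.tgt h) w → IsFrame X Y T (X.G.src h) w' →
      φ.transport w h w' = Y.G.mul (Y.G.mul
        (φ.transport w (X.G.one (X.G.tgt h)) (z (X.G.tgt h) (X.G.tgt h)))
        (φ.transport (z (X.G.tgt h) (X.G.tgt h)) h (z (X.G.src h) (X.G.src h))))
        (φ.transport (z (X.G.src h) (X.G.src h)) (X.G.one (X.G.src h)) w') := by
    intro h w w' hw hw'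
    rw [← φ.transport_mul (X.G.src_one _) (by rwa [X.G.tgt_one]) (ho _) (ho _),
      LieGroupoid.one_mul' rfl, ← φ.transport_mul (X.G.tgt_one _).symm hw
      (by rw [X.G.tgt_one]; exact ho _) (by rwa [X.G.src_one]), LieGroupoid.mul_one' rfl]
  have hloc : ∀ i j h, X.G.src h ∈ U i → X.G.tgt h ∈ U j →
      Y.G.mul (Y.G.mul (Y.G.inv (Y.j (δ j (X.G.tgt h))))
        (φ.transport (z (X.G.tgt h) (X.G.tgt h)) h (z (X.G.src h) (X.G.src h))))
        (Y.j (δ i (X.G.src h))) = φ.transport (z j (X.G.tgt h)) h (z i (X.G.src h)) := by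
    intro i j h hi hj
    rw [hconj h _ _ (hfr j _ hj) (hfr i _ hi), hδj i _ hi, hδj j _ hj,
      hinv _ _ _ (ho _) (hfr j _ hj)]
  have hinvF : ∀ h, φ.symm.transport (z (X.G.tgt h) (X.G.tgt h)).swap
      (φ.transport (z (X.G.tgt h) (X.G.tgt h)) h (z (X.G.src h) (X.G.src h)))
      (z (X.G.src h) (X.G.src h)).swap = h :=
    fun h => φ.symm_transport_transport (ho _) (ho _)
  let D : TwistedIso X Y M :=
    { toFun := fun h => φ.transport (z (X.G.tgt h) (X.G.tgt h)) h (z (X.G.src h) (X.G.src h))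
      invFun := fun g => φ.symm.transport (z (Y.G.tgt g) (Y.G.tgt g)).swap g
        (z (Y.G.src g) (Y.G.src g)).swap
      left_inv := fun h => by
        simp only [φ.src_transport (ho _) (ho _), φ.tgt_transport (ho _) (ho _)]
        exact hinvF h
      right_inv := fun g => by
        simp only [φ.symm.src_transport (ho _).swap (ho _).swap,
          φ.symm.tgt_transport (ho _).swap (ho _).swap]
        exact φ.symm.symm_transport_transport (ho _).swap (ho _).swap
      map_src := fun h => φ.src_transport (ho _) (ho _)
      map_tgt := fun h => φ.tgt_transport (ho _) (ho _)
      map_mul := fun h h' c => by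
        rw [X.G.tgt_mul _ _ c, X.G.src_mul _ _ c, φ.transport_mul c (ho _) (ho _) (ho _), c]
      π_comp := fun h => φ.π_transport (ho _) (ho _)
      U := U
      isOpen_U := hU
      cover := fun x => ⟨x, hxU x⟩
      δ := δ
      src_δ := hδs
      smooth := fun i j => (φ.smooth_transport (hz i) (hz j) (hfr i) (hfr j)).congr
        fun h hh => hloc i j h hh.1 hh.2
      smooth_inv := fun i j => by
        have hs : ∀ k, ContMDiffOn M.model (Y.G.Arr.model.prod X.G.Arr.model) ∞
            (fun x => (z k x).swap) (U k) := fun k =>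
          (contMDiff_snd.comp_contMDiffOn (hz k)).prodMk (contMDiff_fst.comp_contMDiffOn (hz k))
        refine (φ.symm.smooth_transport (hs i) (hs j) (fun x hx => (hfr i x hx).swap)
          fun x hx => (hfr j x hx).swap).congr fun g hg => ?_
        have f₂ := (hfr j _ hg.2).swap
        have f₁ := (hfr i _ hg.1).swap
        have hsrc := φ.symm.src_transport f₂ f₁
        have htgt := φ.symm.tgt_transport f₂ f₁
        have hg' := φ.symm.symm_transport_transport f₂ f₁
        set h := φ.symm.transport (z j (Y.G.tgt g)).swap g (z i (Y.G.src g)).swap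
        have e := hloc i j h (hsrc ▸ hg.1) (htgt ▸ hg.2)
        have hF := hinvF h
        have s₁ := φ.src_transport (ho (X.G.tgt h)) (ho (X.G.src h))
        have s₂ := φ.tgt_transport (ho (X.G.tgt h)) (ho (X.G.src h))
        rw [hsrc, htgt] at e hF s₁ s₂
        rw [show φ.transport (z j (Y.G.tgt g)) h (z i (Y.G.src g)) = g from hg'] at e
        refine Eq.trans ?_ hF
        set F := φ.transport (z (Y.G.tgt g) (Y.G.tgt g)) h (z (Y.G.src g) (Y.G.src g))
        have key : Y.G.mul (Y.G.mul (Y.j (δ j (Y.G.tgt g))) g)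
            (Y.G.inv (Y.j (δ i (Y.G.src g)))) = F := by
          have a2 := Y.tgt_j (δ j (Y.G.tgt g))
          have a3 := Y.src_j (δ i (Y.G.src g))
          have a4 := Y.tgt_j (δ i (Y.G.src g))
          rw [hδs] at a2 a3 a4
          have e' := congrArg (fun f => Y.G.mul (Y.G.mul (Y.j (δ j (Y.G.tgt g))) f)
            (Y.G.inv (Y.j (δ i (Y.G.src g))))) e
          refine e'.symm.trans ?_
          simp (maxDischargeDepth := 8) [LieGroupoid.tgt_mul, LieGroupoid.src_inv,
            LieGroupoid.tgt_inv, LieGroupoid.mul_assoc, LieGroupoid.mul_inv_cancel_left,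
            LieGroupoid.mul_inv, LieGroupoid.mul_one', a2, a3, a4, s₁, s₂]
        rw [key, s₁, s₂] }
  refine ⟨D, α, hαs, ?_, ?_⟩
  · intro i
    refine contMDiffOn_of_embedding_comp Y.isExtension.j_embedding ?_
    have hone : ContMDiff M.model (X.G.Arr.model.prod Y.G.Arr.model) ∞
        (fun x => (X.G.one x, Y.G.one x)) := X.G.isLie.one_smooth.prodMk Y.G.isLie.one_smooth
    refine ((φ.smooth_transport (hz i) (U₂ := T) hone.contMDiffOn (hfr i)
      fun x hx => IsFrame.one hx).comp (X.G.isLie.one_smooth.contMDiffOn (s := T ∩ U i))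
      ?_).congr ?_
    · intro x hx
      exact ⟨(X.G.src_one x).symm ▸ hx.2, (X.G.tgt_one x).symm ▸ hx.1⟩
    · intro x hx
      have e1 := X.G.src_one x
      have e2 := X.G.tgt_one x
      simp only [Function.comp_apply]
      change Y.j (K.mul (α x) (δ i x)) =
        φ.transport (X.G.one (X.G.tgt (X.G.one x)), Y.G.one (X.G.tgt (X.G.one x))) _
          (z i (X.G.src (X.G.one x)))
      rw [Y.j_mul _ _ ((hαs x).trans (hδs i x).symm), hαj x hx.1, hδj i x hx.2, e1, e2,
        ← φ.transport_mul (e1.trans e2.symm) (by rw [e2]; exact IsFrame.one hx.1)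
          (by rw [e2]; exact ho x) (by rw [e1]; exact hfr i x hx.2), LieGroupoid.one_mul' e2]
  · intro h hh
    change Y.G.mul (Y.G.mul (Y.j (α (X.G.tgt h)))
      (φ.transport (z (X.G.tgt h) (X.G.tgt h)) h (z (X.G.src h) (X.G.src h)))) _ = _
    rw [hαj _ hh.1, hαj _ hh.2, hinv _ _ _ (IsFrame.one hh.1) (ho _),
      ← hconj h _ _ (IsFrame.one hh.2) (IsFrame.one hh.1), φ.transport_of_one hh.2 hh.1]

end TwistedIso

/-! ### The bitorsor of a twisted isomorphism -/

namespace TwistedIso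

variable {M : Mfd.{u}} {K : GroupBundle M} {E : LieGroupoid M} {X Y : Extension K E} {ι : Type*}
  (D : TwistedIso X Y ι)

theorem map_one (x : M) : D.toFun (X.G.one x) = Y.G.one x := by
  have e := (X.G.src_one x).trans (X.G.tgt_one x).symm
  refine LieGroupoid.eq_one_of_mul_self ((D.map_src _).trans (X.G.src_one x))
    ((D.map_tgt _).trans (X.G.tgt_one x)) ?_
  rw [← D.map_mul _ _ e, LieGroupoid.one_mul' (X.G.tgt_one x)]

theorem src_invFun (g : Y.G.Arr) : X.G.src (D.invFun g) = Y.G.src g := by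
  rw [← D.map_src, D.right_inv]

theorem tgt_invFun (g : Y.G.Arr) : X.G.tgt (D.invFun g) = Y.G.tgt g := by
  rw [← D.map_tgt, D.right_inv]

theorem exists_θ (k : K.Arr) : ∃ l, Y.j l = D.toFun (X.j k) := by
  obtain ⟨x, hx⟩ := (X.isExtension.exact (X.j k)).1 ⟨k, rfl⟩
  exact (Y.isExtension.exact _).2 ⟨x, by rw [D.π_comp, hx]⟩

theorem exists_θInv (l : K.Arr) : ∃ k, X.j k = D.invFun (Y.j l) := by
  obtain ⟨x, hx⟩ := (Y.isExtension.exact (Y.j l)).1 ⟨l, rfl⟩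
  exact (X.isExtension.exact _).2 ⟨x, by rw [← D.π_comp, D.right_inv, hx]⟩

/-- The automorphism of `K` induced by a twisted isomorphism. -/
noncomputable def θ (k : K.Arr) : K.Arr := (D.exists_θ k).choose

/-- The inverse of `θ`. -/
noncomputable def θInv (l : K.Arr) : K.Arr := (D.exists_θInv l).choose

theorem j_θ (k : K.Arr) : Y.j (D.θ k) = D.toFun (X.j k) := (D.exists_θ k).choose_spec

theorem j_θInv (l : K.Arr) : X.j (D.θInv l) = D.invFun (Y.j l) := (D.exists_θInv l).choose_spec

theorem src_θ (k : K.Arr) : K.src (D.θ k) = K.src k := by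
  rw [← Y.src_j, D.j_θ, D.map_src, X.src_j]

theorem src_θInv (k : K.Arr) : K.src (D.θInv k) = K.src k := by
  rw [← X.src_j, D.j_θInv, D.src_invFun, Y.src_j]

theorem θ_θInv (k : K.Arr) : D.θ (D.θInv k) = k :=
  Y.j_injective (by rw [D.j_θ, D.j_θInv, D.right_inv])

theorem θInv_θ (k : K.Arr) : D.θInv (D.θ k) = k :=
  X.j_injective (by rw [D.j_θInv, D.j_θ, D.left_inv])

theorem θ_mul (k l : K.Arr) (c : K.src k = K.src l) : D.θ (K.mul k l) = K.mul (D.θ k) (D.θ l) :=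
  Y.j_injective (by
    rw [D.j_θ, X.j_mul _ _ c, Y.j_mul _ _ (by rw [D.src_θ, D.src_θ, c]), D.map_mul _ _
      (by rw [X.src_j, X.tgt_j, c]), D.j_θ, D.j_θ])

theorem θ_one (x : M) : D.θ (K.one x) = K.one x :=
  Y.j_injective (by rw [D.j_θ, X.j_one, D.map_one, Y.j_one])

/-- The changes of coordinates between the local trivializations `k ↦ k δ i`. -/
theorem smooth_transition (i j : ι) : ContMDiffOn M.model K.Arr.model ∞
    (fun x => K.mul (K.inv (D.δ i x)) (D.δ j x)) (D.U i ∩ D.U j) := by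
  refine contMDiffOn_of_embedding_comp Y.isExtension.j_embedding ?_
  refine ((D.smooth j i).comp (X.G.isLie.one_smooth.contMDiffOn (s := D.U i ∩ D.U j)) ?_).congr ?_
  · intro x hx
    exact ⟨(X.G.src_one x).symm ▸ hx.2, (X.G.tgt_one x).symm ▸ hx.1⟩
  · intro x hx
    have e1 : X.G.src (X.G.toGroupoidOn.one x) = x := X.G.src_one x
    have e2 : X.G.tgt (X.G.toGroupoidOn.one x) = x := X.G.tgt_one x
    simp only [Function.comp_apply]
    rw [Y.j_mul _ _ (by rw [K.src_inv, D.src_δ, D.src_δ]), e1, e2, Y.j_inv, D.map_one,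
      LieGroupoid.mul_one']
    rw [Y.G.src_inv, Y.tgt_j, D.src_δ]

/-- The space `K`, with the manifold structure for which the maps `k ↦ k δ i` are local
diffeomorphisms into the bundle `K`. -/
noncomputable def gluing : GluingData K.Arr K.Arr ι where
  e i :=
    { toFun := fun k => K.mul k (D.δ i (K.src k))
      invFun := fun k => K.mul k (K.inv (D.δ i (K.src k)))
      source := {k | K.src k ∈ D.U i}
      target := {k | K.src k ∈ D.U i}
      map_source' := fun k hk => by
        simpa [GroupBundle.src_mul, D.src_δ] using hk
      map_target' := fun k hk => by
        simpa [GroupBundle.src_mul, GroupBundle.src_inv, D.src_δ] using hk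
      left_inv' := fun k _ => by
        simp (maxDischargeDepth := 8) [GroupBundle.src_mul, K.tgt_eq, GroupBundle.src_inv, D.src_δ,
          LieGroupoid.mul_assoc, LieGroupoid.mul_inv, LieGroupoid.mul_one']
      right_inv' := fun k _ => by
        simp (maxDischargeDepth := 8) [GroupBundle.src_mul, K.tgt_eq, GroupBundle.src_inv, D.src_δ,
          LieGroupoid.mul_assoc, LieGroupoid.inv_mul, LieGroupoid.mul_one'] }
  cover k := D.cover (K.src k)
  isOpen_overlap i j := by
    have : {k | K.src k ∈ D.U i} ∩ (fun k => K.mul k (K.inv (D.δ i (K.src k)))) ⁻¹'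
        {k | K.src k ∈ D.U j} = K.src ⁻¹' (D.U i ∩ D.U j) := by
      ext k
      simp [GroupBundle.src_mul, GroupBundle.src_inv, D.src_δ]
    exact this ▸ ((D.isOpen_U i).inter (D.isOpen_U j)).preimage
      K.toLieGroupoid.contMDiff_src.continuous
  smooth i j := by
    have hU : ∀ k ∈ {k | K.src k ∈ D.U i} ∩ (fun k => K.mul k (K.inv (D.δ i (K.src k)))) ⁻¹'
        {k | K.src k ∈ D.U j}, K.src k ∈ D.U i ∩ D.U j := by
      intro k hk
      simpa [GroupBundle.src_mul, GroupBundle.src_inv, D.src_δ] using hk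
    have h := LieGroupoid.contMDiffOn_mul contMDiffOn_id ((D.smooth_transition i j).comp
      K.toLieGroupoid.contMDiff_src.contMDiffOn hU) fun k _ => by
        simp [GroupBundle.src_mul, GroupBundle.src_inv, D.src_δ, K.tgt_eq]
    refine h.congr fun k _ => ?_
    simp [GroupBundle.src_mul, GroupBundle.src_inv, D.src_δ, K.tgt_eq, LieGroupoid.mul_assoc]

/-- The total space of the bitorsor: the set `K`, with the glued manifold structure. -/
noncomputable def tot : Mfd.{u} := D.gluing.mfd

/-- The identity map from the total space of the bitorsor to `K`. -/
def toK (p : D.tot) : K.Arr := p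

/-- The identity map from `K` to the total space of the bitorsor. -/
def ofK (k : K.Arr) : D.tot := k

/-- The projection of the bitorsor. -/
def proj (p : D.tot) : M := K.src (D.toK p)

/-- The local trivialization `p ↦ p δ i` of the bitorsor. -/
def coord (i : ι) (p : D.tot) : K.Arr := K.mul (D.toK p) (D.δ i (D.proj p))

theorem src_coord (i : ι) (p : D.tot) : K.src (D.coord i p) = D.proj p :=
  (K.src_mul _ _ (D.src_δ i _).symm).trans (D.src_δ i _)

theorem proj_submersion : Manifold.IsSubmersion D.tot.model M.model ∞ D.proj := by
  obtain ⟨F, _, _, hF⟩ := K.isLie.src_submersion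
  refine ⟨F, inferInstance, inferInstance, fun p => ?_⟩
  obtain ⟨i, hi⟩ := D.cover (D.proj p)
  have h := D.gluing.submersionAt_comp_chart i (x := p) hi (hF _)
  exact h.congr_of_eventuallyEq (Filter.Eventually.of_forall (D.src_coord i))

theorem continuous_proj : Continuous D.proj := D.proj_submersion.contMDiff.continuous

section Smooth

variable {E' H' Z : Type*} [NormedAddCommGroup E'] [NormedSpace ℝ E'] [TopologicalSpace H']
  {I : ModelWithCorners ℝ E' H'} [TopologicalSpace Z] [ChartedSpace H' Z] {s : Set Z}

theorem contMDiffOn_coord (i : ι) {f : Z → D.tot} (hf : ContMDiffOn I D.tot.model ∞ f s)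
    (hs : ∀ z ∈ s, D.proj (f z) ∈ D.U i) :
    ContMDiffOn I K.Arr.model ∞ (fun z => D.coord i (f z)) s :=
  (D.gluing.smooth_chart i).comp hf hs

theorem contMDiffOn_of_coord (i : ι) {f : Z → D.tot} (hs : ∀ z ∈ s, D.proj (f z) ∈ D.U i)
    (hf : ContMDiffOn I K.Arr.model ∞ (fun z => D.coord i (f z)) s) :
    ContMDiffOn I D.tot.model ∞ f s := by
  refine ((D.gluing.smooth_chart_symm i).comp hf fun z hz => ?_).congr fun z hz => ?_
  · change K.src (D.coord i (f z)) ∈ D.U i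
    rw [D.src_coord]; exact hs z hz
  · exact ((D.gluing.e i).left_inv (x := f z) (hs z hz)).symm

theorem contMDiffOn_coord_pair (i : ι) :
    ContMDiffOn (D.tot.model.prod D.tot.model) K.Arr.model ∞ (fun z => D.coord i z.1)
      ({z : D.tot × D.tot | D.proj z.1 = D.proj z.2} ∩ (fun z => D.proj z.1) ⁻¹' D.U i) ∧
    ContMDiffOn (D.tot.model.prod D.tot.model) K.Arr.model ∞ (fun z => D.coord i z.2)
      ({z : D.tot × D.tot | D.proj z.1 = D.proj z.2} ∩ (fun z => D.proj z.1) ⁻¹' D.U i) :=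
  ⟨D.contMDiffOn_coord i contMDiffOn_fst fun _ hz => hz.2,
    D.contMDiffOn_coord i contMDiffOn_snd fun _ hz => (congrArg (· ∈ D.U i) hz.1).mp hz.2⟩

/-- Smoothness can be checked over the sets of the cover. -/
theorem contMDiffOn_of_cover {E'' H'' N : Type*} [NormedAddCommGroup E''] [NormedSpace ℝ E'']
    [TopologicalSpace H''] {J : ModelWithCorners ℝ E'' H''} [TopologicalSpace N]
    [ChartedSpace H'' N] {f : Z → N} {b : Z → M} (hb : Continuous b)
    (h : ∀ i, ContMDiffOn I J ∞ f (s ∩ b ⁻¹' D.U i)) : ContMDiffOn I J ∞ f s := by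
  refine contMDiffOn_of_locally_contMDiffOn fun z _ => ?_
  obtain ⟨i, hi⟩ := D.cover (b z)
  exact ⟨_, (D.isOpen_U i).preimage hb, hi, h i⟩

theorem contMDiffOn_θ (i : ι) {f : Z → K.Arr} (hf : ContMDiffOn I K.Arr.model ∞ f s)
    (hs : ∀ z ∈ s, K.src (f z) ∈ D.U i) : ContMDiffOn I K.Arr.model ∞ (fun z =>
      K.mul (K.mul (K.inv (D.δ i (K.src (f z)))) (D.θ (f z))) (D.δ i (K.src (f z)))) s := by
  refine contMDiffOn_of_embedding_comp Y.isExtension.j_embedding ?_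
  refine ((D.smooth i i).comp (X.isExtension.j_hom.smooth.comp_contMDiffOn hf) ?_).congr ?_
  · intro z hz
    simpa [X.src_j, X.tgt_j] using hs z hz
  · intro z hz
    simp (maxDischargeDepth := 8) [Y.j_mul, Y.j_inv, D.j_θ, X.src_j, X.tgt_j, D.src_δ, D.src_θ,
      GroupBundle.src_mul, GroupBundle.src_inv]

theorem contMDiffOn_θInv (i : ι) {f : Z → K.Arr} (hf : ContMDiffOn I K.Arr.model ∞ f s)
    (hs : ∀ z ∈ s, K.src (f z) ∈ D.U i) : ContMDiffOn I K.Arr.model ∞ (fun z =>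
      D.θInv (K.mul (K.mul (D.δ i (K.src (f z))) (f z)) (K.inv (D.δ i (K.src (f z)))))) s := by
  refine contMDiffOn_of_embedding_comp X.isExtension.j_embedding ?_
  refine ((D.smooth_inv i i).comp (Y.isExtension.j_hom.smooth.comp_contMDiffOn hf) ?_).congr ?_
  · intro z hz
    simpa [Y.src_j, Y.tgt_j] using hs z hz
  · intro z hz
    simp (maxDischargeDepth := 8) [Y.j_mul, Y.j_inv, D.j_θInv, Y.src_j, Y.tgt_j, D.src_δ,
      GroupBundle.src_mul, GroupBundle.src_inv]

end Smooth

/-- The bitorsor of a twisted isomorphism: `K` acts on the left by multiplication and on the right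
by multiplication through `θ`. -/
noncomputable def bitorsor : Bitorsor K K where
  Tot := D.tot
  proj := D.proj
  proj_submersion := D.proj_submersion
  proj_surjective x := ⟨K.one x, K.toLieGroupoid.src_one x⟩
  ract p k := D.ofK (K.mul (D.toK p) (D.θ k))
  proj_ract p k c := (K.src_mul _ _ (by rw [D.src_θ]; exact c)).trans
    ((D.src_θ k).trans c.symm)
  ract_one p := by
    rw [D.θ_one]; exact K.toLieGroupoid.mul_one _
  ract_mul p k k' h h' := by
    have h : K.src (D.toK p) = K.src k := h
    have h' : K.src (D.toK p) = K.src k' := h'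
    rw [D.θ_mul _ _ (h.symm.trans h')]
    refine (K.toLieGroupoid.mul_assoc _ _ _ ?_ ?_).symm
    · rw [K.tgt_eq, D.src_θ]; exact h
    · rw [K.tgt_eq, D.src_θ, D.src_θ]; exact h.symm.trans h'
  ract_smooth := by
    refine D.contMDiffOn_of_cover (b := fun z => D.proj z.1)
      (D.continuous_proj.comp continuous_fst) fun i => ?_
    refine D.contMDiffOn_of_coord i ?_ ?_
    · rintro ⟨p, k⟩ ⟨c, hi⟩
      exact (congrArg (· ∈ D.U i) ((K.src_mul _ _ ((D.src_θ k).trans (Eq.symm c)).symm).trans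
        ((D.src_θ k).trans (Eq.symm c)))).mpr hi
    · have h := LieGroupoid.contMDiffOn_mul (G := K.toLieGroupoid)
        (D.contMDiffOn_coord i contMDiffOn_fst fun z hz => hz.2)
        (D.contMDiffOn_θ i contMDiffOn_snd fun z hz => (congrArg (· ∈ D.U i) hz.1).mp hz.2)
        (s := {z : D.tot × K.Arr | D.proj z.1 = K.src z.2} ∩ (fun z => D.proj z.1) ⁻¹' D.U i) ?_
      · refine h.congr ?_
        rintro ⟨p, k⟩ ⟨c, hi⟩
        have c : K.src (D.toK p) = K.src k := c
        change K.mul (K.mul (D.toK p) (D.θ k)) (D.δ i (K.src (K.mul (D.toK p) (D.θ k)))) =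
          K.mul (K.mul (D.toK p) (D.δ i (K.src (D.toK p)))) _
        simp (maxDischargeDepth := 8) [GroupBundle.src_mul, K.tgt_eq, GroupBundle.src_inv, D.src_δ,
          LieGroupoid.mul_assoc, LieGroupoid.mul_inv_cancel_left, D.src_θ, c]
      · rintro ⟨p, k⟩ ⟨c, hi⟩
        have c : D.proj p = K.src k := c
        simp [D.src_coord, GroupBundle.src_mul, K.tgt_eq, GroupBundle.src_inv, D.src_δ, D.src_θ, c]
  rdiv q p := D.θInv (K.mul (K.inv (D.toK q)) (D.toK p))
  src_rdiv q p c := by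
    have c : K.src (D.toK q) = K.src (D.toK p) := c
    rw [D.src_θInv, K.src_mul _ _ (by rw [K.src_inv, c])]; exact c.symm
  ract_rdiv q p c := by
    have c : K.src (D.toK q) = K.src (D.toK p) := c
    rw [D.θ_θInv]
    exact LieGroupoid.mul_inv_cancel_left (by rw [K.tgt_eq, K.tgt_eq, c])
  rdiv_ract q k c := by
    have c : K.src (D.toK q) = K.src k := c
    have : K.mul (K.inv (D.toK q)) (K.mul (D.toK q) (D.θ k)) = D.θ k :=
      LieGroupoid.inv_mul_cancel_left (by rw [K.tgt_eq, D.src_θ, c])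
    exact (congrArg D.θInv this).trans (D.θInv_θ k)
  rdiv_smooth := by
    refine D.contMDiffOn_of_cover (b := fun z => D.proj z.1)
      (D.continuous_proj.comp continuous_fst) fun i => ?_
    obtain ⟨hq, hp⟩ := D.contMDiffOn_coord_pair i
    have h := D.contMDiffOn_θInv i (LieGroupoid.contMDiffOn_mul (G := K.toLieGroupoid)
      (LieGroupoid.contMDiffOn_inv hq) hp ?_) ?_
    · refine h.congr ?_
      rintro ⟨q, p⟩ ⟨c, hi⟩
      have c : K.src (D.toK q) = K.src (D.toK p) := c
      refine congrArg D.θInv ?_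
      change K.mul (K.inv (D.toK q)) (D.toK p) =
        K.mul (K.mul (D.δ i (K.src (K.mul (K.inv (K.mul (D.toK q) (D.δ i (K.src (D.toK q)))))
          (K.mul (D.toK p) (D.δ i (K.src (D.toK p)))))))
          (K.mul (K.inv (K.mul (D.toK q) (D.δ i (K.src (D.toK q)))))
          (K.mul (D.toK p) (D.δ i (K.src (D.toK p)))))) (K.inv (D.δ i (K.src (K.mul (K.inv
          (K.mul (D.toK q) (D.δ i (K.src (D.toK q)))))
          (K.mul (D.toK p) (D.δ i (K.src (D.toK p))))))))
      simp (maxDischargeDepth := 8) [GroupBundle.src_mul, K.tgt_eq, GroupBundle.src_inv, D.src_δ,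
        LieGroupoid.mul_assoc, LieGroupoid.mul_inv_cancel_left, LieGroupoid.inv_mul_rev,
        LieGroupoid.mul_inv, LieGroupoid.mul_one', c]
    · rintro ⟨q, p⟩ ⟨c, hi⟩
      have c : D.proj q = D.proj p := c
      simp [D.src_coord, K.tgt_eq, GroupBundle.src_inv, c]
    · rintro ⟨q, p⟩ ⟨c, hi⟩
      have c : D.proj q = D.proj p := c
      have hi : D.proj q ∈ D.U i := hi
      rw [c] at hi
      simpa [D.src_coord, GroupBundle.src_mul, GroupBundle.src_inv, c] using hi
  lact l p := D.ofK (K.mul l (D.toK p))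
  proj_lact l p c := K.src_mul _ _ c.symm
  one_lact p := LieGroupoid.one_mul' (K.tgt_eq _)
  mul_lact l l' p h h' := by
    have h : K.src (D.toK p) = K.src l := h
    have h' : K.src (D.toK p) = K.src l' := h'
    refine K.toLieGroupoid.mul_assoc _ _ _ ?_ ?_
    · rw [K.tgt_eq]; exact h.symm.trans h'
    · rw [K.tgt_eq]; exact h'.symm
  lact_smooth := by
    refine D.contMDiffOn_of_cover (b := fun z => D.proj z.2)
      (D.continuous_proj.comp continuous_snd) fun i => ?_
    refine D.contMDiffOn_of_coord i ?_ ?_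
    · rintro ⟨l, p⟩ ⟨c, hi⟩
      exact (congrArg (· ∈ D.U i) (K.src_mul _ _ (Eq.symm c))).mpr hi
    · have h := LieGroupoid.contMDiffOn_mul (G := K.toLieGroupoid) contMDiffOn_fst
        (D.contMDiffOn_coord i contMDiffOn_snd fun z hz => hz.2)
        (s := {z : K.Arr × D.tot | D.proj z.2 = K.src z.1} ∩ (fun z => D.proj z.2) ⁻¹' D.U i) ?_
      · refine h.congr ?_
        rintro ⟨l, p⟩ ⟨c, hi⟩
        have c : K.src (D.toK p) = K.src l := c
        change K.mul (K.mul l (D.toK p)) (D.δ i (K.src (K.mul l (D.toK p)))) =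
          K.mul l (K.mul (D.toK p) (D.δ i (K.src (D.toK p))))
        simp (maxDischargeDepth := 8) [GroupBundle.src_mul, K.tgt_eq, D.src_δ,
          LieGroupoid.mul_assoc, c]
      · rintro ⟨l, p⟩ ⟨c, hi⟩
        have c : D.proj p = K.src l := c
        simp [D.src_coord, K.tgt_eq, c]
  ldiv p q := K.mul (D.toK p) (K.inv (D.toK q))
  src_ldiv p q c := (K.src_mul _ _ (c.trans (K.src_inv _).symm)).trans (K.src_inv _)
  ldiv_lact p q c := by
    have c : K.src (D.toK p) = K.src (D.toK q) := c
    refine (K.toLieGroupoid.mul_assoc _ _ _ ?_ ?_).trans ?_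
    · rw [K.tgt_eq, K.src_inv, c]
    · rw [K.src_inv, K.tgt_eq]
    · rw [K.toLieGroupoid.inv_mul]; exact LieGroupoid.mul_one' c
  lact_ldiv l q c := by
    have c : K.src (D.toK q) = K.src l := c
    refine (K.toLieGroupoid.mul_assoc _ _ _ ?_ ?_).trans ?_
    · rw [K.tgt_eq, c]
    · rw [K.tgt_eq, K.src_inv]
    · rw [K.toLieGroupoid.mul_inv, K.tgt_eq]; exact LieGroupoid.mul_one' c.symm
  ldiv_smooth := by
    refine D.contMDiffOn_of_cover (b := fun z => D.proj z.1)
      (D.continuous_proj.comp continuous_fst) fun i => ?_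
    obtain ⟨hq, hp⟩ := D.contMDiffOn_coord_pair i
    have h := LieGroupoid.contMDiffOn_mul (G := K.toLieGroupoid) hq
      (LieGroupoid.contMDiffOn_inv hp) ?_
    · refine h.congr ?_
      rintro ⟨q, p⟩ ⟨c, hi⟩
      have c : K.src (D.toK q) = K.src (D.toK p) := c
      change K.mul (D.toK q) (K.inv (D.toK p)) =
        K.mul (K.mul (D.toK q) (D.δ i (K.src (D.toK q))))
          (K.inv (K.mul (D.toK p) (D.δ i (K.src (D.toK p)))))
      simp (maxDischargeDepth := 8) [GroupBundle.src_mul, K.tgt_eq, GroupBundle.src_inv, D.src_δ,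
        LieGroupoid.mul_assoc, LieGroupoid.mul_inv_cancel_left, LieGroupoid.inv_mul_rev, c]
    · rintro ⟨q, p⟩ ⟨c, hi⟩
      have c : D.proj q = D.proj p := c
      simp [D.src_coord, K.tgt_eq, GroupBundle.src_inv, c]
  lact_ract l p k h h' := by
    have h : K.src (D.toK p) = K.src l := h
    have h' : K.src (D.toK p) = K.src k := h'
    refine (K.toLieGroupoid.mul_assoc _ _ _ ?_ ?_).symm
    · rw [K.tgt_eq]; exact h.symm
    · rw [K.tgt_eq, D.src_θ]; exact h'

end TwistedIso

/-! ### The twisted extension -/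

/-- The manifold structure on `A` transported along a bijection onto a manifold. -/
def transportData {A : Type u} {Y : Mfd.{u}} (e : A ≃ Y) : GluingData A Y Unit where
  e _ := e.toPartialEquiv
  cover _ := ⟨(), trivial⟩
  isOpen_overlap _ _ := by simp
  smooth _ _ := by
    refine contMDiffOn_id.congr fun y _ => ?_
    simp

namespace TwistedIso

variable {M : Mfd.{u}} {K : GroupBundle M} {E : LieGroupoid M} {X Y : Extension K E} {ι : Type*}
  (D : TwistedIso X Y ι)

theorem map_mul_left (k : K.Arr) (h : X.G.Arr) (c : K.src k = X.G.tgt h) :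
    D.toFun (X.G.mul (X.j k) h) = Y.G.mul (Y.j (D.θ k)) (D.toFun h) := by
  rw [D.map_mul _ _ (by rw [X.src_j, c]), D.j_θ]

theorem map_mul_right (h : X.G.Arr) (k : K.Arr) (c : K.src k = X.G.src h) :
    D.toFun (X.G.mul h (X.j k)) = Y.G.mul (D.toFun h) (Y.j (D.θ k)) := by
  rw [D.map_mul _ _ (by rw [X.tgt_j, c]), D.j_θ]

theorem θ_inv (k : K.Arr) : D.θ (K.inv k) = K.inv (D.θ k) :=
  Y.j_injective (by
    refine (LieGroupoid.eq_inv _ _ ?_ ?_).trans (Y.j_inv _).symm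
    · rw [Y.src_j, Y.tgt_j, D.src_θ, D.src_θ, K.src_inv]
    · rw [← Y.j_mul _ _ (by rw [D.src_θ, D.src_θ, K.src_inv]), ← D.θ_mul _ _ (K.src_inv k),
        K.toLieGroupoid.inv_mul, D.θ_one, Y.j_one, Y.src_j, D.src_θ])

/-- The map `q ⊗ h ⊗ p⁻¹ ↦ q Ψ(h) p⁻¹`, for a twisted isomorphism `Ψ`. -/
noncomputable def ofTwist : Twist D.bitorsor X → Y.G.Arr :=
  Quot.lift (fun a => Y.G.mul (Y.G.mul (Y.j (D.toK a.1.1)) (D.toFun a.1.2.1))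
    (Y.G.inv (Y.j (D.toK a.1.2.2)))) <| TwistRel.elim
    (fun q g p k hk hq hp _ _ => by
      have hk : K.src k = K.src (D.toK q) := hk
      have hq : K.src (D.toK q) = X.G.tgt g := hq
      have hp : K.src (D.toK p) = X.G.src g := hp
      change Y.G.mul (Y.G.mul (Y.j (K.mul (D.toK q) (D.θ k))) (D.toFun g))
        (Y.G.inv (Y.j (D.toK p))) = Y.G.mul (Y.G.mul (Y.j (D.toK q))
          (D.toFun (X.G.mul (X.j k) g))) (Y.G.inv (Y.j (D.toK p)))
      rw [D.map_mul_left _ _ (hk.trans hq), Y.j_mul _ _ (by rw [D.src_θ, hk])]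
      congr 1
      refine LieGroupoid.mul_assoc _ _ _ _ ?_ ?_
      · rw [Y.src_j, Y.tgt_j, D.src_θ, hk]
      · rw [Y.src_j, D.src_θ, D.map_tgt, hk, hq])
    (fun q g p l hl hq hp _ _ => by
      have hl : K.src l = K.src (D.toK p) := hl
      have hq : K.src (D.toK q) = X.G.tgt g := hq
      have hp : K.src (D.toK p) = X.G.src g := hp
      change Y.G.mul (Y.G.mul (Y.j (D.toK q)) (D.toFun (X.G.mul g (X.j l))))
        (Y.G.inv (Y.j (D.toK p))) = Y.G.mul (Y.G.mul (Y.j (D.toK q)) (D.toFun g))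
          (Y.G.inv (Y.j (K.mul (D.toK p) (D.θ (K.inv l)))))
      rw [D.map_mul_right _ _ (hl.trans hp), D.θ_inv, Y.j_mul _ _ (by rw [K.src_inv, D.src_θ, hl])]
      simp (maxDischargeDepth := 8) [Y.j_inv, LieGroupoid.inv_mul_rev,
        LieGroupoid.inv_inv, LieGroupoid.mul_assoc, LieGroupoid.src_mul, LieGroupoid.tgt_mul,
        LieGroupoid.tgt_inv, Y.src_j, Y.tgt_j, D.src_θ, D.map_src, D.map_tgt, hl, hq, hp])

theorem ofTwist_tensor (q : D.bitorsor.Tot) (h : X.G.Arr) (p : D.bitorsor.Tot) (hq hp) :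
    D.ofTwist (tensor q h p hq hp) = Y.G.mul (Y.G.mul (Y.j (D.toK q)) (D.toFun h))
      (Y.G.inv (Y.j (D.toK p))) := rfl

theorem src_ofTwist (a : Twist D.bitorsor X) : Y.G.src (D.ofTwist a) = Twist.src a := by
  induction a using Twist.ind with
  | h q h p hq hp =>
    have hq : K.src (D.toK q) = X.G.tgt h := hq
    have hp' : K.src (D.toK p) = X.G.src h := hp
    change _ = K.src (D.toK p)
    rw [ofTwist_tensor]
    simp (maxDischargeDepth := 8) [LieGroupoid.src_mul, LieGroupoid.src_inv, LieGroupoid.tgt_inv,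
      Y.src_j, Y.tgt_j, D.map_src, D.map_tgt, hq, hp']

theorem tgt_ofTwist (a : Twist D.bitorsor X) : Y.G.tgt (D.ofTwist a) = Twist.tgt a := by
  induction a using Twist.ind with
  | h q h p hq hp =>
    have hq' : K.src (D.toK q) = X.G.tgt h := hq
    have hp' : K.src (D.toK p) = X.G.src h := hp
    change _ = K.src (D.toK q)
    rw [ofTwist_tensor]
    simp (maxDischargeDepth := 8) [LieGroupoid.src_mul, LieGroupoid.tgt_mul, LieGroupoid.tgt_inv,
      Y.src_j, Y.tgt_j, D.map_src, D.map_tgt, hq', hp']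

theorem π_ofTwist (a : Twist D.bitorsor X) : Y.π (D.ofTwist a) = twistπ D.bitorsor X a := by
  induction a using Twist.ind with
  | h q h p hq hp =>
    have hq' : K.src (D.toK q) = X.G.tgt h := hq
    have hp' : K.src (D.toK p) = X.G.src h := hp
    change _ = X.π h
    have hY := Y.isExtension.π_hom
    have hX := X.isExtension.π_hom
    rw [ofTwist_tensor, hY.map_mul _ _ (by simp (maxDischargeDepth := 8) [LieGroupoid.src_mul,
        LieGroupoid.tgt_inv, Y.src_j, D.map_src, D.map_tgt, hq', hp']),
      hY.map_mul _ _ (by rw [Y.src_j, D.map_tgt, hq']), hY.map_inv, Y.π_j, Y.π_j, D.π_comp, hq',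
      hp', LieGroupoid.inv_one, LieGroupoid.one_mul' (hX.map_tgt h),
      LieGroupoid.mul_one' (hX.map_src h)]

theorem map_mul_mul {h g : X.G.Arr} {k : K.Arr} (hk : K.src k = X.G.src h)
    (hk' : K.src k = X.G.tgt g) : D.toFun (X.G.mul (X.G.mul h (X.j (D.θInv k))) g) =
      Y.G.mul (Y.G.mul (D.toFun h) (Y.j k)) (D.toFun g) := by
  have c : K.src (D.θInv k) = X.G.src h := (D.src_θInv k).trans hk
  rw [D.map_mul _ _ (by rw [X.G.src_mul _ _ (by rw [X.tgt_j, c]), X.src_j, D.src_θInv, hk']),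
    D.map_mul_right _ _ c, D.θ_θInv]

theorem ofTwist_mul (a b : Twist D.bitorsor X) (c : Twist.src a = Twist.tgt b) :
    D.ofTwist (Twist.mul a b) = Y.G.mul (D.ofTwist a) (D.ofTwist b) := by
  induction a using Twist.ind with
  | h r h s hr hs =>
  induction b using Twist.ind with
  | h q g p hq hp =>
    have hr' : K.src (D.toK r) = X.G.tgt h := hr
    have hs' : K.src (D.toK s) = X.G.src h := hs
    have hq' : K.src (D.toK q) = X.G.tgt g := hq
    have hp' : K.src (D.toK p) = X.G.src g := hp
    have c' : X.G.src h = X.G.tgt g := by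
      rw [← hs', ← hq']; exact c
    obtain ⟨h1, h2, e⟩ := tensor_mul r s q p h g hr hs hq hp c
    rw [e, ofTwist_tensor, ofTwist_tensor, ofTwist_tensor]
    have hk : K.src (K.mul (K.inv (D.toK s)) (D.toK q)) = X.G.src h := by
      rw [K.src_mul _ _ (by rw [K.src_inv, hs', hq', c']), hq', c']
    have e2 := D.map_mul_mul (k := K.mul (K.inv (D.toK s)) (D.toK q)) hk (hk.trans c')
    change Y.G.mul (Y.G.mul (Y.j (D.toK r)) (D.toFun (X.G.mul (X.G.mul h (X.j (D.θInv
      (K.mul (K.inv (D.toK s)) (D.toK q))))) g))) _ = _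
    rw [e2, Y.j_mul _ _ (by rw [K.src_inv, hs', hq', c']), Y.j_inv]
    generalize D.toK r = r at *
    generalize D.toK s = s at *
    generalize D.toK q = q at *
    generalize D.toK p = p at *
    simp (maxDischargeDepth := 8) [LieGroupoid.mul_assoc, LieGroupoid.src_mul,
      LieGroupoid.tgt_mul, LieGroupoid.src_inv, LieGroupoid.tgt_inv, Y.src_j, Y.tgt_j, D.map_src,
      D.map_tgt, hr', hs', hq', hp', c']

theorem ofTwist_j (k : K.Arr) : D.ofTwist (twistJ D.bitorsor X k) = Y.j k := by
  set q := Function.surjInv D.bitorsor.proj_surjective (K.src k)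
  have hq : K.src (D.toK q) = K.src k := Function.surjInv_eq D.bitorsor.proj_surjective (K.src k)
  change Y.G.mul (Y.G.mul (Y.j (K.mul k (D.toK q))) (D.toFun (X.G.one (K.src k))))
    (Y.G.inv (Y.j (D.toK q))) = _
  generalize D.toK q = q at *
  rw [D.map_one]
  simp (maxDischargeDepth := 8) [Y.j_mul, LieGroupoid.mul_assoc, LieGroupoid.src_mul,
    LieGroupoid.tgt_inv, LieGroupoid.mul_inv, LieGroupoid.mul_one', Y.src_j, Y.tgt_j, hq]

/-- The arrow `h` with `q ⊗ h ⊗ p⁻¹ = g`. -/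
noncomputable def solve (q p : K.Arr) (g : Y.G.Arr) : X.G.Arr :=
  D.invFun (Y.G.mul (Y.G.mul (Y.G.inv (Y.j q)) g) (Y.j p))

theorem src_solve {q p : K.Arr} {g : Y.G.Arr} (hq : K.src q = Y.G.tgt g)
    (hp : K.src p = Y.G.src g) :
    X.G.src (D.solve q p g) = K.src p := by
  simp (maxDischargeDepth := 8) [solve, src_invFun, LieGroupoid.src_mul, LieGroupoid.src_inv,
    Y.src_j, Y.tgt_j, hq, hp]

theorem tgt_solve {q p : K.Arr} {g : Y.G.Arr} (hq : K.src q = Y.G.tgt g)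
    (hp : K.src p = Y.G.src g) :
    X.G.tgt (D.solve q p g) = K.src q := by
  simp (maxDischargeDepth := 8) [solve, tgt_invFun, LieGroupoid.src_mul, LieGroupoid.src_inv,
    LieGroupoid.tgt_mul, LieGroupoid.tgt_inv, Y.src_j, Y.tgt_j, hq, hp]

theorem mul_solve {q p : K.Arr} {g : Y.G.Arr} (hq : K.src q = Y.G.tgt g)
    (hp : K.src p = Y.G.src g) :
    Y.G.mul (Y.G.mul (Y.j q) (D.toFun (D.solve q p g))) (Y.G.inv (Y.j p)) = g := by
  simp (maxDischargeDepth := 8) [solve, D.right_inv, LieGroupoid.mul_assoc, LieGroupoid.src_inv,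
    LieGroupoid.tgt_mul, LieGroupoid.tgt_inv, LieGroupoid.mul_inv_cancel_left,
    LieGroupoid.mul_inv, LieGroupoid.mul_one', Y.src_j, Y.tgt_j, hq, hp]

theorem solve_mul {q p : K.Arr} {h : X.G.Arr} (hq : K.src q = X.G.tgt h)
    (hp : K.src p = X.G.src h) :
    D.solve q p (Y.G.mul (Y.G.mul (Y.j q) (D.toFun h)) (Y.G.inv (Y.j p))) = h := by
  simp (maxDischargeDepth := 8) [solve, D.left_inv, LieGroupoid.mul_assoc, LieGroupoid.src_inv,
    LieGroupoid.tgt_mul, LieGroupoid.tgt_inv, LieGroupoid.inv_mul_cancel_left,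
    LieGroupoid.inv_mul, LieGroupoid.mul_one', Y.src_j, Y.tgt_j, D.map_src, D.map_tgt, hq, hp]

theorem ofTwist_surjective : Function.Surjective D.ofTwist := fun g => by
  have h1 : K.src (K.one (Y.G.tgt g)) = Y.G.tgt g := K.toLieGroupoid.src_one _
  have h2 : K.src (K.one (Y.G.src g)) = Y.G.src g := K.toLieGroupoid.src_one _
  exact ⟨tensor (D.ofK (K.one (Y.G.tgt g))) (D.solve _ _ g) (D.ofK (K.one (Y.G.src g)))
    (D.tgt_solve h1 h2).symm (D.src_solve h1 h2).symm, D.mul_solve h1 h2⟩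

/-- Every arrow of the twisted extension is of the form `1 ⊗ h ⊗ 1⁻¹`. -/
theorem exists_tensor_one (a : Twist D.bitorsor X) : ∃ h hq hp,
    a = tensor (D.ofK (K.one (X.G.tgt h))) h (D.ofK (K.one (X.G.src h))) hq hp := by
  induction a using Twist.ind with
  | h q h p hq hp =>
    have hq' : K.src (D.toK q) = X.G.tgt h := hq
    have hp' : K.src (D.toK p) = X.G.src h := hp
    have h1 : D.bitorsor.proj (D.ofK (K.one (X.G.tgt h))) = X.G.tgt h := K.toLieGroupoid.src_one _
    have h2 : D.bitorsor.proj (D.ofK (K.one (X.G.src h))) = X.G.src h := K.toLieGroupoid.src_one _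
    have e1 := D.bitorsor.ract_rdiv _ _ (h1.trans hq.symm)
    have e2 := D.bitorsor.ract_rdiv _ _ (h2.trans hp.symm)
    have s1 := D.bitorsor.src_rdiv _ _ (h1.trans hq.symm)
    have s2 := D.bitorsor.src_rdiv _ _ (h2.trans hp.symm)
    set k := D.bitorsor.rdiv (D.ofK (K.one (X.G.tgt h))) q
    set l := D.bitorsor.rdiv (D.ofK (K.one (X.G.src h))) p
    have s2' : K.src (K.inv l) = D.bitorsor.proj (D.ofK (K.one (X.G.src h))) := by
      rw [K.src_inv, s2]
    have k1 : X.G.src (X.j k) = X.G.tgt h := by rw [X.src_j, s1, h1]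
    have k2 : X.G.src (X.G.mul (X.j k) h) = X.G.src h := X.G.src_mul _ _ k1
    have k3 : X.G.tgt (X.G.mul (X.j k) h) = X.G.tgt h := by
      rw [X.G.tgt_mul _ _ k1, X.tgt_j, s1, h1]
    have k4 : X.G.src (X.G.mul (X.j k) h) = X.G.tgt (X.j (K.inv l)) := by
      rw [k2, X.tgt_j, s2', h2]
    have k5 : X.G.tgt (X.G.mul (X.G.mul (X.j k) h) (X.j (K.inv l))) = X.G.tgt h := by
      rw [X.G.tgt_mul _ _ k4, k3]
    have k6 : X.G.src (X.G.mul (X.G.mul (X.j k) h) (X.j (K.inv l))) = X.G.src h := by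
      rw [X.G.src_mul _ _ k4, X.src_j, s2', h2]
    refine ⟨X.G.mul (X.G.mul (X.j k) h) (X.j (K.inv l)), ?_, ?_, ?_⟩
    · rw [k5, h1]
    · rw [k6, h2]
    · have r := tensor_right _ _ _ _ s2' (h1.trans k3.symm) (h2.trans k2.symm)
      have t := tensor_left _ _ _ _ s1 h1 hp
      refine (tensor_congr _ _ e1.symm rfl rfl).trans (t.trans ?_)
      refine (tensor_congr _ _ rfl rfl ?_).trans (r.symm.trans ?_)
      · rw [LieGroupoid.inv_inv, e2]
      · exact tensor_congr _ _ (by rw [k5]) rfl (by rw [k6])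

theorem ofTwist_injective : Function.Injective D.ofTwist := by
  intro a b hab
  obtain ⟨h, hq, hp, rfl⟩ := D.exists_tensor_one a
  obtain ⟨g, hq', hp', rfl⟩ := D.exists_tensor_one b
  have key : ∀ h : X.G.Arr, Y.G.mul (Y.G.mul (Y.j (K.one (X.G.tgt h))) (D.toFun h))
      (Y.G.inv (Y.j (K.one (X.G.src h)))) = D.toFun h := fun h => by
    rw [Y.j_one, Y.j_one, LieGroupoid.inv_one, LieGroupoid.one_mul' (D.map_tgt h),
      LieGroupoid.mul_one' (D.map_src h)]
  have : h = g := by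
    rw [← D.left_inv h, ← D.left_inv g, ← key h, ← key g]
    exact congrArg D.invFun hab
  subst this
  rfl

/-- The bijection `P ⊗_K X ⊗_K P⁻¹ → Y`. -/
noncomputable def twistEquiv : Twist D.bitorsor X ≃ Y.G.Arr :=
  Equiv.ofBijective D.ofTwist ⟨D.ofTwist_injective, D.ofTwist_surjective⟩

/-- The manifold structure on `P ⊗_K X ⊗_K P⁻¹` for which `twistEquiv` is a diffeomorphism. -/
noncomputable def twistStr : MfdStr (Twist D.bitorsor X) := (transportData D.twistEquiv).mfdStr

/-- The diffeomorphism `P ⊗_K X ⊗_K P⁻¹ → Y`. -/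
noncomputable def twistDiffeo : Diffeomorph (twistMfd D.twistStr).model Y.G.Arr.model
    (twistMfd D.twistStr) Y.G.Arr ∞ where
  toEquiv := D.twistEquiv
  contMDiff_toFun := contMDiffOn_univ.1 ((transportData D.twistEquiv).smooth_chart ())
  contMDiff_invFun := contMDiffOn_univ.1 ((transportData D.twistEquiv).smooth_chart_symm ())

section

variable {E' H' Z : Type*} [NormedAddCommGroup E'] [NormedSpace ℝ E'] [TopologicalSpace H']
  {I : ModelWithCorners ℝ E' H'} [TopologicalSpace Z] [ChartedSpace H' Z] {s : Set Z}

theorem contMDiffOn_of_ofTwist {f : Z → twistMfd D.twistStr}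
    (hf : ContMDiffOn I Y.G.Arr.model ∞ (D.ofTwist ∘ f) s) :
    ContMDiffOn I (twistMfd D.twistStr).model ∞ f s :=
  (D.twistDiffeo.symm.contMDiff.comp_contMDiffOn hf).congr fun z _ =>
    (D.twistDiffeo.symm_apply_apply (f z)).symm

theorem submersion_of_ofTwist {f : Y.G.Arr → Z} {f' : twistMfd D.twistStr → Z}
    (h : ∀ a, f (D.ofTwist a) = f' a) (hf : Manifold.IsSubmersion Y.G.Arr.model I ∞ f) :
    Manifold.IsSubmersion (twistMfd D.twistStr).model I ∞ f' := by
  obtain rfl : (fun a => f (D.ofTwist a)) = f' := funext h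
  obtain ⟨F, _, _, hF⟩ := hf
  exact ⟨F, inferInstance, inferInstance, fun a =>
    (transportData D.twistEquiv).submersionAt_comp_chart () (x := a) trivial (hF _)⟩

end

theorem ofTwist_one (x : M) : D.ofTwist (Twist.one D.bitorsor X x) = Y.G.one x := by
  have hs : Twist.src (Twist.one D.bitorsor X x) = x := (twistGroupoid D.bitorsor X).src_one x
  have ht : Twist.tgt (Twist.one D.bitorsor X x) = x := (twistGroupoid D.bitorsor X).tgt_one x
  have hm : Twist.mul (Twist.one D.bitorsor X (Twist.tgt (Twist.one D.bitorsor X x)))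
      (Twist.one D.bitorsor X x) = Twist.one D.bitorsor X x :=
    (twistGroupoid D.bitorsor X).one_mul (Twist.one D.bitorsor X x)
  rw [ht] at hm
  refine LieGroupoid.eq_one_of_mul_self ((D.src_ofTwist _).trans hs) ((D.tgt_ofTwist _).trans ht) ?_
  rw [← D.ofTwist_mul _ _ (hs.trans ht.symm), hm]

theorem ofTwist_inv (a : Twist D.bitorsor X) :
    D.ofTwist (Twist.inv a) = Y.G.inv (D.ofTwist a) := by
  have hs : Twist.src (Twist.inv a) = Twist.tgt a := (twistGroupoid D.bitorsor X).src_inv a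
  have hm : Twist.mul (Twist.inv a) a = Twist.one D.bitorsor X (Twist.src a) :=
    (twistGroupoid D.bitorsor X).inv_mul a
  refine LieGroupoid.eq_inv _ _ ?_ ?_
  · rw [D.src_ofTwist, D.tgt_ofTwist, hs]
  · rw [← D.ofTwist_mul _ _ hs, hm, D.ofTwist_one, D.src_ofTwist]

theorem isLie_twist : IsLie (M := M) (A := twistMfd D.twistStr) (twistGroupoid D.bitorsor X) where
  src_submersion := D.submersion_of_ofTwist D.src_ofTwist Y.G.isLie.src_submersion
  tgt_submersion := D.submersion_of_ofTwist D.tgt_ofTwist Y.G.isLie.tgt_submersion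
  one_smooth := by
    refine contMDiffOn_univ.1 (D.contMDiffOn_of_ofTwist ?_)
    exact Y.G.isLie.one_smooth.contMDiffOn.congr fun x _ => D.ofTwist_one x
  inv_smooth := by
    refine contMDiffOn_univ.1 (D.contMDiffOn_of_ofTwist ?_)
    exact (Y.G.isLie.inv_smooth.comp D.twistDiffeo.contMDiff).contMDiffOn.congr
      fun a _ => D.ofTwist_inv a
  mul_smooth := by
    refine D.contMDiffOn_of_ofTwist ?_
    refine (LieGroupoid.contMDiffOn_mul (G := Y.G)
      (D.twistDiffeo.contMDiff.comp_contMDiffOn contMDiffOn_fst)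
      (D.twistDiffeo.contMDiff.comp_contMDiffOn contMDiffOn_snd) ?_).congr
      fun z hz => D.ofTwist_mul _ _ hz
    intro z hz
    exact (D.src_ofTwist _).trans (Eq.trans hz (D.tgt_ofTwist _).symm)

theorem src_twistJ (k : K.Arr) : Twist.src (twistJ D.bitorsor X k) = K.src k := by
  rw [← D.src_ofTwist, D.ofTwist_j, Y.src_j]

theorem tgt_twistJ (k : K.Arr) : Twist.tgt (twistJ D.bitorsor X k) = K.tgt k := by
  rw [← D.tgt_ofTwist, D.ofTwist_j, Y.isExtension.j_hom.map_tgt]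

theorem isExtension_twist : IsExtension K E
    ⟨twistMfd D.twistStr, twistGroupoid D.bitorsor X, D.isLie_twist⟩
    (twistJ D.bitorsor X) (twistπ D.bitorsor X) where
  j_hom :=
    { smooth := by
        refine contMDiffOn_univ.1 (D.contMDiffOn_of_ofTwist ?_)
        exact Y.isExtension.j_hom.smooth.contMDiffOn.congr fun k _ => D.ofTwist_j k
      map_src := D.src_twistJ
      map_tgt := D.tgt_twistJ
      map_mul := fun k l c => by
        refine D.ofTwist_injective ((D.ofTwist_j _).trans (Eq.trans ?_
          (D.ofTwist_mul _ _ ((D.src_twistJ k).trans (c.trans (D.tgt_twistJ l).symm))).symm))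
        rw [D.ofTwist_j, D.ofTwist_j, Y.isExtension.j_hom.map_mul _ _ c] }
  j_embedding := by
    have e : twistJ D.bitorsor X = D.twistDiffeo.symm ∘ Y.j := by
      funext k
      exact D.ofTwist_injective ((D.ofTwist_j k).trans (D.twistDiffeo.apply_symm_apply _).symm)
    obtain ⟨⟨F, _, _, hF⟩, hE⟩ := Y.isExtension.j_embedding
    rw [e]
    refine ⟨⟨F, inferInstance, inferInstance, fun k => ?_⟩, ?_⟩
    · exact (transportData D.twistEquiv).immersionAt_chart_symm_comp () (x := k) trivial (hF _)
    · exact D.twistDiffeo.symm.toHomeomorph.isEmbedding.comp hE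
  π_hom :=
    { smooth := (Y.isExtension.π_hom.smooth.comp D.twistDiffeo.contMDiff).congr
        fun a => (D.π_ofTwist a).symm
      map_src := fun a => (congrArg E.src (D.π_ofTwist a)).symm.trans
        ((Y.isExtension.π_hom.map_src _).trans (D.src_ofTwist a))
      map_tgt := fun a => (congrArg E.tgt (D.π_ofTwist a)).symm.trans
        ((Y.isExtension.π_hom.map_tgt _).trans (D.tgt_ofTwist a))
      map_mul := fun a b c => by
        have c' : Y.G.src (D.ofTwist a) = Y.G.tgt (D.ofTwist b) :=
          (D.src_ofTwist a).trans (Eq.trans c (D.tgt_ofTwist b).symm)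
        have h := congrArg Y.π (D.ofTwist_mul a b c)
        rw [Y.isExtension.π_hom.map_mul _ _ c'] at h
        exact (D.π_ofTwist _).symm.trans (h.trans (congrArg₂ E.mul (D.π_ofTwist a)
          (D.π_ofTwist b))) }
  π_submersion := D.submersion_of_ofTwist D.π_ofTwist Y.isExtension.π_submersion
  π_surjective := by
    rw [← funext D.π_ofTwist]
    exact Y.isExtension.π_surjective.comp D.ofTwist_surjective
  exact a := by
    refine Iff.trans (exists_congr fun k => ?_) ((Y.isExtension.exact (D.ofTwist a)).trans
      (exists_congr fun x => Eq.congr_left (D.π_ofTwist a)))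
    rw [← D.ofTwist_j]
    exact D.ofTwist_injective.eq_iff.symm

theorem contMDiffOn_mul_toFun_mul : ContMDiffOn
    (D.tot.model.prod (X.G.Arr.model.prod D.tot.model)) Y.G.Arr.model ∞
    (fun z : D.tot × X.G.Arr × D.tot => Y.G.mul (Y.G.mul (Y.j (D.toK z.1)) (D.toFun z.2.1))
      (Y.G.inv (Y.j (D.toK z.2.2)))) (tripleSet D.bitorsor X) := by
  refine D.contMDiffOn_of_cover (b := fun z => D.proj z.1)
    (D.continuous_proj.comp continuous_fst) fun j => ?_
  refine D.contMDiffOn_of_cover (b := fun z => D.proj z.2.2)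
    (D.continuous_proj.comp (continuous_snd.comp continuous_snd)) fun i => ?_
  set s : Set (D.tot × X.G.Arr × D.tot) :=
    (tripleSet D.bitorsor X ∩ (fun z => D.proj z.1) ⁻¹' D.U j) ∩ (fun z => D.proj z.2.2) ⁻¹' D.U i
  have hq : ∀ z ∈ s, D.proj z.1 = X.G.tgt z.2.1 := fun z hz => hz.1.1.1
  have hp : ∀ z ∈ s, D.proj z.2.2 = X.G.src z.2.1 := fun z hz => hz.1.1.2
  have h1 := Y.isExtension.j_hom.smooth.comp_contMDiffOn (D.contMDiffOn_coord j
    (s := s) (contMDiffOn_fst (I := D.tot.model) (J := X.G.Arr.model.prod D.tot.model))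
    fun z hz => hz.1.2)
  have h2 := Y.isExtension.j_hom.smooth.comp_contMDiffOn (D.contMDiffOn_coord i
    (s := s) ((contMDiffOn_snd (I := X.G.Arr.model) (J := D.tot.model)).comp
      (contMDiffOn_snd (I := D.tot.model) (J := X.G.Arr.model.prod D.tot.model))
      (Set.subset_preimage_univ)) fun z hz => hz.2)
  have h3 := (D.smooth i j).comp (s := s)
    ((contMDiffOn_fst (I := X.G.Arr.model) (J := D.tot.model)).comp
      (contMDiffOn_snd (I := D.tot.model) (J := X.G.Arr.model.prod D.tot.model))
      (Set.subset_preimage_univ)) fun z hz => ⟨hp z hz ▸ hz.2, hq z hz ▸ hz.1.2⟩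
  refine (LieGroupoid.contMDiffOn_mul (LieGroupoid.contMDiffOn_mul h1 h3 ?_)
    (LieGroupoid.contMDiffOn_inv h2) ?_).congr ?_
  all_goals
    rintro ⟨q, h, p⟩ hz
    have hq : K.src (D.toK q) = X.G.tgt h := hq _ hz
    have hp : K.src (D.toK p) = X.G.src h := hp _ hz
    simp (maxDischargeDepth := 8) [coord, proj, Y.j_mul, LieGroupoid.mul_assoc,
      LieGroupoid.src_mul, LieGroupoid.tgt_mul, LieGroupoid.src_inv, LieGroupoid.tgt_inv,
      LieGroupoid.mul_inv_cancel_left, LieGroupoid.inv_mul_rev, Y.src_j, Y.tgt_j, D.src_δ,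
      D.map_src, D.map_tgt, hq, hp]

/-- Solving for the middle factor is smooth, in the local trivializations of the bitorsor. -/
theorem contMDiffOn_solve {i j : ι} {a b : M → K.Arr} {V W : Set M}
    (ha : ContMDiffOn M.model K.Arr.model ∞ a V) (hb : ContMDiffOn M.model K.Arr.model ∞ b W)
    (has : ∀ y ∈ V, K.src (a y) = y) (hbs : ∀ y ∈ W, K.src (b y) = y) :
    ContMDiffOn Y.G.Arr.model X.G.Arr.model ∞ (fun g => D.solve
      (K.mul (a (Y.G.tgt g)) (K.inv (D.δ j (Y.G.tgt g))))
      (K.mul (b (Y.G.src g)) (K.inv (D.δ i (Y.G.src g)))) g)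
      {g | (Y.G.tgt g ∈ V ∧ Y.G.tgt g ∈ D.U j) ∧ Y.G.src g ∈ W ∧ Y.G.src g ∈ D.U i} := by
  set s := {g : Y.G.Arr | (Y.G.tgt g ∈ V ∧ Y.G.tgt g ∈ D.U j) ∧ Y.G.src g ∈ W ∧ Y.G.src g ∈ D.U i}
  have h1 := Y.isExtension.j_hom.smooth.comp_contMDiffOn (ha.comp (s := s)
    Y.G.contMDiff_tgt.contMDiffOn fun g hg => hg.1.1)
  have h2 := Y.isExtension.j_hom.smooth.comp_contMDiffOn (hb.comp (s := s)
    Y.G.contMDiff_src.contMDiffOn fun g hg => hg.2.1)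
  have h3 := LieGroupoid.contMDiffOn_mul (LieGroupoid.contMDiffOn_mul
    (LieGroupoid.contMDiffOn_inv h1) (contMDiffOn_id (s := s)) ?_) h2 ?_
  · refine ((D.smooth_inv i j).comp h3 ?_).congr ?_
    all_goals
      intro g hg
      have c1 : K.src (a (Y.G.toGroupoidOn.tgt g)) = Y.G.tgt g := has _ hg.1.1
      have c2 : K.src (b (Y.G.toGroupoidOn.src g)) = Y.G.src g := hbs _ hg.2.1
      have c3 := hg.1.2
      have c4 := hg.2.2
      have c5 := Y.j_mul (a (Y.G.tgt g)) (K.inv (D.δ j (Y.G.tgt g))) (by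
        rw [K.src_inv, D.src_δ]; exact c1)
      have c6 := Y.j_mul (b (Y.G.src g)) (K.inv (D.δ i (Y.G.src g))) (by
        rw [K.src_inv, D.src_δ]; exact c2)
      simp (maxDischargeDepth := 8) [solve, LieGroupoid.src_mul, LieGroupoid.src_inv,
        LieGroupoid.tgt_mul, LieGroupoid.tgt_inv, LieGroupoid.mul_assoc, c5, c6, Y.j_inv,
        LieGroupoid.inv_mul_rev, LieGroupoid.inv_inv, Y.src_j, Y.tgt_j,
        D.src_δ, c1, c2, c3, c4]
  all_goals
    intro g hg
    have c1 : K.src (a (Y.G.toGroupoidOn.tgt g)) = Y.G.tgt g := has _ hg.1.1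
    have c2 : K.src (b (Y.G.toGroupoidOn.src g)) = Y.G.src g := hbs _ hg.2.1
    simp (maxDischargeDepth := 8) [LieGroupoid.src_mul, LieGroupoid.src_inv, Y.tgt_j, c1, c2]

theorem coord_mul_inv (i : ι) (p : D.tot) :
    K.mul (D.coord i p) (K.inv (D.δ i (D.proj p))) = D.toK p := by
  simp (maxDischargeDepth := 8) [coord, proj, LieGroupoid.mul_assoc, K.tgt_eq, D.src_δ,
    LieGroupoid.mul_inv, LieGroupoid.mul_one', GroupBundle.src_inv]

theorem isTwistStr_quotient : IsSubmersionFrom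
    (D.bitorsor.Tot.model.prod (X.G.Arr.model.prod D.bitorsor.Tot.model))
    (twistMfd D.twistStr).model (tripleSet D.bitorsor X) (twistMk D.twistStr) := by
  refine ⟨fun F hF => D.contMDiffOn_of_ofTwist (D.contMDiffOn_mul_toFun_mul.congr fun z hz =>
    congrArg D.ofTwist (hF ⟨z, hz⟩)), ?_⟩
  rintro ⟨⟨q₀, h₀, p₀⟩, hq₀, hp₀⟩
  have hq₀ : K.src (D.toK q₀) = X.G.tgt h₀ := hq₀
  have hp₀ : K.src (D.toK p₀) = X.G.src h₀ := hp₀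
  obtain ⟨j, hj⟩ := D.cover (X.G.tgt h₀)
  obtain ⟨i, hi⟩ := D.cover (X.G.src h₀)
  have ej : K.src (D.coord j q₀) = X.G.tgt h₀ := (D.src_coord j q₀).trans hq₀
  have ei : K.src (D.coord i p₀) = X.G.src h₀ := (D.src_coord i p₀).trans hp₀
  obtain ⟨V, hV, hqV, a, ha, ha₀, has⟩ := exists_localSection K.isLie.src_submersion (D.coord j q₀)
  obtain ⟨W, hW, hpW, b, hb, hb₀, hbs⟩ := exists_localSection K.isLie.src_submersion (D.coord i p₀)
  have hqV : X.G.tgt h₀ ∈ V := ej ▸ hqV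
  have hpW : X.G.src h₀ ∈ W := ei ▸ hpW
  have ha₀ : a (X.G.tgt h₀) = D.coord j q₀ := ej ▸ ha₀
  have hb₀ : b (X.G.src h₀) = D.coord i p₀ := ei ▸ hb₀
  -- The lifts of `g` along `ofTwist`: the two outer factors are local sections of the bitorsor,
  -- and they determine the middle factor.
  let q : Y.G.Arr → K.Arr := fun g => K.mul (a (Y.G.tgt g)) (K.inv (D.δ j (Y.G.tgt g)))
  let p : Y.G.Arr → K.Arr := fun g => K.mul (b (Y.G.src g)) (K.inv (D.δ i (Y.G.src g)))
  let s : Set Y.G.Arr :=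
    {g | (Y.G.tgt g ∈ V ∧ Y.G.tgt g ∈ D.U j) ∧ Y.G.src g ∈ W ∧ Y.G.src g ∈ D.U i}
  have hs : IsOpen s := ((hV.inter (D.isOpen_U j)).preimage Y.G.contMDiff_tgt.continuous).inter
    ((hW.inter (D.isOpen_U i)).preimage Y.G.contMDiff_src.continuous)
  have hq : ∀ g ∈ s, K.src (q g) = Y.G.tgt g := fun g hg => by
    simp only [q]
    rw [K.src_mul _ _ (by rw [K.src_inv, D.src_δ]; exact has _ hg.1.1), K.src_inv, D.src_δ]
  have hp : ∀ g ∈ s, K.src (p g) = Y.G.src g := fun g hg => by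
    simp only [p]
    rw [K.src_mul _ _ (by rw [K.src_inv, D.src_δ]; exact hbs _ hg.2.1), K.src_inv, D.src_δ]
  have hqs : ContMDiffOn Y.G.Arr.model D.tot.model ∞ (fun g => D.ofK (q g)) s := by
    refine D.contMDiffOn_of_coord j (fun g hg => (congrArg (· ∈ D.U j) (hq g hg)).mpr hg.1.2) ((ha.comp
      Y.G.contMDiff_tgt.contMDiffOn fun g hg => hg.1.1).congr fun g hg => ?_)
    change K.mul (q g) (D.δ j (K.src (q g))) = a (Y.G.tgt g)
    have c := has _ hg.1.1
    rw [hq g hg]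
    simp (maxDischargeDepth := 8) [q, LieGroupoid.mul_assoc, GroupBundle.src_inv, K.tgt_eq, D.src_δ,
      LieGroupoid.inv_mul, LieGroupoid.mul_one', c]
  have hps : ContMDiffOn Y.G.Arr.model D.tot.model ∞ (fun g => D.ofK (p g)) s := by
    refine D.contMDiffOn_of_coord i (fun g hg => (congrArg (· ∈ D.U i) (hp g hg)).mpr hg.2.2) ((hb.comp
      Y.G.contMDiff_src.contMDiffOn fun g hg => hg.2.1).congr fun g hg => ?_)
    change K.mul (p g) (D.δ i (K.src (p g))) = b (Y.G.src g)
    have c := hbs _ hg.2.1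
    rw [hp g hg]
    simp (maxDischargeDepth := 8) [p, LieGroupoid.mul_assoc, GroupBundle.src_inv, K.tgt_eq, D.src_δ,
      LieGroupoid.inv_mul, LieGroupoid.mul_one', c]
  have h1 : Y.G.tgt (D.ofTwist (tensor q₀ h₀ p₀ hq₀ hp₀)) = X.G.tgt h₀ :=
    (D.tgt_ofTwist _).trans hq₀
  have h2 : Y.G.src (D.ofTwist (tensor q₀ h₀ p₀ hq₀ hp₀)) = X.G.src h₀ :=
    (D.src_ofTwist _).trans hp₀
  have hq' : q (D.ofTwist (tensor q₀ h₀ p₀ hq₀ hp₀)) = D.toK q₀ := by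
    simp only [q]
    rw [h1, ha₀]
    exact (congrArg (fun x => K.mul (D.coord j q₀) (K.inv (D.δ j x))) hq₀.symm).trans
      (D.coord_mul_inv j q₀)
  have hp' : p (D.ofTwist (tensor q₀ h₀ p₀ hq₀ hp₀)) = D.toK p₀ := by
    simp only [p]
    rw [h2, hb₀]
    exact (congrArg (fun x => K.mul (D.coord i p₀) (K.inv (D.δ i x))) hp₀.symm).trans
      (D.coord_mul_inv i p₀)
  refine ⟨D.twistDiffeo ⁻¹' s, hs.preimage D.twistDiffeo.contMDiff.continuous, ?_,
    (fun g => (D.ofK (q g), D.solve (q g) (p g) g, D.ofK (p g))) ∘ D.twistDiffeo, ?_, ?_, ?_⟩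
  · exact ⟨⟨(congrArg (· ∈ V) h1).mpr hqV, (congrArg (· ∈ D.U j) h1).mpr hj⟩,
      (congrArg (· ∈ W) h2).mpr hpW, (congrArg (· ∈ D.U i) h2).mpr hi⟩
  · exact (hqs.prodMk ((D.contMDiffOn_solve ha hb has hbs).prodMk hps)).comp
      D.twistDiffeo.contMDiff.contMDiffOn fun _ h => h
  · refine Prod.ext hq' (Prod.ext ?_ hp')
    change D.solve (q (D.ofTwist (tensor q₀ h₀ p₀ hq₀ hp₀)))
      (p (D.ofTwist (tensor q₀ h₀ p₀ hq₀ hp₀))) (D.ofTwist (tensor q₀ h₀ p₀ hq₀ hp₀)) = h₀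
    rw [hq', hp']
    exact D.solve_mul hq₀ hp₀
  · intro y hy
    have c1 := hq _ hy
    have c2 := hp _ hy
    refine ⟨⟨(D.tgt_solve c1 c2).symm, (D.src_solve c1 c2).symm⟩, ?_⟩
    exact D.ofTwist_injective (D.mul_solve c1 c2)

theorem isTwistStr : IsTwistStr D.twistStr :=
  ⟨D.isTwistStr_quotient, D.isLie_twist, D.isExtension_twist⟩

/-- The isomorphism of extensions from `P ⊗_K X ⊗_K P⁻¹` to `Y`. -/
noncomputable def extIso : ExtIso (twist D.bitorsor X D.twistStr D.isTwistStr) Y where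
  toDiffeo := D.twistDiffeo
  isHom :=
    { smooth := D.twistDiffeo.contMDiff
      map_src := D.src_ofTwist
      map_tgt := D.tgt_ofTwist
      map_mul := D.ofTwist_mul }
  comp_j := D.ofTwist_j
  π_comp := D.π_ofTwist

end TwistedIso

end LieExt

open LieExt in
theorem proposition4p7 (M : Mfd.{u}) [T2Space M] (K : GroupBundle M) (E : LieGroupoid M)
    (hE : E.IsRegular) (G H : Extension K E) (T : Set M) (hT : E.IsCompleteTransversal T)
    (φ : RestrIso H G T) :
    ∃ (P : Bitorsor K K) (α : T → P.Tot) (hα : IsCentralSection P T α)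
      (S : MfdStr (Twist P H)) (hS : IsTwistStr S) (ψ : ExtIso (twist P H S hS) G),
      ψ.restr T ∘ sectionHat hα.toIsSectionOver S hS = φ.toEquiv := by
  obtain ⟨D, α, hαs, hα, hφ⟩ := φ.exists_twistedIso hT
  have hsec : IsCentralSection D.bitorsor T (fun x => D.ofK (α x)) :=
    { smooth := fun F hF => by
        refine D.contMDiffOn_of_cover (b := id) continuous_id fun i => ?_
        have hF' : ∀ x ∈ T, F x = D.ofK (α x) := fun x hx => hF ⟨x, hx⟩
        have hp : ∀ x ∈ T, D.proj (F x) = x := fun x hx =>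
          (congrArg D.proj (hF' x hx)).trans (hαs x)
        refine D.contMDiffOn_of_coord i (fun x hx => (hp x hx.1).symm ▸ hx.2)
          ((hα i).congr fun x hx => ?_)
        rw [hF' x hx.1]
        exact congrArg (fun y => K.mul (α x) (D.δ i y)) (hαs x)
      proj_eq := fun x => hαs x
      central := fun x k hk => by
        have h := hφ (H.j k) ⟨by rw [H.src_j, hk]; exact x.2, by rw [H.tgt_j, hk]; exact x.2⟩
        rw [φ.ext_j (hk ▸ x.2), H.src_j, H.tgt_j, hk, ← D.j_θ] at h
        have c := hαs x
        have hθ := (D.src_θ k).trans hk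
        refine G.j_injective ?_
        change G.j (K.mul (α x) (D.θ k)) = G.j (K.mul k (α x))
        have s : G.G.src (G.G.mul (G.j (α x)) (G.j (D.θ k))) = x := by
          rw [G.G.src_mul _ _ (by rw [G.src_j, G.tgt_j, c, hθ]), G.src_j, hθ]
        rw [G.j_mul _ _ (c.trans hθ.symm), G.j_mul _ _ (hk.trans c.symm), ← h,
          G.G.mul_assoc _ _ _ (by rw [s, G.G.tgt_inv, G.src_j, c]) (G.G.src_inv _), G.G.inv_mul,
          LieGroupoid.mul_one' (by rw [s, G.src_j, c])] }
  refine ⟨D.bitorsor, fun x => D.ofK (α x), hsec, D.twistStr, D.isTwistStr, D.extIso, ?_⟩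
  funext h
  apply Subtype.ext
  rw [← φ.ext_coe]
  exact hφ h h.2
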